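/- **Theorem.** Fix a side length $L>0$, put $V=L^3$, and let $\Lambda>0$ be an ultraviolet cutoff. The photon modes are the pairs $(k,\lambda)$ with $k\in\frac{2\pi}{L}\mathbb Z^3$, $0<|k|<\Lambda$, $\lambda\in\{1,2\}$; let $\varepsilon_\lambda(k)\in\mathbb R^3$ be polarization vectors, $\varepsilon_\lambda(k)\cdot\varepsilon_{\lambda'}(k)=\delta_{\lambda\lambda'}$, $\varepsilon_\lambda(k)\cdot k=0$. Let $a_\lambda(k),a^*_\lambda(k)$ be the annihilation and creation operators on the Fock space $\mathcal F$ over these modes, with $[a_\lambda(k),a^*_{\lambda'}(k')]=\delta_{\lambda\lambda'}\delta_{kk'}$ and all other commutators zero, and put $$A(x)=\frac1{\sqrt{2V}}\sum_{0<|k|<\Lambda}\sum_{\lambda=1,2}\frac{\varepsilon_\lambda(k)}{\sqrt{|k|}}\bigl[a_\lambda(k)e^{ik\cdot x}+a^*_\lambda(k)e^{-ik\cdot x}\bigr],\qquad H_f=\sum_{0<|k|<\Lambda}\sum_{\lambda=1,2}|k|\,a^*_\lambda(k)a_\lambda(k).$$ For $\alpha>0$ and $N\ge1$ let $$H(N)=\sum_{j=1}^N\tfrac12\bigl(p_j+\sqrt\alpha\,A(x_j)\bigr)^2+H_f,\qquad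 p_j=-i\nabla_{x_j},$$ act on permutation-symmetric functions in $L^2(\mathbb R^{3N})\otimes\mathcal F$, with domain the symmetric functions having finitely many non-zero amplitudes in the photon occupation number basis, each smooth and compactly supported in $(x_1,\dots,x_N)$, and let $$E_0^{boson}(N)=\inf_{\Psi\ne0}\frac{\langle\Psi,H(N)\Psi\rangle}{\langle\Psi,\Psi\rangle}$$ over this domain. There are universal constants $C_1,C_2>0$ such that for every $\alpha>0$ there is $\Lambda_0>0$, depending only on $\alpha$, such that for all $\Lambda\ge\Lambda_0$, all $L$ with $2\pi/L<\Lambda$ (i.e. at least one photon mode is present), and all choices of polarization vectors: 1. for all $N\ge1$, $$C_1\sqrt N\,\sqrt\alpha\,\Lambda^{3/2}\le E_0^{boson}(N)\le C_2\,N^{5/7}\alpha^{2/7}\Lambda^{12/7};$$ 2. the energy is sublinear in $N$: $E_0^{boson}(N)/N\to0$ as $N\to\infty$; 3. charged bosons bind: there is $N_0$ such that $E_0^{boson}(N)<N\,E_0^{boson}(1)$ for all $N\ge N_0$. -/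

import Mathlib

namespace NRQED

noncomputable section

/-- Physical space `ℝ³` with its Euclidean norm. -/
abbrev Space : Type := EuclideanSpace ℝ (Fin 3)

/-- Configurations `(x₁, …, x_N)` of `N` particles in `ℝ³`. -/
abbrev Config (N : ℕ) : Type := Fin N → Space

/-- The wave vector `k = 2πn/L`, `n ∈ ℤ³`, of the box of side `L`. -/
def waveVec (L : ℝ) (n : Fin 3 → ℤ) : Space :=
  WithLp.toLp 2 fun c => 2 * Real.pi * (n c : ℝ) / L

open Classical in
/-- The set of all `n ∈ ℤ³` with `n ≠ 0` and `|2πn/L| < Λ` (see `mem_modes`); it is cut out of a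
finite box of integers so that its finiteness is built in. -/
def modes (L Λ : ℝ) : Finset (Fin 3 → ℤ) :=
  (Fintype.piFinset fun _ : Fin 3 =>
    Finset.Icc (-⌈Λ * L / (2 * Real.pi)⌉) ⌈Λ * L / (2 * Real.pi)⌉).filter
      fun n => n ≠ 0 ∧ ‖waveVec L n‖ < Λ

theorem mem_modes {L : ℝ} (hL : 0 < L) (Λ : ℝ) (n : Fin 3 → ℤ) :
    n ∈ modes L Λ ↔ n ≠ 0 ∧ ‖waveVec L n‖ < Λ := by
  classical
  unfold modes
  rw [Finset.mem_filter, Fintype.mem_piFinset, and_iff_right_iff_imp]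
  rintro ⟨-, h⟩ c
  have hpi : (0 : ℝ) < 2 * Real.pi := by positivity
  have h1 : |2 * Real.pi * (n c : ℝ) / L| ≤ Λ := by
    have h2 := PiLp.norm_apply_le (waveVec L n) c
    simp only [waveVec, Real.norm_eq_abs] at h2
    exact h2.trans h.le
  rw [abs_le, le_div_iff₀ hL, div_le_iff₀ hL] at h1
  have hub : (n c : ℝ) ≤ Λ * L / (2 * Real.pi) := by
    rw [le_div_iff₀ hpi]; linarith [h1.2]
  have hlb : -(n c : ℝ) ≤ Λ * L / (2 * Real.pi) := by
    rw [le_div_iff₀ hpi]; linarith [h1.1]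
  rw [Finset.mem_Icc]
  constructor
  · have : (-(n c) : ℤ) ≤ ⌈Λ * L / (2 * Real.pi)⌉ := by
      have h3 := hlb.trans (Int.le_ceil _)
      exact_mod_cast h3
    linarith
  · have h3 := hub.trans (Int.le_ceil _)
    exact_mod_cast h3

/-- Photon modes: a wave vector below the cutoff together with one of two polarizations. -/
abbrev Mode (L Λ : ℝ) : Type := ↥(modes L Λ) × Fin 2

/-- The wave vector of a photon mode. -/
def Mode.k {L Λ : ℝ} (i : Mode L Λ) : Space := waveVec L i.1.1

/-- `ε n s` (`s = 0, 1`) are real polarization vectors for all wave vectors `k = 2πn/L` below the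
cutoff: they are orthonormal and orthogonal to `k`. -/
def IsPolarization (L Λ : ℝ) (ε : (Fin 3 → ℤ) → Fin 2 → Space) : Prop :=
  ∀ n ∈ modes L Λ,
    (∀ s t : Fin 2, inner ℝ (ε n s) (ε n t) = if s = t then (1 : ℝ) else 0) ∧
    ∀ s : Fin 2, inner ℝ (ε n s) (waveVec L n) = 0

/-- Wave functions of `N` particles and the photon field in the occupation number representation:
`Ψ ν x` is the amplitude at the configuration `x` of the normalized Fock vector with `ν i` photons
in each mode `i`. The square-summable ones form
`L²(ℝ^{3N}) ⊗ ℱ = L²(ℝ^{3N}) ⊗ ℓ²(ℕ^modes)`. -/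
abbrev WaveFn (L Λ : ℝ) (N : ℕ) : Type := (Mode L Λ → ℕ) → Config N → ℂ

variable {L Λ : ℝ} {N : ℕ}

/-- The inner product of `L²(ℝ^{3N}) ⊗ ℱ`. -/
def innerProd (Ψ Φ : WaveFn L Λ N) : ℂ :=
  ∑' ν : Mode L Λ → ℕ, ∫ x : Config N, (starRingEnd ℂ) (Ψ ν x) * Φ ν x

/-- The annihilation operator `a_i` of the mode `i`. -/
def annihilate (i : Mode L Λ) (Ψ : WaveFn L Λ N) : WaveFn L Λ N :=
  fun ν x => (Real.sqrt ((ν i : ℝ) + 1) : ℂ) * Ψ (ν + Pi.single i 1) x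

/-- The creation operator `a_i^*` of the mode `i` (the factor vanishes where `ν i = 0`). -/
def create (i : Mode L Λ) (Ψ : WaveFn L Λ N) : WaveFn L Λ N :=
  fun ν x => (Real.sqrt (ν i : ℝ) : ℂ) * Ψ (ν - Pi.single i 1) x

/-- The component `A_c(x_j)` of the quantized vector potential at the position of particle `j`,
`A(x) = (2V)^{-1/2} ∑_{k,s} |k|^{-1/2} ε_s(k) (a_s(k) e^{ik·x} + a_s^*(k) e^{-ik·x})`,
`V = L³`. -/
def vectorPotential (ε : (Fin 3 → ℤ) → Fin 2 → Space) (j : Fin N) (c : Fin 3)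
    (Ψ : WaveFn L Λ N) : WaveFn L Λ N :=
  fun ν x => (1 / Real.sqrt (2 * L ^ 3) : ℂ) *
    ∑ i : Mode L Λ, ((ε i.1.1 i.2 c / Real.sqrt ‖i.k‖ : ℝ) : ℂ) *
      (Complex.exp (Complex.I * (inner ℝ i.k (x j) : ℝ)) * annihilate i Ψ ν x +
        Complex.exp (-(Complex.I * (inner ℝ i.k (x j) : ℝ))) * create i Ψ ν x)

/-- The momentum component `(p_j)_c = -i ∂/∂x_{j,c}` of particle `j`. -/
def momentum (j : Fin N) (c : Fin 3) (Ψ : WaveFn L Λ N) : WaveFn L Λ N :=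
  fun ν x => -Complex.I *
    fderiv ℝ (Ψ ν) x (Pi.single j (EuclideanSpace.single c (1 : ℝ)))

/-- The component `(p_j + √α A(x_j))_c`. -/
def covMomentum (α : ℝ) (ε : (Fin 3 → ℤ) → Fin 2 → Space) (j : Fin N) (c : Fin 3)
    (Ψ : WaveFn L Λ N) : WaveFn L Λ N :=
  momentum j c Ψ + (Real.sqrt α : ℂ) • vectorPotential ε j c Ψ

/-- The field energy `H_f = ∑_{k,s} |k| a_s^*(k) a_s(k)`. -/
def fieldEnergy (Ψ : WaveFn L Λ N) : WaveFn L Λ N :=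
  ∑ i : Mode L Λ, (‖i.k‖ : ℂ) • create i (annihilate i Ψ)

/-- The Hamiltonian `H(N) = ∑_j ½ (p_j + √α A(x_j))² + H_f`. -/
def hamiltonian (α : ℝ) (ε : (Fin 3 → ℤ) → Fin 2 → Space) (Ψ : WaveFn L Λ N) :
    WaveFn L Λ N :=
  (∑ j : Fin N, (1 / 2 : ℂ) •
      ∑ c : Fin 3, covMomentum α ε j c (covMomentum α ε j c Ψ)) + fieldEnergy Ψ

/-- The dense domain on which the Hamiltonian of `N` bosons is given: permutation-symmetric wave
functions with finitely many nonzero photon amplitudes (polynomials in the creation operators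
applied to the vacuum), each of them smooth and compactly supported in the configuration. -/
structure IsBosonic (Ψ : WaveFn L Λ N) : Prop where
  finite_support : {ν | Ψ ν ≠ 0}.Finite
  smooth : ∀ ν, ContDiff ℝ (⊤ : ℕ∞) (Ψ ν)
  compact_support : ∀ ν, HasCompactSupport (Ψ ν)
  symmetric : ∀ (σ : Equiv.Perm (Fin N)) ν x, Ψ ν (fun j => x (σ j)) = Ψ ν x

/-- The ground state energy `inf_Ψ ⟨Ψ, HΨ⟩ / ⟨Ψ, Ψ⟩` of `N` bosons. The infimum over the domain
above is the bottom of the spectrum of the (Friedrichs) self-adjoint operator `H(N)`. -/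
def bosonEnergy (L Λ α : ℝ) (ε : (Fin 3 → ℤ) → Fin 2 → Space) (N : ℕ) : ℝ :=
  sInf {E : ℝ | ∃ Ψ : WaveFn L Λ N, IsBosonic Ψ ∧ Ψ ≠ 0 ∧
    E = (innerProd Ψ (hamiltonian α ε Ψ)).re / (innerProd Ψ Ψ).re}

end

end NRQED

/-! The two bounds on the energy are independent, and claims 2 and 3 follow from them: `N ^ (5/7) =
o(N)`, while the lower bound makes the energy of one boson strictly positive.

Lower bound (`energy_lower_bound`). Let `P_j = p_j + √α A(x_j)` and let `D_j` be the creation part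
of a transverse field at `x_j` with mode weights proportional to `√|k|`, essentially the electric
field. Then `∑_c [P_{j,c}, D_{j,c}] = √α ρ`, where `ρ ∼ Λ³` is the number of modes divided by `2L³`
(`sum_commutator`). As in an uncertainty principle, kinetic energy and field energy cannot both be
small: `∑_c ‖D*_{j,c} Ψ‖²` is at most `ρ ⟨H_f⟩`, and `D_j` exceeds `D_j*` only by a zero-point term.
Weighting the two energies optimally and summing over `j` gives `√α √(Nρ/2) - Λ/2`. For large `Λ`
the zero-point loss is at most half of the main term.

Upper bound (`exists_bosonEnergy_upper_bound`). All particles are put into one real orbital `φ`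
living in a box of size `r`, tensored with one photon state `F`. Since `½(p + √α A)² ≤ p² + α A²`,
the field only feels the quadratic form `αN ∫ φ² A²`, plus `H_f`, which is at most `Λ` times the
photon number. The vector potentials at different points have real mutual inner products, so there
are photon modes `b_m` with `A_c(x) = ∑ ρ_m(x,c) (b_m + b_m*)`, `ρ_m` real, in which the form is
diagonal with entries `g_m` (`exists_diagonal_modes`). Squeezing each `b_m` separately costs about
`√(αNΛ g_m)` per mode (`exists_squeezed_state`, `coupled_oscillator_le`).

It remains to bound `∑ √g_m`, the trace norm of the operator with rows `φ ρ_m`, uniformly in `L`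
(`sum_sqrt_le`). The rows are an explicit kernel inverting `1 + Λ⁻¹∂` in each direction on the box,
applied to functions that are still small because all `|k| < Λ`. Both factors are Hilbert–Schmidt,
with squared norms of order `(rΛ)³` and `Λ²`, so the trace norm is `O(Λ (rΛ)^(3/2))`. Balancing `N /
r²` against `√(αNΛ) Λ (rΛ)^(3/2)` gives `r = N^(1/7) α^(-1/7) Λ^(-6/7)` and the stated exponents. -/

namespace NRQED

noncomputable section

open MeasureTheory

variable {L Λ : ℝ} {N M : ℕ}

/-! ### The pre-Hilbert space of smooth vectors -/

/-- Wave functions with finitely many nonzero photon amplitudes, each of them smooth and compactly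
supported; no permutation symmetry is required. -/
def smoothVectors (L Λ : ℝ) (N : ℕ) : Submodule ℂ (WaveFn L Λ N) where
  carrier := {Ψ | {ν | Ψ ν ≠ 0}.Finite ∧
    ∀ ν, ContDiff ℝ (⊤ : ℕ∞) (Ψ ν) ∧ HasCompactSupport (Ψ ν)}
  add_mem' := by
    rintro Ψ Φ ⟨h1, h2⟩ ⟨h3, h4⟩
    refine ⟨(h1.union h3).subset ?_, fun ν => ⟨(h2 ν).1.add (h4 ν).1, (h2 ν).2.add (h4 ν).2⟩⟩
    intro ν hν
    by_contra hc
    simp only [Set.mem_union, Set.mem_ofPred_eq, not_or, not_not] at hc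
    exact hν (by simp [hc.1, hc.2])
  zero_mem' := ⟨by simp, fun ν => ⟨contDiff_const, HasCompactSupport.zero⟩⟩
  smul_mem' := by
    rintro c Ψ ⟨h1, h2⟩
    refine ⟨h1.subset ?_, fun ν => ⟨(h2 ν).1.const_smul c, ?_⟩⟩
    · intro ν hν hc
      exact hν (by simp [hc])
    · exact (h2 ν).2.smul_left (f := fun _ => c)

/-- The space `smoothVectors`, to be normed by the inner product of `L²(ℝ^{3N}) ⊗ ℱ`. -/
def SmoothVec (L Λ : ℝ) (N : ℕ) : Type := smoothVectors L Λ N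

instance : AddCommGroup (SmoothVec L Λ N) := inferInstanceAs (AddCommGroup (smoothVectors L Λ N))
instance : Module ℂ (SmoothVec L Λ N) := inferInstanceAs (Module ℂ (smoothVectors L Λ N))

namespace SmoothVec

/-- The inclusion of `SmoothVec` into all wave functions. -/
def val : SmoothVec L Λ N →ₗ[ℂ] WaveFn L Λ N := (smoothVectors L Λ N).subtype

theorem val_injective : Function.Injective (val : SmoothVec L Λ N → WaveFn L Λ N) :=
  Subtype.val_injective

theorem ext_val {Ψ Φ : SmoothVec L Λ N} (h : Ψ.val = Φ.val) : Ψ = Φ := val_injective h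

theorem finite (Ψ : SmoothVec L Λ N) : {ν | Ψ.val ν ≠ 0}.Finite := Ψ.2.1
theorem smooth (Ψ : SmoothVec L Λ N) (ν) : ContDiff ℝ (⊤ : ℕ∞) (Ψ.val ν) := (Ψ.2.2 ν).1
theorem compact (Ψ : SmoothVec L Λ N) (ν) : HasCompactSupport (Ψ.val ν) := (Ψ.2.2 ν).2
theorem continuous (Ψ : SmoothVec L Λ N) (ν) : Continuous (Ψ.val ν) := (Ψ.smooth ν).continuous
theorem differentiable (Ψ : SmoothVec L Λ N) (ν) : Differentiable ℝ (Ψ.val ν) :=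
  (Ψ.smooth ν).differentiable (by simp)

theorem integrable_conj_mul (Ψ Φ : SmoothVec L Λ N) (ν) :
    Integrable (fun x => (starRingEnd ℂ) (Ψ.val ν x) * Φ.val ν x) := by
  refine Continuous.integrable_of_hasCompactSupport ?_ ?_
  · exact (Complex.continuous_conj.comp (Ψ.continuous ν)).mul (Φ.continuous ν)
  · exact (Φ.compact ν).mul_left

theorem summable_inner (Ψ Φ : SmoothVec L Λ N) :
    Summable fun ν => ∫ x, (starRingEnd ℂ) (Ψ.val ν x) * Φ.val ν x := by
  refine summable_of_hasFiniteSupport (Φ.finite.subset ?_)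
  intro ν hν hc
  exact hν (by simp [hc])

theorem integral_conj_mul_self (Ψ : SmoothVec L Λ N) (ν) :
    ∫ x, (starRingEnd ℂ) (Ψ.val ν x) * Ψ.val ν x = ((∫ x, ‖Ψ.val ν x‖ ^ 2 : ℝ) : ℂ) := by
  rw [← integral_complex_ofReal]
  refine integral_congr_ae (Filter.Eventually.of_forall fun x => ?_)
  simp only
  rw [mul_comm, Complex.mul_conj, Complex.normSq_eq_norm_sq]

instance core : InnerProductSpace.Core ℂ (SmoothVec L Λ N) where
  inner Ψ Φ := innerProd Ψ.val Φ.val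
  conj_inner_symm Ψ Φ := by
    simp only [innerProd, Complex.conj_tsum]
    refine tsum_congr fun ν => ?_
    rw [← integral_conj]
    simp [mul_comm]
  re_inner_nonneg Ψ := by
    change 0 ≤ Complex.reCLM _
    rw [innerProd, Complex.reCLM.map_tsum (summable_inner Ψ Ψ)]
    refine tsum_nonneg fun ν => ?_
    rw [integral_conj_mul_self]
    exact integral_nonneg fun x => by positivity
  add_left Ψ Φ X := by
    simp only [innerProd]
    rw [← (summable_inner Ψ X).tsum_add (summable_inner Φ X)]
    refine tsum_congr fun ν => ?_
    rw [← integral_add (integrable_conj_mul Ψ X ν) (integrable_conj_mul Φ X ν)]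
    simp [add_mul]
  smul_left Ψ Φ r := by
    simp only [innerProd, ← tsum_mul_left, ← integral_const_mul]
    simp [mul_assoc]
  definite Ψ h := by
    apply ext_val
    have hr : Complex.reCLM (innerProd Ψ.val Ψ.val) = 0 := by
      have : innerProd Ψ.val Ψ.val = 0 := h
      rw [this]; simp
    have hs := Complex.reCLM.summable (summable_inner Ψ Ψ)
    rw [innerProd, Complex.reCLM.map_tsum (summable_inner Ψ Ψ)] at hr
    simp only [integral_conj_mul_self, Complex.reCLM_apply, Complex.ofReal_re] at hr hs
    have h0 := (hasSum_zero_iff_of_nonneg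
      (fun ν => integral_nonneg fun x => by positivity)).1 (hr ▸ hs.hasSum)
    funext ν x
    have h1 := congrFun h0 ν
    have hc : Continuous fun x => ‖Ψ.val ν x‖ ^ 2 := ((Ψ.continuous ν).norm).pow 2
    -- Definiteness holds pointwise, not merely almost everywhere, because the amplitudes are
    -- continuous.
    have h2 := (hc.integral_pos_of_hasCompactSupport_nonneg_nonzero (μ := volume) (x := x) ?_
      (fun x => by positivity))
    · by_contra hx
      have h3 := h2 (by simpa using hx)
      simp only [Pi.zero_apply] at h1
      linarith
    · have := (Ψ.compact ν).norm
      exact this.comp_left (g := fun t : ℝ => t ^ 2) (by simp)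

instance : NormedAddCommGroup (SmoothVec L Λ N) := core.toNormedAddCommGroup
instance : InnerProductSpace ℂ (SmoothVec L Λ N) := InnerProductSpace.ofCore core.toCore

theorem inner_def (Ψ Φ : SmoothVec L Λ N) : inner ℂ Ψ Φ = innerProd Ψ.val Φ.val := rfl

theorem norm_sq (Ψ : SmoothVec L Λ N) : ‖Ψ‖ ^ 2 = (innerProd Ψ.val Ψ.val).re := by
  rw [← inner_def]; exact norm_sq_eq_re_inner (𝕜 := ℂ) Ψ

end SmoothVec

/-! ### Elementary operators: adjoints and commutation relations -/

/-- Restriction of an additive, homogeneous operation on wave functions to smooth vectors. -/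
def liftOp (T : WaveFn L Λ N → WaveFn L Λ N) (ha : ∀ Ψ Φ : SmoothVec L Λ N, T (Ψ.val + Φ.val) = T Ψ.val + T Φ.val)
    (hs : ∀ (c : ℂ) (Ψ : SmoothVec L Λ N), T (c • Ψ.val) = c • T Ψ.val)
    (hm : ∀ Ψ : SmoothVec L Λ N, T Ψ.val ∈ smoothVectors L Λ N) : Module.End ℂ (SmoothVec L Λ N) where
  toFun Ψ := ⟨T Ψ.val, hm Ψ⟩
  map_add' Ψ Φ := Subtype.ext (ha Ψ Φ)
  map_smul' c Ψ := Subtype.ext (hs c Ψ)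

/-- Annihilation operators on smooth vectors. -/
def ann (i : Mode L Λ) : Module.End ℂ (SmoothVec L Λ N) :=
  liftOp (annihilate i) (fun Ψ Φ => by funext ν x; simp [annihilate, mul_add])
    (fun c Ψ => by funext ν x; simp [annihilate]; ring)
    (fun Ψ => by
      refine ⟨?_, fun ν => ⟨contDiff_const.mul (Ψ.smooth _), (Ψ.compact _).mul_left⟩⟩
      refine (Ψ.finite.preimage (f := fun ν => ν + Pi.single i 1)
        (fun a _ b _ h => by simpa using h)).subset ?_
      intro ν hν hc
      exact hν (by funext x; simp [annihilate, hc]))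

/-- Creation operators on smooth vectors. -/
def cre (i : Mode L Λ) : Module.End ℂ (SmoothVec L Λ N) :=
  liftOp (create i) (fun Ψ Φ => by funext ν x; simp [create, mul_add])
    (fun c Ψ => by funext ν x; simp [create]; ring)
    (fun Ψ => by
      refine ⟨?_, fun ν => ⟨contDiff_const.mul (Ψ.smooth _), (Ψ.compact _).mul_left⟩⟩
      refine (Ψ.finite.image (fun ν => ν + Pi.single i 1)).subset ?_
      intro ν hν
      by_cases h0 : ν i = 0
      · exact absurd (by funext x; simp [create, h0]) hν
      refine ⟨ν - Pi.single i 1, fun hc => hν (by funext x; simp [create, hc]), ?_⟩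
      funext j
      by_cases hj : j = i
      · subst hj; simp; omega
      · simp [hj])

/-- Multiplication by a smooth function of the particle positions. -/
def mulBy (u : Config N → ℂ) (hu : ContDiff ℝ (⊤ : ℕ∞) u) : Module.End ℂ (SmoothVec L Λ N) :=
  liftOp (fun Ψ ν x => u x * Ψ ν x) (fun Ψ Φ => by funext ν x; simp [mul_add])
    (fun c Ψ => by funext ν x; simp; ring)
    (fun Ψ => by
      refine ⟨Ψ.finite.subset ?_, fun ν => ⟨hu.mul (Ψ.smooth _), (Ψ.compact _).mul_left⟩⟩
      intro ν hν hc
      exact hν (by funext x; simp [hc]))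

/-- Momentum operators on smooth vectors. -/
def mom (j : Fin N) (c : Fin 3) : Module.End ℂ (SmoothVec L Λ N) :=
  liftOp (momentum j c)
    (fun Ψ Φ => by
      funext ν x
      have : (Ψ.val + Φ.val) ν = Ψ.val ν + Φ.val ν := rfl
      simp only [momentum, this, Pi.add_apply]
      rw [fderiv_add (Ψ.differentiable ν x) (Φ.differentiable ν x)]
      simp [mul_add])
    (fun r Ψ => by
      funext ν x
      have : (r • Ψ.val) ν = r • Ψ.val ν := rfl
      simp only [momentum, this, Pi.smul_apply]
      rw [fderiv_const_smul (Ψ.differentiable ν x)]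
      simp; ring)
    (fun Ψ => by
      refine ⟨Ψ.finite.subset ?_, fun ν => ⟨?_, ?_⟩⟩
      · intro ν hν hc
        exact hν (by funext x; simp [momentum, hc])
      · refine contDiff_const.mul ?_
        exact ((Ψ.smooth ν).fderiv_right (m := (⊤ : ℕ∞)) (by simp)).clm_apply contDiff_const
      · refine HasCompactSupport.mul_left ?_
        exact ((Ψ.compact ν).fderiv (𝕜 := ℝ)).comp_left
          (g := fun T : Config N →L[ℝ] ℂ => T (Pi.single j (EuclideanSpace.single c (1 : ℝ)))) (by simp))

theorem ann_val (i : Mode L Λ) (Ψ : SmoothVec L Λ N) : (ann i Ψ).val = annihilate i Ψ.val := rfl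
theorem cre_val (i : Mode L Λ) (Ψ : SmoothVec L Λ N) : (cre i Ψ).val = create i Ψ.val := rfl
theorem mom_val (j : Fin N) (c : Fin 3) (Ψ : SmoothVec L Λ N) :
    (mom j c Ψ).val = momentum j c Ψ.val := rfl
theorem mulBy_val (u : Config N → ℂ) (hu) (Ψ : SmoothVec L Λ N) (ν x) :
    (mulBy u hu Ψ).val ν x = u x * Ψ.val ν x := rfl

/-- Reindexing by `ν ↦ ν + e_i` is injective; it misses only the indices with `ν i = 0`, where the
creation operator has the factor `√0`. -/
theorem inner_ann_left (i : Mode L Λ) (Ψ Φ : SmoothVec L Λ N) :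
    inner ℂ (ann i Ψ) Φ = inner ℂ Ψ (cre i Φ) := by
  simp only [SmoothVec.inner_def, innerProd, ann_val, cre_val]
  have hinj : Function.Injective (fun ν : Mode L Λ → ℕ => ν + Pi.single i 1) :=
    fun a b h => by simpa using h
  refine Eq.trans ?_ (hinj.tsum_eq (f := fun ν =>
    ∫ x, (starRingEnd ℂ) (Ψ.val ν x) * create i Φ.val ν x) ?_)
  · refine tsum_congr fun ν => ?_
    refine integral_congr_ae (Filter.Eventually.of_forall fun x => ?_)
    have h2 : ν + Pi.single i 1 - Pi.single i 1 = ν := by funext j; simp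
    simp only [annihilate, create, h2, map_mul, Complex.conj_ofReal, Pi.add_apply, Pi.single_eq_same,
      Nat.cast_add, Nat.cast_one]
    ring
  · intro ν hν
    by_cases h0 : ν i = 0
    · exact absurd (by simp [create, h0]) hν
    · refine ⟨ν - Pi.single i 1, ?_⟩
      funext j
      by_cases hj : j = i
      · subst hj; simp; omega
      · simp [hj]

theorem inner_cre_left (i : Mode L Λ) (Ψ Φ : SmoothVec L Λ N) :
    inner ℂ (cre i Ψ) Φ = inner ℂ Ψ (ann i Φ) := by
  rw [← inner_conj_symm, ← inner_ann_left, inner_conj_symm]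

theorem inner_mulBy_left (u u' : Config N → ℂ) (hu hu') (h : ∀ x, u' x = (starRingEnd ℂ) (u x))
    (Ψ Φ : SmoothVec L Λ N) : inner ℂ (mulBy u hu Ψ) Φ = inner ℂ Ψ (mulBy u' hu' Φ) := by
  simp only [SmoothVec.inner_def, innerProd, mulBy_val, h, map_mul]
  refine tsum_congr fun ν => integral_congr_ae (Filter.Eventually.of_forall fun x => ?_)
  simp only
  ring

theorem inner_mom_left (j : Fin N) (c : Fin 3) (Ψ Φ : SmoothVec L Λ N) :
    inner ℂ (mom j c Ψ) Φ = inner ℂ Ψ (mom j c Φ) := by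
  simp only [SmoothVec.inner_def, innerProd, mom_val, momentum]
  refine tsum_congr fun ν => ?_
  set v : Config N := Pi.single j (EuclideanSpace.single c (1 : ℝ))
  have hconj : ∀ x, fderiv ℝ (fun y => (starRingEnd ℂ) (Ψ.val ν y)) x v
      = (starRingEnd ℂ) (fderiv ℝ (Ψ.val ν) x v) := by
    intro x
    have := (Complex.conjCLE.toContinuousLinearMap.hasFDerivAt (x := Ψ.val ν x)).comp x
      (Ψ.differentiable ν x).hasFDerivAt
    have h2 : fderiv ℝ (fun y => (starRingEnd ℂ) (Ψ.val ν y)) x = _ := this.fderiv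
    rw [h2]; simp
  have hcs : HasCompactSupport fun x => fderiv ℝ (Φ.val ν) x v :=
    ((Φ.compact ν).fderiv (𝕜 := ℝ)).comp_left (g := fun T : Config N →L[ℝ] ℂ => T v) (by simp)
  have hcd : ∀ X : SmoothVec L Λ N, Continuous fun x => fderiv ℝ (X.val ν) x v := fun X =>
    ((X.smooth ν).continuous_fderiv (by simp)).clm_apply continuous_const
  -- Integration by parts; compact support gives the integrability and removes boundary terms, and
  -- the factor `-i` turns antisymmetry into symmetry.
  have key := integral_mul_fderiv_eq_neg_fderiv_mul_of_integrable (μ := (volume : Measure (Config N)))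
    (f := fun y => (starRingEnd ℂ) (Ψ.val ν y)) (g := Φ.val ν) (v := v)
    (by
      simp only [hconj]
      exact ((Complex.continuous_conj.comp (hcd Ψ)).mul (Φ.continuous ν)).integrable_of_hasCompactSupport
        (Φ.compact ν).mul_left)
    (by
      exact ((Complex.continuous_conj.comp (Ψ.continuous ν)).mul (hcd Φ)).integrable_of_hasCompactSupport
        hcs.mul_left)
    (SmoothVec.integrable_conj_mul Ψ Φ ν)
    (fun x _ => (Complex.conjCLE.toContinuousLinearMap.differentiableAt).comp x (Ψ.differentiable ν x))
    (fun x _ => Φ.differentiable ν x)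
  simp only [hconj] at key
  have e1 : ∀ x, (starRingEnd ℂ) (-Complex.I * fderiv ℝ (Ψ.val ν) x v) * Φ.val ν x
      = Complex.I * ((starRingEnd ℂ) (fderiv ℝ (Ψ.val ν) x v) * Φ.val ν x) := by
    intro x; simp; ring
  have e2 : ∀ x, (starRingEnd ℂ) (Ψ.val ν x) * (-Complex.I * fderiv ℝ (Φ.val ν) x v)
      = -Complex.I * ((starRingEnd ℂ) (Ψ.val ν x) * fderiv ℝ (Φ.val ν) x v) := by
    intro x; ring
  simp only [e1, e2, integral_const_mul]
  rw [key]; ring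

theorem ann_mul_cre (l i : Mode L Λ) :
    (ann l * cre i : Module.End ℂ (SmoothVec L Λ N)) = cre i * ann l + if l = i then 1 else 0 := by
  refine LinearMap.ext fun Ψ => SmoothVec.ext_val ?_
  funext ν x
  by_cases h : l = i
  · subst h
    have h2 : ν + Pi.single l 1 - Pi.single l 1 = ν := by funext j; simp
    simp only [Module.End.mul_apply, LinearMap.add_apply, map_add, Pi.add_apply, ann_val, cre_val,
      annihilate, create, if_true, Module.End.one_apply, h2]
    by_cases h0 : ν l = 0
    · simp [h0]
    · have h3 : ν - Pi.single l 1 + Pi.single l 1 = ν := by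
        funext j
        by_cases hj : j = l
        · subst hj; simp; omega
        · simp [hj]
      have h4 : (((ν - Pi.single l 1 : Mode L Λ → ℕ) l : ℕ) : ℝ) + 1 = ν l := by
        have : (ν - Pi.single l 1 : Mode L Λ → ℕ) l + 1 = ν l := by simp; omega
        exact_mod_cast this
      rw [h3, h4]
      have e1 : (Real.sqrt (ν l : ℝ) : ℂ) * (Real.sqrt (ν l : ℝ) : ℂ) = (ν l : ℂ) := by
        rw [← Complex.ofReal_mul, Real.mul_self_sqrt (by positivity)]; simp
      have e2 : (Real.sqrt ((ν l : ℝ) + 1) : ℂ) * (Real.sqrt ((ν l : ℝ) + 1) : ℂ) = (ν l : ℂ) + 1 := by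
        rw [← Complex.ofReal_mul, Real.mul_self_sqrt (by positivity)]; simp
      have e3 : ((ν l + (Pi.single l 1 : Mode L Λ → ℕ) l : ℕ) : ℝ) = (ν l : ℝ) + 1 := by simp
      rw [e3, ← mul_assoc, ← mul_assoc, e1, e2]; ring
  · simp only [Module.End.mul_apply, ann_val, cre_val, annihilate, create, if_neg h, add_zero,
      Pi.add_apply]
    have h' : i ≠ l := fun e => h e.symm
    have e1 : ν i + (Pi.single l 1 : Mode L Λ → ℕ) i = ν i := by simp [h']
    have e2 : (ν - Pi.single i 1 : Mode L Λ → ℕ) l = ν l := by simp [h]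
    rw [e1, e2]
    by_cases h0 : ν i = 0
    · simp [h0]
    · have h3 : ν + Pi.single l 1 - Pi.single i 1 = ν - Pi.single i 1 + Pi.single l 1 := by
        funext j
        by_cases hj : j = i
        · subst hj; simp [h']
        · simp [hj]
      rw [h3]; ring

theorem commute_cre (l i : Mode L Λ) : Commute (cre l : Module.End ℂ (SmoothVec L Λ N)) (cre i) := by
  refine LinearMap.ext fun Ψ => SmoothVec.ext_val ?_
  funext ν x
  by_cases h : l = i
  · subst h; rfl
  · have h' : i ≠ l := fun e => h e.symm
    simp only [Module.End.mul_apply, cre_val, create]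
    have e1 : (ν - Pi.single l 1 : Mode L Λ → ℕ) i = ν i := by simp [h']
    have e2 : (ν - Pi.single i 1 : Mode L Λ → ℕ) l = ν l := by simp [h]
    rw [e1, e2, tsub_right_comm]; ring

theorem commute_mulBy_ann (u : Config N → ℂ) (hu) (i : Mode L Λ) :
    Commute (mulBy u hu) (ann i) := by
  refine LinearMap.ext fun Ψ => SmoothVec.ext_val ?_
  funext ν x
  simp only [Module.End.mul_apply, ann_val, mulBy_val, annihilate]; ring

theorem commute_mulBy_cre (u : Config N → ℂ) (hu) (i : Mode L Λ) :
    Commute (mulBy u hu) (cre i) := by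
  refine LinearMap.ext fun Ψ => SmoothVec.ext_val ?_
  funext ν x
  simp only [Module.End.mul_apply, cre_val, mulBy_val, create]; ring

theorem commute_mom_cre (j : Fin N) (c : Fin 3) (i : Mode L Λ) : Commute (mom j c) (cre i) := by
  refine LinearMap.ext fun Ψ => SmoothVec.ext_val ?_
  funext ν x
  simp only [Module.End.mul_apply, cre_val, mom_val, create, momentum]
  have : create i Ψ.val ν = (Real.sqrt (ν i : ℝ) : ℂ) • Ψ.val (ν - Pi.single i 1) := rfl
  rw [this, fderiv_const_smul (Ψ.differentiable _ x)]
  simp; ring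

/-- The plane wave `x ↦ e^{is k·x_j}`. -/
def planeWave (s : ℝ) (j : Fin N) (k : Space) : Config N → ℂ :=
  fun x => Complex.exp (Complex.I * ((s * inner ℝ k (x j) : ℝ) : ℂ))

theorem contDiff_planeWave (s : ℝ) (j : Fin N) (k : Space) :
    ContDiff ℝ (⊤ : ℕ∞) (planeWave s j k) := by
  unfold planeWave
  refine Complex.contDiff_exp.comp (contDiff_const.mul (Complex.ofRealCLM.contDiff.comp ?_))
  exact contDiff_const.mul (contDiff_const.inner ℝ (contDiff_apply ℝ Space j))

/-- Multiplication by `e^{is k·x_j}`. -/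
def wave (s : ℝ) (j : Fin N) (k : Space) : Module.End ℂ (SmoothVec L Λ N) :=
  mulBy (planeWave s j k) (contDiff_planeWave s j k)

theorem inner_wave_left (s : ℝ) (j : Fin N) (k : Space) (Ψ Φ : SmoothVec L Λ N) :
    inner ℂ (wave s j k Ψ) Φ = inner ℂ Ψ (wave (-s) j k Φ) := by
  refine inner_mulBy_left _ _ _ _ (fun x => ?_) _ _
  simp only [planeWave, ← Complex.exp_conj, map_mul, Complex.conj_I, Complex.conj_ofReal]
  congr 1; push_cast; ring

theorem wave_mul_wave_neg (s : ℝ) (j : Fin N) (k : Space) :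
    (wave s j k * wave (-s) j k : Module.End ℂ (SmoothVec L Λ N)) = 1 := by
  refine LinearMap.ext fun Ψ => SmoothVec.ext_val ?_
  funext ν x
  simp only [Module.End.mul_apply, wave, mulBy_val, planeWave, Module.End.one_apply]
  rw [← mul_assoc, ← Complex.exp_add]
  have : Complex.I * ((s * inner ℝ k (x j) : ℝ) : ℂ) + Complex.I * ((-s * inner ℝ k (x j) : ℝ) : ℂ) = 0 := by
    push_cast; ring
  rw [this]; simp

theorem norm_wave (s : ℝ) (j : Fin N) (k : Space) (Ψ : SmoothVec L Λ N) :
    ‖wave s j k Ψ‖ = ‖Ψ‖ := by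
  have h : inner ℂ (wave s j k Ψ) (wave s j k Ψ) = inner ℂ Ψ Ψ := by
    rw [inner_wave_left, ← Module.End.mul_apply]
    have := wave_mul_wave_neg (L := L) (Λ := Λ) (-s) j k
    rw [neg_neg] at this
    rw [this]; rfl
  have h2 : ‖wave s j k Ψ‖ ^ 2 = ‖Ψ‖ ^ 2 := by
    rw [norm_sq_eq_re_inner (𝕜 := ℂ), h, ← norm_sq_eq_re_inner (𝕜 := ℂ)]
  exact (sq_eq_sq₀ (norm_nonneg _) (norm_nonneg _)).1 h2

theorem commute_wave (s t : ℝ) (j l : Fin N) (k p : Space) :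
    Commute (wave s j k : Module.End ℂ (SmoothVec L Λ N)) (wave t l p) := by
  refine LinearMap.ext fun Ψ => SmoothVec.ext_val ?_
  funext ν x
  simp only [Module.End.mul_apply, wave, mulBy_val]; ring

theorem mom_mul_wave (j : Fin N) (c : Fin 3) (s : ℝ) (k : Space) :
    (mom j c * wave s j k : Module.End ℂ (SmoothVec L Λ N)) =
      wave s j k * mom j c + ((s * k c : ℝ) : ℂ) • wave s j k := by
  refine LinearMap.ext fun Ψ => SmoothVec.ext_val ?_
  funext ν x
  set v : Config N := Pi.single j (EuclideanSpace.single c (1 : ℝ)) with hv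
  have hw : HasFDerivAt (planeWave s j k) (fderiv ℝ (planeWave s j k) x) x :=
    ((contDiff_planeWave s j k).differentiable (by simp) x).hasFDerivAt
  have hline : fderiv ℝ (planeWave s j k) x v = Complex.I * ((s * k c : ℝ) : ℂ) * planeWave s j k x := by
    rw [← (hw.hasLineDerivAt v).lineDeriv]
    have : ∀ t : ℝ, planeWave s j k (x + t • v) =
        Complex.exp (Complex.I * ((s * k c : ℝ) : ℂ) * (t : ℂ)) * planeWave s j k x := by
      intro t
      simp only [planeWave, ← Complex.exp_add]
      congr 1
      have : inner ℝ k ((x + t • v) j) = inner ℝ k (x j) + t * k c := by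
        simp [hv, inner_add_right, inner_smul_right, EuclideanSpace.inner_single_right]
      rw [this]; push_cast; ring
    rw [lineDeriv]
    simp only [this]
    have hd : HasDerivAt (fun t : ℝ => Complex.exp (Complex.I * ((s * k c : ℝ) : ℂ) * (t : ℂ)))
        (Complex.exp (Complex.I * ((s * k c : ℝ) : ℂ) * ((0 : ℝ) : ℂ)) * (Complex.I * ((s * k c : ℝ) : ℂ) * 1)) 0 :=
      ((Complex.ofRealCLM.hasDerivAt (x := (0 : ℝ))).const_mul
        (Complex.I * ((s * k c : ℝ) : ℂ))).cexp
    rw [(hd.mul_const (planeWave s j k x)).deriv]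
    simp
  have hf : fderiv ℝ ((wave s j k Ψ).val ν) x v =
      planeWave s j k x * fderiv ℝ (Ψ.val ν) x v +
        Complex.I * ((s * k c : ℝ) : ℂ) * planeWave s j k x * Ψ.val ν x := by
    have h1 : (wave s j k Ψ).val ν = planeWave s j k * Ψ.val ν := rfl
    rw [h1, fderiv_mul hw.differentiableAt (Ψ.differentiable ν x)]
    simp only [add_apply, smul_apply, hline, smul_eq_mul]
    ring
  simp only [Module.End.mul_apply, LinearMap.add_apply, LinearMap.smul_apply, map_add, map_smul,
    Pi.add_apply, Pi.smul_apply, smul_eq_mul]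
  rw [mom_val, momentum, ← hv, hf]
  simp only [wave, mulBy_val, mom_val, momentum, ← hv]
  linear_combination (-(((s * k c : ℝ) : ℂ) * planeWave s j k x * Ψ.val ν x)) * Complex.I_mul_I

/-! ### The vector potential and the quadratic form of the Hamiltonian -/

/-- The vector potential on smooth vectors. -/
def vecPot (ε : (Fin 3 → ℤ) → Fin 2 → Space) (j : Fin N) (c : Fin 3) :
    Module.End ℂ (SmoothVec L Λ N) :=
  (1 / Real.sqrt (2 * L ^ 3) : ℂ) • ∑ i : Mode L Λ, ((ε i.1.1 i.2 c / Real.sqrt ‖i.k‖ : ℝ) : ℂ) •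
    (wave 1 j i.k * ann i + wave (-1) j i.k * cre i)

/-- The covariant momentum on smooth vectors. -/
def covMom (α : ℝ) (ε : (Fin 3 → ℤ) → Fin 2 → Space) (j : Fin N) (c : Fin 3) :
    Module.End ℂ (SmoothVec L Λ N) :=
  mom j c + (Real.sqrt α : ℂ) • vecPot ε j c

theorem val_sum {ι : Type*} (s : Finset ι) (F : ι → SmoothVec L Λ N) (ν x) :
    (∑ i ∈ s, F i).val ν x = ∑ i ∈ s, (F i).val ν x := by
  rw [map_sum]; simp

theorem vecPot_val (ε : (Fin 3 → ℤ) → Fin 2 → Space) (j : Fin N) (c : Fin 3)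
    (Ψ : SmoothVec L Λ N) : (vecPot ε j c Ψ).val = vectorPotential ε j c Ψ.val := by
  funext ν x
  simp only [vecPot, vectorPotential, LinearMap.smul_apply, LinearMap.sum_apply, map_smul,
    Pi.smul_apply, smul_eq_mul, val_sum, LinearMap.add_apply, map_add, Pi.add_apply,
    Module.End.mul_apply, wave, mulBy_val, planeWave, ann_val, cre_val]
  simp

theorem covMom_val (α : ℝ) (ε : (Fin 3 → ℤ) → Fin 2 → Space) (j : Fin N) (c : Fin 3)
    (Ψ : SmoothVec L Λ N) : (covMom α ε j c Ψ).val = covMomentum α ε j c Ψ.val := by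
  simp only [covMom, covMomentum, LinearMap.add_apply, LinearMap.smul_apply, map_add, map_smul,
    vecPot_val, mom_val]

theorem inner_vecPot_left (ε : (Fin 3 → ℤ) → Fin 2 → Space) (j : Fin N) (c : Fin 3)
    (Ψ Φ : SmoothVec L Λ N) : inner ℂ (vecPot ε j c Ψ) Φ = inner ℂ Ψ (vecPot ε j c Φ) := by
  have h : ∀ i : Mode L Λ, inner ℂ (wave 1 j i.k (ann i Ψ) + wave (-1) j i.k (cre i Ψ)) Φ
      = inner ℂ Ψ (wave 1 j i.k (ann i Φ) + wave (-1) j i.k (cre i Φ)) := by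
    intro i
    simp only [inner_add_left, inner_add_right,
      inner_wave_left, inner_ann_left, inner_cre_left, neg_neg]
    simp only [wave, ← Module.End.mul_apply, (commute_mulBy_ann _ _ i).eq,
      (commute_mulBy_cre _ _ i).eq]
    ring
  simp only [vecPot, LinearMap.smul_apply, LinearMap.sum_apply, inner_smul_left, inner_smul_right,
    sum_inner, inner_sum, LinearMap.add_apply, Module.End.mul_apply, h]
  simp [inner_add_right]

theorem inner_covMom_left (α : ℝ) (ε : (Fin 3 → ℤ) → Fin 2 → Space) (j : Fin N) (c : Fin 3)
    (Ψ Φ : SmoothVec L Λ N) : inner ℂ (covMom α ε j c Ψ) Φ = inner ℂ Ψ (covMom α ε j c Φ) := by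
  simp only [covMom, LinearMap.add_apply, LinearMap.smul_apply, inner_add_left, inner_add_right,
    inner_smul_left, inner_smul_right, inner_mom_left, inner_vecPot_left]
  simp

/-- The quadratic form of the Hamiltonian. -/
def energy (α : ℝ) (ε : (Fin 3 → ℤ) → Fin 2 → Space) (Ψ : SmoothVec L Λ N) : ℝ :=
  1 / 2 * ∑ j, ∑ c, ‖covMom α ε j c Ψ‖ ^ 2 + ∑ i : Mode L Λ, ‖i.k‖ * ‖ann i Ψ‖ ^ 2

/-- The covariant momenta are symmetric and `cre` is adjoint to `ann`, so one factor of each product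
moves to the left. From here on the Hamiltonian enters only through the sum of squares `energy`. -/
theorem re_inner_hamiltonian (α : ℝ) (ε : (Fin 3 → ℤ) → Fin 2 → Space) (Ψ : SmoothVec L Λ N) :
    (innerProd Ψ.val (hamiltonian α ε Ψ.val)).re = energy α ε Ψ := by
  have h : hamiltonian α ε Ψ.val = ((∑ j : Fin N, (1 / 2 : ℂ) • ∑ c : Fin 3,
      covMom α ε j c (covMom α ε j c Ψ)) + ∑ i : Mode L Λ, (‖i.k‖ : ℂ) • cre i (ann i Ψ)).val := by
    simp only [hamiltonian, fieldEnergy, map_add, map_sum, map_smul, covMom_val, cre_val, ann_val]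
  rw [h, ← SmoothVec.inner_def]
  have hc : ∀ j c, inner ℂ Ψ (covMom α ε j c (covMom α ε j c Ψ)) =
      inner ℂ (covMom α ε j c Ψ) (covMom α ε j c Ψ) := fun j c => (inner_covMom_left α ε j c _ _).symm
  simp only [inner_add_right, inner_sum, inner_smul_right, hc, ← inner_ann_left]
  simp only [inner_self_eq_norm_sq_to_K, energy, Complex.add_re, Complex.re_sum, Finset.mul_sum]
  congr 1
  · refine Finset.sum_congr rfl fun j _ => Finset.sum_congr rfl fun c _ => ?_
    rw [show (1 / 2 : ℂ) = ((1 / 2 : ℝ) : ℂ) by push_cast; rfl]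
    rw [Complex.re_ofReal_mul]
    norm_cast
  · refine Finset.sum_congr rfl fun i _ => ?_
    rw [Complex.re_ofReal_mul]
    norm_cast

/-! ### Lower bound from a commutator -/

theorem Mode.k_norm_pos (hL : 0 < L) (i : Mode L Λ) : 0 < ‖i.k‖ := by
  rw [norm_pos_iff]
  intro h
  have h1 := ((mem_modes hL Λ i.1.1).1 i.1.2).1
  apply h1
  funext c
  have h2 : i.k c = 0 := by rw [h]; rfl
  have h3 : 2 * Real.pi * (i.1.1 c : ℝ) / L = 0 := h2
  have hpi := Real.pi_pos.ne'
  have h4 : (i.1.1 c : ℝ) = 0 := by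
    field_simp at h3
    simpa [hpi] using h3
  exact_mod_cast h4

theorem Mode.k_norm_lt (hL : 0 < L) (i : Mode L Λ) : ‖i.k‖ < Λ :=
  ((mem_modes hL Λ i.1.1).1 i.1.2).2

namespace IsPolarization

variable {ε : (Fin 3 → ℤ) → Fin 2 → Space}

theorem sum_sq (hε : IsPolarization L Λ ε) (i : Mode L Λ) : ∑ c, ε i.1.1 i.2 c ^ 2 = 1 := by
  have h := (hε i.1.1 i.1.2).1 i.2 i.2
  rw [if_pos rfl, PiLp.inner_apply] at h
  rw [← h]
  refine Finset.sum_congr rfl fun c _ => ?_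
  simp [sq]

theorem sum_mul_k (hε : IsPolarization L Λ ε) (i : Mode L Λ) : ∑ c, ε i.1.1 i.2 c * i.k c = 0 := by
  have h := (hε i.1.1 i.1.2).2 i.2
  rw [PiLp.inner_apply] at h
  rw [← h]
  refine Finset.sum_congr rfl fun c _ => ?_
  simp [Mode.k, mul_comm]

end IsPolarization

/-- `e^{ik·x_j} a_i`. -/
def waveAnn (j : Fin N) (i : Mode L Λ) : Module.End ℂ (SmoothVec L Λ N) := wave 1 j i.k * ann i

/-- `e^{-ik·x_j} a_i^*`. -/
def waveCre (j : Fin N) (i : Mode L Λ) : Module.End ℂ (SmoothVec L Λ N) := wave (-1) j i.k * cre i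

theorem commute_wave_ann (s : ℝ) (j : Fin N) (k : Space) (i : Mode L Λ) :
    Commute (wave s j k) (ann i) := commute_mulBy_ann _ _ i

theorem commute_wave_cre (s : ℝ) (j : Fin N) (k : Space) (i : Mode L Λ) :
    Commute (wave s j k) (cre i) := commute_mulBy_cre _ _ i

/-- The phases survive only in the diagonal commutator, where `e^{ik·x_j} e^{-ik·x_j} = 1`. Dressing
by plane waves at one fixed particle thus preserves the canonical relations. -/
theorem waveAnn_mul_waveCre (j : Fin N) (l i : Mode L Λ) :
    waveAnn j l * waveCre j i = waveCre j i * waveAnn j l + if l = i then 1 else 0 := by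
  have h1 : waveAnn j l * waveCre j i = wave 1 j l.k * wave (-1) j i.k * (ann l * cre i) := by
    simp only [waveAnn, waveCre, mul_assoc]
    rw [← mul_assoc (ann l), ← (commute_wave_ann (-1) j i.k l).eq, mul_assoc]
  have h2 : waveCre j i * waveAnn j l = wave 1 j l.k * wave (-1) j i.k * (cre i * ann l) := by
    simp only [waveAnn, waveCre, mul_assoc]
    rw [← mul_assoc (cre i), ← (commute_wave_cre 1 j l.k i).eq, mul_assoc, ← mul_assoc,
      (commute_wave (-1) 1 j j i.k l.k).eq, mul_assoc]
  rw [h1, h2, ann_mul_cre, mul_add]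
  congr 1
  by_cases h : l = i
  · subst h; simp [wave_mul_wave_neg]
  · simp [h]

theorem commute_waveCre (j : Fin N) (l i : Mode L Λ) : Commute (waveCre j l) (waveCre j i) := by
  have h : ∀ l i : Mode L Λ, Commute (wave (-1) j l.k) (waveCre j i) := fun l i =>
    (commute_wave _ _ _ _ _ _).mul_right (commute_wave_cre _ _ _ _)
  exact (h l i).mul_left ((commute_wave_cre _ _ _ _).symm.mul_right (commute_cre _ _))

theorem mom_mul_waveCre (j : Fin N) (c : Fin 3) (i : Mode L Λ) :
    mom j c * waveCre j i = waveCre j i * mom j c + ((-i.k c : ℝ) : ℂ) • waveCre j i := by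
  rw [waveCre, ← mul_assoc, mom_mul_wave, add_mul, mul_assoc, (commute_mom_cre j c i).eq, mul_assoc]
  simp

theorem inner_waveCre_left (j : Fin N) (i : Mode L Λ) (Ψ Φ : SmoothVec L Λ N) :
    inner ℂ (waveCre j i Ψ) Φ = inner ℂ Ψ (waveAnn j i Φ) := by
  simp only [waveCre, waveAnn, Module.End.mul_apply, inner_wave_left, inner_cre_left, neg_neg]
  rw [← Module.End.mul_apply, ← (commute_wave_ann 1 j i.k i).eq, Module.End.mul_apply]

theorem vecPot_eq (ε : (Fin 3 → ℤ) → Fin 2 → Space) (j : Fin N) (c : Fin 3) :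
    (vecPot ε j c : Module.End ℂ (SmoothVec L Λ N)) = (1 / Real.sqrt (2 * L ^ 3) : ℂ) •
      ∑ i : Mode L Λ, ((ε i.1.1 i.2 c / Real.sqrt ‖i.k‖ : ℝ) : ℂ) • (waveAnn j i + waveCre j i) := rfl

/-- Dressed creation operators commute with each other, so only the annihilation half of `A`
contributes, and it leaves the scalar weight of the single mode `i`. -/
theorem vecPot_mul_waveCre (ε : (Fin 3 → ℤ) → Fin 2 → Space) (j : Fin N) (c : Fin 3)
    (i : Mode L Λ) : vecPot ε j c * waveCre j i = waveCre j i * vecPot ε j c +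
      ((1 / Real.sqrt (2 * L ^ 3) * (ε i.1.1 i.2 c / Real.sqrt ‖i.k‖) : ℝ) : ℂ) • 1 := by
  have h : ∀ l : Mode L Λ, (waveAnn j l + waveCre j l) * waveCre j i =
      waveCre j i * (waveAnn j l + waveCre j l) + if l = i then 1 else 0 := by
    intro l
    rw [add_mul, waveAnn_mul_waveCre, (commute_waveCre j l i).eq, mul_add]; abel
  rw [vecPot_eq, smul_mul_assoc, mul_smul_comm, Finset.sum_mul, Finset.mul_sum]
  simp only [smul_mul_assoc, mul_smul_comm, h]
  simp only [smul_add _ (waveCre j i * _), Finset.sum_add_distrib, smul_ite, smul_zero,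
    Finset.sum_ite_eq', Finset.mem_univ, if_true]
  rw [smul_add, smul_smul]
  norm_cast

/-- The creation part of a transverse field proportional to the electric field at `x_j`. -/
def fieldCre (ε : (Fin 3 → ℤ) → Fin 2 → Space) (j : Fin N) (c : Fin 3) :
    Module.End ℂ (SmoothVec L Λ N) :=
  ∑ i : Mode L Λ, ((1 / Real.sqrt (2 * L ^ 3) * (Real.sqrt ‖i.k‖ * ε i.1.1 i.2 c) : ℝ) : ℂ) • waveCre j i

/-- The adjoint of `fieldCre`. -/
def fieldAnn (ε : (Fin 3 → ℤ) → Fin 2 → Space) (j : Fin N) (c : Fin 3) :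
    Module.End ℂ (SmoothVec L Λ N) :=
  ∑ i : Mode L Λ, ((1 / Real.sqrt (2 * L ^ 3) * (Real.sqrt ‖i.k‖ * ε i.1.1 i.2 c) : ℝ) : ℂ) • waveAnn j i

theorem inner_fieldCre_left (ε : (Fin 3 → ℤ) → Fin 2 → Space) (j : Fin N) (c : Fin 3)
    (Ψ Φ : SmoothVec L Λ N) : inner ℂ (fieldCre ε j c Ψ) Φ = inner ℂ Ψ (fieldAnn ε j c Φ) := by
  simp only [fieldCre, fieldAnn, LinearMap.sum_apply, LinearMap.smul_apply, sum_inner, inner_sum,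
    inner_smul_left, inner_smul_right, inner_waveCre_left, Complex.conj_ofReal]

theorem inner_fieldAnn_left (ε : (Fin 3 → ℤ) → Fin 2 → Space) (j : Fin N) (c : Fin 3)
    (Ψ Φ : SmoothVec L Λ N) : inner ℂ (fieldAnn ε j c Ψ) Φ = inner ℂ Ψ (fieldCre ε j c Φ) := by
  rw [← inner_conj_symm, ← inner_fieldCre_left, inner_conj_symm]

theorem inv_sqrt_sq (hL : 0 < L) : (1 / Real.sqrt (2 * L ^ 3)) ^ 2 = 1 / (2 * L ^ 3) := by
  rw [div_pow, Real.sq_sqrt (by positivity), one_pow]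

/-- The weight `√|k|` of `fieldCre` cancels the `1/√|k|` of `A`, so that every mode enters the
scalar part of the commutator with equal strength. The momentum contributes the remaining term,
proportional to `ε_c k_c`. -/
theorem covMom_mul_fieldCre (hL : 0 < L) (α : ℝ) (ε : (Fin 3 → ℤ) → Fin 2 → Space) (j : Fin N)
    (c : Fin 3) : (covMom α ε j c * fieldCre ε j c : Module.End ℂ (SmoothVec L Λ N)) =
      fieldCre ε j c * covMom α ε j c +
      (∑ i : Mode L Λ, ((1 / Real.sqrt (2 * L ^ 3) * (Real.sqrt ‖i.k‖ * -(ε i.1.1 i.2 c * i.k c)) : ℝ) : ℂ)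
        • waveCre j i +
      ((Real.sqrt α * (1 / (2 * L ^ 3)) * ∑ i : Mode L Λ, ε i.1.1 i.2 c ^ 2 : ℝ) : ℂ) • 1) := by
  have h : ∀ i : Mode L Λ, covMom α ε j c * waveCre j i = waveCre j i * covMom α ε j c +
      (((-i.k c : ℝ) : ℂ) • waveCre j i + ((Real.sqrt α * (1 / Real.sqrt (2 * L ^ 3) *
        (ε i.1.1 i.2 c / Real.sqrt ‖i.k‖)) : ℝ) : ℂ) • 1) := by
    intro i
    rw [covMom, add_mul, mom_mul_waveCre, smul_mul_assoc, vecPot_mul_waveCre, smul_add, mul_add,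
      mul_smul_comm, smul_smul, ← Complex.ofReal_mul]
    abel
  simp only [fieldCre, Finset.mul_sum, Finset.sum_mul, mul_smul_comm, smul_mul_assoc, h, smul_add,
    Finset.sum_add_distrib]
  congr 2
  · refine Finset.sum_congr rfl fun i _ => ?_
    rw [smul_smul, ← Complex.ofReal_mul]
    congr 2; ring
  · rw [Complex.ofReal_sum, Finset.sum_smul]
    refine Finset.sum_congr rfl fun i _ => ?_
    rw [smul_smul, ← Complex.ofReal_mul, ← inv_sqrt_sq hL]
    have h1 := Real.sqrt_pos.2 (i.k_norm_pos hL)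
    congr 2
    field_simp

/-- Summed over the components, the momentum part is `ε · k = 0` by transversality, and the scalar
part counts the modes because `|ε| = 1`. -/
theorem sum_commutator (hL : 0 < L) (α : ℝ) {ε : (Fin 3 → ℤ) → Fin 2 → Space}
    (hε : IsPolarization L Λ ε) (j : Fin N) (Ψ : SmoothVec L Λ N) :
    ∑ c, (covMom α ε j c (fieldCre ε j c Ψ) - fieldCre ε j c (covMom α ε j c Ψ)) =
      ((Real.sqrt α * (Fintype.card (Mode L Λ) / (2 * L ^ 3)) : ℝ) : ℂ) • Ψ := by
  have h : ∀ c, covMom α ε j c (fieldCre ε j c Ψ) - fieldCre ε j c (covMom α ε j c Ψ) =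
      ∑ i : Mode L Λ, ((1 / Real.sqrt (2 * L ^ 3) * (Real.sqrt ‖i.k‖ * -(ε i.1.1 i.2 c * i.k c)) : ℝ) : ℂ)
        • waveCre j i Ψ +
      ((Real.sqrt α * (1 / (2 * L ^ 3)) * ∑ i : Mode L Λ, ε i.1.1 i.2 c ^ 2 : ℝ) : ℂ) • Ψ := by
    intro c
    have := congrArg (fun T => T Ψ) (covMom_mul_fieldCre (Λ := Λ) hL α ε j c)
    simp only [Module.End.mul_apply, LinearMap.add_apply, LinearMap.sum_apply, LinearMap.smul_apply,
      Module.End.one_apply] at this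
    rw [this]; abel
  simp only [h, Finset.sum_add_distrib]
  rw [Finset.sum_comm]
  simp only [← Finset.sum_smul, ← Complex.ofReal_sum]
  have h1 : ∀ i : Mode L Λ, ∑ c, 1 / Real.sqrt (2 * L ^ 3) * (Real.sqrt ‖i.k‖ * -(ε i.1.1 i.2 c * i.k c)) = 0 := by
    intro i
    rw [← Finset.mul_sum, ← Finset.mul_sum, Finset.sum_neg_distrib, hε.sum_mul_k]; simp
  have h2 : ∑ c, Real.sqrt α * (1 / (2 * L ^ 3)) * ∑ i : Mode L Λ, ε i.1.1 i.2 c ^ 2 =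
      Real.sqrt α * (Fintype.card (Mode L Λ) / (2 * L ^ 3)) := by
    rw [← Finset.mul_sum, Finset.sum_comm]
    simp only [hε.sum_sq]
    simp; ring
  simp only [h1, h2, Complex.ofReal_zero, zero_smul, Finset.sum_const_zero, zero_add]

/-- Linear combinations of annihilation and creation operators inherit the canonical commutation
relations. -/
theorem sum_smul_mul_sum_smul {ι R : Type*} [Fintype ι] [DecidableEq ι] [Ring R] [Algebra ℂ R]
    (X Y : ι → R) (h : ∀ l i, X l * Y i = Y i * X l + if l = i then 1 else 0) (d e : ι → ℂ) :
    (∑ l, d l • X l) * (∑ i, e i • Y i) =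
      (∑ i, e i • Y i) * (∑ l, d l • X l) + (∑ i, d i * e i) • (1 : R) := by
  have h1 : ∀ l i, (d l • X l) * (e i • Y i) =
      (e i • Y i) * (d l • X l) + if l = i then (d i * e i) • (1 : R) else 0 := by
    intro l i
    rw [smul_mul_smul_comm, smul_mul_smul_comm, h, smul_add, mul_comm (e i)]
    by_cases hl : l = i
    · subst hl; simp
    · simp [hl]
  rw [Finset.sum_mul_sum, Finset.sum_mul_sum, Finset.sum_smul]
  simp only [h1, Finset.sum_add_distrib]
  rw [Finset.sum_comm]
  simp

theorem re_ofReal_mul_inner_self (a : ℝ) (Ψ : SmoothVec L Λ N) :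
    RCLike.re ((a : ℂ) * inner ℂ Ψ Ψ) = a * ‖Ψ‖ ^ 2 := by
  change Complex.re _ = _
  rw [Complex.re_ofReal_mul, norm_sq_eq_re_inner (𝕜 := ℂ)]
  rfl

/-- The excess of the creation part over its adjoint is the zero-point term; it is the source of the
loss `Λ / 2` in the lower bound. -/
theorem norm_fieldCre_sq (hL : 0 < L) (ε : (Fin 3 → ℤ) → Fin 2 → Space) (j : Fin N) (c : Fin 3)
    (Ψ : SmoothVec L Λ N) : ‖fieldCre ε j c Ψ‖ ^ 2 = ‖fieldAnn ε j c Ψ‖ ^ 2 +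
      (1 / (2 * L ^ 3) * ∑ i : Mode L Λ, ‖i.k‖ * ε i.1.1 i.2 c ^ 2) * ‖Ψ‖ ^ 2 := by
  have h : (fieldAnn ε j c * fieldCre ε j c : Module.End ℂ (SmoothVec L Λ N)) =
      fieldCre ε j c * fieldAnn ε j c +
        ((1 / (2 * L ^ 3) * ∑ i : Mode L Λ, ‖i.k‖ * ε i.1.1 i.2 c ^ 2 : ℝ) : ℂ) • 1 := by
    rw [fieldAnn, fieldCre, sum_smul_mul_sum_smul _ _ (waveAnn_mul_waveCre j)]
    congr 2
    rw [← Complex.ofReal_inj.2 (Finset.mul_sum _ _ _).symm, Complex.ofReal_sum]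
    refine Finset.sum_congr rfl fun i _ => ?_
    rw [← Complex.ofReal_mul, ← inv_sqrt_sq hL]
    congr 1
    linear_combination ((1 / Real.sqrt (2 * L ^ 3)) ^ 2 * ε i.1.1 i.2 c ^ 2) * Real.sq_sqrt (norm_nonneg i.k)
  rw [norm_sq_eq_re_inner (𝕜 := ℂ), inner_fieldCre_left, ← Module.End.mul_apply, h]
  simp only [LinearMap.add_apply, Module.End.mul_apply, LinearMap.smul_apply, Module.End.one_apply,
    inner_add_right, ← inner_fieldAnn_left, inner_smul_right, map_add, re_ofReal_mul_inner_self]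
  rw [norm_sq_eq_re_inner (𝕜 := ℂ) (fieldAnn ε j c Ψ)]

/-- Cauchy–Schwarz over the modes, pairing the polarization components with `√|k| ‖a_i Ψ‖`; plane
waves have modulus one and drop out. -/
theorem sum_norm_fieldAnn_sq_le (hL : 0 < L) {ε : (Fin 3 → ℤ) → Fin 2 → Space}
    (hε : IsPolarization L Λ ε) (j : Fin N) (Ψ : SmoothVec L Λ N) :
    ∑ c, ‖fieldAnn ε j c Ψ‖ ^ 2 ≤
      (Fintype.card (Mode L Λ) / (2 * L ^ 3)) * ∑ i : Mode L Λ, ‖i.k‖ * ‖ann i Ψ‖ ^ 2 := by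
  have h : ∀ c, ‖fieldAnn ε j c Ψ‖ ^ 2 ≤ (∑ i : Mode L Λ, 1 / (2 * L ^ 3) * ε i.1.1 i.2 c ^ 2) *
      ∑ i : Mode L Λ, ‖i.k‖ * ‖ann i Ψ‖ ^ 2 := by
    intro c
    have h1 : ‖fieldAnn ε j c Ψ‖ ≤ ∑ i : Mode L Λ,
        (1 / Real.sqrt (2 * L ^ 3) * |ε i.1.1 i.2 c|) * (Real.sqrt ‖i.k‖ * ‖ann i Ψ‖) := by
      simp only [fieldAnn, LinearMap.sum_apply, LinearMap.smul_apply]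
      refine (norm_sum_le _ _).trans (Finset.sum_le_sum fun i _ => le_of_eq ?_)
      rw [norm_smul, waveAnn, Module.End.mul_apply, norm_wave, Complex.norm_real, Real.norm_eq_abs,
        abs_mul, abs_mul, abs_of_nonneg (Real.sqrt_nonneg _),
        abs_of_nonneg (by positivity : 0 ≤ 1 / Real.sqrt (2 * L ^ 3))]
      ring
    refine (pow_le_pow_left₀ (norm_nonneg _) h1 2).trans ((Finset.sum_mul_sq_le_sq_mul_sq _ _ _).trans
      (le_of_eq ?_))
    simp only [mul_pow, sq_abs, inv_sqrt_sq hL, Real.sq_sqrt (norm_nonneg _)]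
  refine (Finset.sum_le_sum fun c _ => h c).trans (le_of_eq ?_)
  rw [← Finset.sum_mul, Finset.sum_comm]
  simp only [← Finset.mul_sum, hε.sum_sq]
  simp; left; ring

theorem energy_lower_bound (hL : 0 < L) {α : ℝ} {ε : (Fin 3 → ℤ) → Fin 2 → Space}
    (hε : IsPolarization L Λ ε) (hN : 1 ≤ N) (Ψ : SmoothVec L Λ N)
    (hM : 0 < Fintype.card (Mode L Λ)) :
    (Real.sqrt α * Real.sqrt (N * (Fintype.card (Mode L Λ) / (2 * L ^ 3)) / 2) - Λ / 2) * ‖Ψ‖ ^ 2 ≤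
      energy α ε Ψ := by
  set ρ : ℝ := Fintype.card (Mode L Λ) / (2 * L ^ 3) with hρ
  have hρ0 : 0 < ρ := by positivity
  -- With this weight in Young's inequality, `N ρ = 2 t²`. After summing the per-particle bounds and
  -- dividing by `2t`, the kinetic squares have coefficient `1/2` and the field energy has
  -- coefficient `1`, exactly as in `energy`.
  set t : ℝ := Real.sqrt (N * ρ / 2) with ht
  have hN0 : (0 : ℝ) < N := by exact_mod_cast hN
  have ht0 : 0 < t := Real.sqrt_pos.2 (by positivity)
  have ht2 : t ^ 2 = N * ρ / 2 := Real.sq_sqrt (by positivity)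
  set Hf : ℝ := ∑ i : Mode L Λ, ‖i.k‖ * ‖ann i Ψ‖ ^ 2 with hHf
  have hj : ∀ j : Fin N, Real.sqrt α * ρ * ‖Ψ‖ ^ 2 ≤
      t * ∑ c, ‖covMom α ε j c Ψ‖ ^ 2 + (ρ / t) * Hf + ρ * Λ / (2 * t) * ‖Ψ‖ ^ 2 := by
    intro j
    -- The expectation of the commutator identity in `Ψ`, with the leftmost operator of each product
    -- moved onto the left argument.
    have h1 : Real.sqrt α * ρ * ‖Ψ‖ ^ 2 = ∑ c, (RCLike.re (inner ℂ (covMom α ε j c Ψ) (fieldCre ε j c Ψ)) -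
        RCLike.re (inner ℂ (fieldAnn ε j c Ψ) (covMom α ε j c Ψ))) := by
      have h := congrArg (fun X => RCLike.re (inner ℂ Ψ X)) (sum_commutator hL α hε j Ψ)
      simp only [inner_sum, inner_sub_right, inner_smul_right, map_sum, map_sub] at h
      simp only [inner_covMom_left, inner_fieldAnn_left]
      rw [h, re_ofReal_mul_inner_self]
    have h2 : ∀ c, RCLike.re (inner ℂ (covMom α ε j c Ψ) (fieldCre ε j c Ψ)) -
        RCLike.re (inner ℂ (fieldAnn ε j c Ψ) (covMom α ε j c Ψ)) ≤
        t * ‖covMom α ε j c Ψ‖ ^ 2 + 1 / t * ‖fieldAnn ε j c Ψ‖ ^ 2 +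
          1 / (2 * t) * ((1 / (2 * L ^ 3) * ∑ i : Mode L Λ, ‖i.k‖ * ε i.1.1 i.2 c ^ 2) * ‖Ψ‖ ^ 2) := by
      intro c
      have e1 := re_inner_le_norm (𝕜 := ℂ) (covMom α ε j c Ψ) (fieldCre ε j c Ψ)
      have e2 := neg_le_of_abs_le ((RCLike.abs_re_le_norm _).trans
        (norm_inner_le_norm (𝕜 := ℂ) (fieldAnn ε j c Ψ) (covMom α ε j c Ψ)))
      have e3 := norm_fieldCre_sq hL ε j c Ψ
      set p := ‖covMom α ε j c Ψ‖
      set q := ‖fieldCre ε j c Ψ‖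
      set s := ‖fieldAnn ε j c Ψ‖
      have e4 : ∀ y : ℝ, p * y ≤ t / 2 * p ^ 2 + 1 / (2 * t) * y ^ 2 := by
        intro y
        have : t / 2 * p ^ 2 + 1 / (2 * t) * y ^ 2 - p * y = 1 / (2 * t) * (t * p - y) ^ 2 := by
          field_simp; ring
        have : 0 ≤ 1 / (2 * t) * (t * p - y) ^ 2 := by positivity
        linarith
      have e5 := e4 q
      have e6 := e4 s
      rw [e3] at e5
      have e7 : 1 / t * s ^ 2 = 2 * (1 / (2 * t) * s ^ 2) := by field_simp
      rw [e7]
      linarith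
    have h3 := sum_norm_fieldAnn_sq_le hL hε j Ψ
    rw [h1]
    refine (Finset.sum_le_sum fun c _ => h2 c).trans ?_
    rw [Finset.sum_add_distrib, Finset.sum_add_distrib, ← Finset.mul_sum, ← Finset.mul_sum,
      ← Finset.mul_sum, ← Finset.sum_mul, ← Finset.mul_sum]
    have h4 : 1 / (2 * L ^ 3) * ∑ c, ∑ i : Mode L Λ, ‖i.k‖ * ε i.1.1 i.2 c ^ 2 ≤ ρ * Λ := by
      rw [Finset.sum_comm]
      simp only [← Finset.mul_sum, hε.sum_sq, mul_one]
      have : ∑ i : Mode L Λ, ‖i.k‖ ≤ Fintype.card (Mode L Λ) * Λ := by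
        have := Finset.sum_le_sum (s := Finset.univ) fun (i : Mode L Λ) _ => (i.k_norm_lt hL).le
        simpa using this
      calc _ ≤ 1 / (2 * L ^ 3) * (Fintype.card (Mode L Λ) * Λ) := by gcongr
        _ = ρ * Λ := by rw [hρ]; ring
    have h5 : 1 / t * ∑ c, ‖fieldAnn ε j c Ψ‖ ^ 2 ≤ ρ / t * Hf := by
      calc _ ≤ 1 / t * (ρ * Hf) := by gcongr
        _ = _ := by ring
    have h6 : 1 / (2 * t) * (1 / (2 * L ^ 3) * ∑ c, ∑ i : Mode L Λ, ‖i.k‖ * ε i.1.1 i.2 c ^ 2 * ‖Ψ‖ ^ 2)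
        ≤ ρ * Λ / (2 * t) * ‖Ψ‖ ^ 2 := by
      simp only [← Finset.sum_mul]
      calc _ = 1 / (2 * t) * ((1 / (2 * L ^ 3) * ∑ c, ∑ i : Mode L Λ, ‖i.k‖ * ε i.1.1 i.2 c ^ 2) * ‖Ψ‖ ^ 2) := by ring
        _ ≤ 1 / (2 * t) * ((ρ * Λ) * ‖Ψ‖ ^ 2) := by gcongr
        _ = _ := by ring
    simp only [← Finset.sum_mul] at h6
    rw [← mul_assoc] at h6
    linarith [h6]
  have hs := Finset.sum_le_sum (s := Finset.univ) fun (j : Fin N) _ => hj j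
  rw [Finset.sum_add_distrib, Finset.sum_add_distrib] at hs
  simp only [Finset.sum_const, Finset.card_univ, Fintype.card_fin, nsmul_eq_mul] at hs
  rw [← Finset.mul_sum] at hs
  have hNρ : N * ρ = 2 * t ^ 2 := by rw [ht2]; ring
  have e1 : (N : ℝ) * (ρ / t * Hf) = 2 * t * Hf := by
    rw [← mul_assoc, ← mul_div_assoc, hNρ]; field_simp
  have e2 : (N : ℝ) * (ρ * Λ / (2 * t) * ‖Ψ‖ ^ 2) = t * Λ * ‖Ψ‖ ^ 2 := by
    rw [show (N : ℝ) * (ρ * Λ / (2 * t) * ‖Ψ‖ ^ 2) = (N * ρ) * Λ / (2 * t) * ‖Ψ‖ ^ 2 by ring, hNρ]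
    field_simp
  have e3 : (N : ℝ) * (Real.sqrt α * ρ * ‖Ψ‖ ^ 2) = 2 * t ^ 2 * Real.sqrt α * ‖Ψ‖ ^ 2 := by
    rw [← hNρ]; ring
  rw [e1, e2, e3] at hs
  have hE : energy α ε Ψ = 1 / 2 * ∑ j, ∑ c, ‖covMom α ε j c Ψ‖ ^ 2 + Hf := rfl
  rw [hE]
  refine le_of_mul_le_mul_left ?_ (by positivity : 0 < 2 * t)
  linarith

/-! ### Counting lattice modes -/

theorem waveVec_apply (L : ℝ) (n : Fin 3 → ℤ) (c : Fin 3) :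
    waveVec L n c = 2 * Real.pi / L * n c := by
  change 2 * Real.pi * (n c : ℝ) / L = _
  ring

theorem norm_waveVec_sq (L : ℝ) (n : Fin 3 → ℤ) :
    ‖waveVec L n‖ ^ 2 = (2 * Real.pi / L) ^ 2 * ∑ c, (n c : ℝ) ^ 2 := by
  rw [EuclideanSpace.norm_sq_eq, Finset.mul_sum]
  refine Finset.sum_congr rfl fun c _ => ?_
  rw [waveVec_apply, Real.norm_eq_abs, sq_abs]; ring

theorem abs_le_norm_waveVec (hL : 0 < L) (n : Fin 3 → ℤ) (c : Fin 3) :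
    2 * Real.pi / L * |(n c : ℝ)| ≤ ‖waveVec L n‖ := by
  have h := PiLp.norm_apply_le (waveVec L n) c
  rwa [waveVec_apply, Real.norm_eq_abs, abs_mul,
    abs_of_pos (by have := Real.pi_pos; positivity)] at h

theorem card_modes_pos (hL : 0 < L) (hΛ : 2 * Real.pi / L < Λ) : 0 < (modes L Λ).card := by
  refine Finset.card_pos.2 ⟨Pi.single 0 1, (mem_modes hL Λ _).2 ⟨by simp, ?_⟩⟩
  have h0 : (0 : ℝ) < 2 * Real.pi / L := by have := Real.pi_pos; positivity
  refine lt_of_pow_lt_pow_left₀ 2 (h0.le.trans hΛ.le) ?_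
  rw [norm_waveVec_sq]
  have : ∑ c : Fin 3, (((Pi.single 0 1 : Fin 3 → ℤ) c : ℤ) : ℝ) ^ 2 = 1 := by
    simp [Fin.sum_univ_three]
  rw [this, mul_one]
  exact pow_lt_pow_left₀ hΛ h0.le (by norm_num)

/-- The cube `[0, R/2]³` lies inside the open ball of radius `R = ΛL/2π` since `3/4 < 1`. Its
lattice points, except the origin, are therefore modes. -/
theorem card_modes_ge (hL : 0 < L) (hΛ : 2 * Real.pi / L < Λ) :
    (Λ * L / (2 * Real.pi)) ^ 3 / 16 ≤ ((modes L Λ).card : ℝ) := by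
  have hpi := Real.pi_pos
  have h0 : (0 : ℝ) < 2 * Real.pi / L := by positivity
  have hΛ0 : 0 < Λ := h0.trans hΛ
  set R : ℝ := Λ * L / (2 * Real.pi) with hR
  have hR0 : 0 < R := by positivity
  set m : ℕ := ⌊R / 2⌋₊ with hm
  have hm1 : (m : ℝ) ≤ R / 2 := Nat.floor_le (by positivity)
  have hm2 : R / 2 < m + 1 := Nat.lt_floor_add_one _
  have hsub : (Fintype.piFinset fun _ : Fin 3 => Finset.Icc (0 : ℤ) m).erase 0 ⊆ modes L Λ := by
    intro n hn
    rw [Finset.mem_erase, Fintype.mem_piFinset] at hn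
    refine (mem_modes hL Λ n).2 ⟨hn.1, ?_⟩
    refine lt_of_pow_lt_pow_left₀ 2 hΛ0.le ?_
    rw [norm_waveVec_sq]
    have h1 : ∀ c, (n c : ℝ) ^ 2 ≤ (R / 2) ^ 2 := by
      intro c
      have h2 := Finset.mem_Icc.1 (hn.2 c)
      have h3 : (0 : ℝ) ≤ n c := by exact_mod_cast h2.1
      have h4 : (n c : ℝ) ≤ m := by exact_mod_cast h2.2
      exact pow_le_pow_left₀ h3 (h4.trans hm1) 2
    have h5 : ∑ c, (n c : ℝ) ^ 2 ≤ 3 * (R / 2) ^ 2 := by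
      rw [Fin.sum_univ_three]; linarith [h1 0, h1 1, h1 2]
    have h6 : Λ = 2 * Real.pi / L * R := by rw [hR]; field_simp
    calc (2 * Real.pi / L) ^ 2 * ∑ c, (n c : ℝ) ^ 2 ≤ (2 * Real.pi / L) ^ 2 * (3 * (R / 2) ^ 2) := by gcongr
      _ < (2 * Real.pi / L) ^ 2 * R ^ 2 := by
        refine mul_lt_mul_of_pos_left ?_ (by positivity)
        nlinarith [sq_pos_of_pos hR0]
      _ = Λ ^ 2 := by rw [← mul_pow, ← h6]
  have hcard := Finset.card_le_card hsub
  rw [Finset.card_erase_of_mem (by simp), Fintype.card_piFinset] at hcard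
  simp only [Int.card_Icc, Finset.prod_const, Finset.card_univ, Fintype.card_fin] at hcard
  have h1 : ((m : ℤ) + 1 - 0).toNat = m + 1 := by omega
  rw [h1] at hcard
  have hpos := card_modes_pos hL hΛ
  -- The removed origin is paid for by the existence of one mode: `(m + 1)³ ≤ card + 1 ≤ 2 card`.
  -- This covers small `R` as well.
  have h2 : (m + 1) ^ 3 ≤ 2 * (modes L Λ).card := by omega
  have h3 : ((m : ℝ) + 1) ^ 3 ≤ 2 * (modes L Λ).card := by exact_mod_cast h2
  have h4 := pow_le_pow_left₀ (by positivity) hm2.le 3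
  have : (R / 2) ^ 3 = R ^ 3 / 8 := by ring
  linarith

/-- The cube of lattice points of sup-norm at most `M`. -/
def latticeCube (M : ℕ) : Finset (Fin 3 → ℤ) :=
  Fintype.piFinset fun _ : Fin 3 => Finset.Icc (-(M : ℤ)) M

theorem mem_latticeCube {M : ℕ} {n : Fin 3 → ℤ} : n ∈ latticeCube M ↔ ∀ c, |n c| ≤ M := by
  simp [latticeCube, Fintype.mem_piFinset, abs_le]

theorem card_latticeCube (M : ℕ) : (latticeCube M).card = (2 * M + 1) ^ 3 := by
  rw [latticeCube, Fintype.card_piFinset]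
  simp only [Int.card_Icc, Finset.prod_const, Finset.card_univ, Fintype.card_fin]
  congr 1; omega

/-- Summation over sup-norm shells: the shell of radius `M + 1` has at most `26 (M + 1)²` points,
each contributing at most `1/(M + 1)`. The origin contributes `1/0 = 0`. -/
theorem sum_inv_norm_latticeCube_le (M : ℕ) :
    ∑ n ∈ latticeCube M, 1 / ‖n‖ ≤ 13 * M * (M + 1) := by
  induction M with
  | zero =>
    have : latticeCube 0 = {0} := by
      ext n
      simp only [mem_latticeCube, Finset.mem_singleton, Nat.cast_zero, abs_nonpos_iff]
      exact funext_iff.symm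
    simp [this]
  | succ M ih =>
    have hsub : latticeCube M ⊆ latticeCube (M + 1) := by
      intro n hn
      rw [mem_latticeCube] at hn ⊢
      intro c
      have := hn c
      push_cast; omega
    rw [← Finset.sum_sdiff hsub]
    have h1 : ∑ n ∈ latticeCube (M + 1) \ latticeCube M, 1 / ‖n‖ ≤ 26 * (M + 1) := by
      have h2 : ∀ n ∈ latticeCube (M + 1) \ latticeCube M, 1 / ‖n‖ ≤ 1 / ((M : ℝ) + 1) := by
        intro n hn
        rw [Finset.mem_sdiff, mem_latticeCube, mem_latticeCube, not_forall] at hn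
        obtain ⟨-, c, hc⟩ := hn
        have h3 : (M : ℝ) + 1 ≤ ‖n‖ := by
          refine le_trans ?_ (norm_le_pi_norm n c)
          have : (M : ℤ) + 1 ≤ |n c| := by omega
          rw [Int.norm_eq_abs]
          exact_mod_cast this
        exact one_div_le_one_div_of_le (by positivity) h3
      refine (Finset.sum_le_sum h2).trans ?_
      rw [Finset.sum_const, nsmul_eq_mul, Finset.card_sdiff_of_subset hsub, card_latticeCube,
        card_latticeCube, Nat.cast_sub (Nat.pow_le_pow_left (by omega) 3)]
      push_cast
      rw [mul_one_div, div_le_iff₀ (by positivity)]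
      nlinarith [sq_nonneg (M : ℝ), (Nat.cast_nonneg M : (0 : ℝ) ≤ M)]
    push_cast
    nlinarith

/-- The Riemann-sum counterpart of `∫_{|k|<Λ} dk/|k|`, uniform in `L`. Replacing the Euclidean norm
by the smaller sup norm only increases the sum. -/
theorem sum_inv_norm_k_le (hL : 0 < L) (hΛ : 2 * Real.pi / L < Λ) :
    ∑ i : Mode L Λ, 1 / (2 * L ^ 3 * ‖i.k‖) ≤ Λ ^ 2 := by
  have hpi := Real.pi_pos
  have h0 : (0 : ℝ) < 2 * Real.pi / L := by positivity
  have hΛ0 : 0 < Λ := h0.trans hΛ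
  set R : ℝ := Λ * L / (2 * Real.pi) with hR
  have hR1 : 1 < R := by
    rw [hR, lt_div_iff₀ (by positivity)]
    rw [div_lt_iff₀ hL] at hΛ; linarith
  set M : ℕ := ⌊R⌋₊ with hM
  have hM1 : (M : ℝ) ≤ R := Nat.floor_le (by positivity)
  have hsub : modes L Λ ⊆ latticeCube M := by
    intro n hn
    rw [mem_latticeCube]
    intro c
    have h1 := (abs_le_norm_waveVec hL n c).trans ((mem_modes hL Λ n).1 hn).2.le
    have h2 : |(n c : ℝ)| ≤ R := by
      rw [hR, le_div_iff₀ (by positivity)]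
      rw [div_mul_eq_mul_div, div_le_iff₀ hL] at h1
      linarith
    have h3 : ((n c).natAbs : ℝ) ≤ R := by
      rw [Nat.cast_natAbs]; exact_mod_cast h2
    have h4 : (n c).natAbs ≤ M := Nat.le_floor h3
    rw [Int.abs_eq_natAbs]
    exact_mod_cast h4
  have h1 : ∀ i : Mode L Λ, 1 / (2 * L ^ 3 * ‖i.k‖) ≤ 1 / (4 * Real.pi * L ^ 2) * (1 / ‖i.1.1‖) := by
    intro i
    have h2 : ‖i.1.1‖ ≤ L / (2 * Real.pi) * ‖i.k‖ := by
      refine (pi_norm_le_iff_of_nonneg (by positivity)).2 fun c => ?_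
      have := abs_le_norm_waveVec hL i.1.1 c
      rw [Int.norm_eq_abs]
      change _ ≤ ‖i.k‖ at this
      rw [div_mul_eq_mul_div, div_le_iff₀ hL] at this
      rw [div_mul_eq_mul_div, le_div_iff₀ (by positivity)]
      linarith
    have h3 : 0 < ‖i.1.1‖ := norm_pos_iff.2 ((mem_modes hL Λ _).1 i.1.2).1
    rw [← one_div_mul_one_div_rev, mul_comm, one_div_mul_one_div_rev, one_div_mul_one_div_rev]
    refine one_div_le_one_div_of_le (by positivity) ?_
    calc ‖i.1.1‖ * (4 * Real.pi * L ^ 2) ≤ L / (2 * Real.pi) * ‖i.k‖ * (4 * Real.pi * L ^ 2) := by gcongr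
      _ = _ := by field_simp; ring
  refine (Finset.sum_le_sum fun i _ => h1 i).trans ?_
  rw [← Finset.mul_sum, Fintype.sum_prod_type]
  simp only [Finset.sum_const, Finset.card_univ, Fintype.card_fin, nsmul_eq_mul, ← Finset.mul_sum]
  rw [Finset.sum_coe_sort (modes L Λ) (fun n => 1 / ‖n‖)]
  have h4 : ∑ n ∈ modes L Λ, 1 / ‖n‖ ≤ 26 * R ^ 2 := by
    refine (Finset.sum_le_sum_of_subset_of_nonneg hsub fun n _ _ => by positivity).trans ?_
    refine (sum_inv_norm_latticeCube_le M).trans ?_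
    have : (0 : ℝ) ≤ M := by positivity
    nlinarith
  calc 1 / (4 * Real.pi * L ^ 2) * (((2 : ℕ) : ℝ) * ∑ n ∈ modes L Λ, 1 / ‖n‖)
      ≤ 1 / (4 * Real.pi * L ^ 2) * (((2 : ℕ) : ℝ) * (26 * R ^ 2)) := by gcongr
    _ = 13 / (4 * Real.pi ^ 3) * 1 * Λ ^ 2 := by rw [hR]; push_cast; field_simp; ring
    _ ≤ 1 * 1 * Λ ^ 2 := by
      gcongr
      rw [div_le_one (by positivity)]
      have := pow_le_pow_left₀ (by norm_num) Real.pi_gt_three.le 3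
      linarith
    _ = Λ ^ 2 := by ring

/-! ### Photon number and squeezed states -/

/-- All nonzero amplitudes of `Ψ` have exactly `d` photons. -/
def HasPhotons (d : ℕ) (Ψ : SmoothVec L Λ N) : Prop :=
  ∀ ν : Mode L Λ → ℕ, Ψ.val ν ≠ 0 → ∑ i, ν i = d

namespace HasPhotons

theorem add {d : ℕ} {Ψ Φ : SmoothVec L Λ N} (h : HasPhotons d Ψ) (h' : HasPhotons d Φ) :
    HasPhotons d (Ψ + Φ) := by
  intro ν hν
  by_cases h0 : Ψ.val ν = 0
  · refine h' ν fun h1 => hν ?_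
    rw [map_add, Pi.add_apply, h0, h1, add_zero]
  · exact h ν h0

theorem smul {d : ℕ} {Ψ : SmoothVec L Λ N} (h : HasPhotons d Ψ) (c : ℂ) : HasPhotons d (c • Ψ) := by
  intro ν hν
  refine h ν fun h1 => hν ?_
  rw [map_smul, Pi.smul_apply, h1, smul_zero]

theorem zero (d : ℕ) : HasPhotons d (0 : SmoothVec L Λ N) := by
  intro ν hν
  exact absurd (by rw [map_zero]; rfl) hν

theorem sum {ι : Type*} {s : Finset ι} {d : ℕ} {F : ι → SmoothVec L Λ N}
    (h : ∀ i ∈ s, HasPhotons d (F i)) : HasPhotons d (∑ i ∈ s, F i) :=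
  Finset.sum_induction F (HasPhotons d) (fun _ _ h1 h2 => h1.add h2) (zero d) h

theorem cre {d : ℕ} {Ψ : SmoothVec L Λ N} (h : HasPhotons d Ψ) (i : Mode L Λ) :
    HasPhotons (d + 1) (cre i Ψ) := by
  intro ν hν
  have h0 : ν i ≠ 0 := fun h0 => hν (by funext x; simp [cre_val, create, h0])
  have h1 : Ψ.val (ν - Pi.single i 1) ≠ 0 := fun h1 => hν (by funext x; simp [cre_val, create, h1])
  rw [← h _ h1]
  have h2 : ν = (ν - Pi.single i 1) + Pi.single i 1 := by
    funext j
    by_cases hj : j = i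
    · subst hj; simp; omega
    · simp [hj]
  conv_lhs => rw [h2]
  simp [Finset.sum_add_distrib]

theorem inner_eq_zero {d e : ℕ} (hde : d ≠ e) {Ψ Φ : SmoothVec L Λ N} (h : HasPhotons d Ψ)
    (h' : HasPhotons e Φ) : inner ℂ Ψ Φ = 0 := by
  rw [SmoothVec.inner_def, innerProd]
  refine (tsum_congr fun ν => ?_).trans tsum_zero
  by_cases h0 : Ψ.val ν = 0
  · simp [h0]
  by_cases h1 : Φ.val ν = 0
  · simp [h1]
  exact absurd ((h ν h0).symm.trans (h' ν h1)) hde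

theorem sum_norm_ann_sq {d : ℕ} {Ψ : SmoothVec L Λ N} (h : HasPhotons d Ψ) :
    ∑ i : Mode L Λ, ‖ann i Ψ‖ ^ 2 = d * ‖Ψ‖ ^ 2 := by
  have h1 : ∑ i : Mode L Λ, NRQED.cre i (ann i Ψ) = ((d : ℝ) : ℂ) • Ψ := by
    refine SmoothVec.ext_val ?_
    funext ν x
    have h2 : ∀ i : Mode L Λ, (NRQED.cre i (ann i Ψ)).val ν x = (ν i : ℂ) * Ψ.val ν x := by
      intro i
      simp only [cre_val, ann_val, create, annihilate]
      by_cases h0 : ν i = 0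
      · simp [h0]
      have h3 : ν - Pi.single i 1 + Pi.single i 1 = ν := by
        funext j
        by_cases hj : j = i
        · subst hj; simp; omega
        · simp [hj]
      have h4 : (((ν - Pi.single i 1 : Mode L Λ → ℕ) i : ℕ) : ℝ) + 1 = ν i := by
        have : (ν - Pi.single i 1 : Mode L Λ → ℕ) i + 1 = ν i := by simp; omega
        exact_mod_cast this
      rw [h3, h4, ← mul_assoc, ← Complex.ofReal_mul, Real.mul_self_sqrt (by positivity)]
      simp
    rw [val_sum]
    simp only [h2, map_smul, Pi.smul_apply, smul_eq_mul]
    rw [← Finset.sum_mul]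
    by_cases h0 : Ψ.val ν = 0
    · simp [h0]
    rw [← h ν h0]
    push_cast; ring
  have h2 := congrArg (fun X => RCLike.re (inner ℂ Ψ X)) h1
  simp only [inner_sum, ← inner_ann_left, inner_smul_right, map_sum, re_ofReal_mul_inner_self,
    ← norm_sq_eq_re_inner (𝕜 := ℂ)] at h2
  exact h2

end HasPhotons

section Squeezed

variable {M : ℕ}

/-- The annihilation operator of the photon state `∑ i, b m i`. -/
def annB (b : Fin M → Mode L Λ → ℂ) (m : Fin M) : Module.End ℂ (SmoothVec L Λ N) :=
  ∑ i, (starRingEnd ℂ) (b m i) • ann i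

/-- The creation operator of the photon state `∑ i, b m i`. -/
def creB (b : Fin M → Mode L Λ → ℂ) (m : Fin M) : Module.End ℂ (SmoothVec L Λ N) :=
  ∑ i, b m i • cre i

theorem inner_creB_left (b : Fin M → Mode L Λ → ℂ) (m : Fin M) (Ψ Φ : SmoothVec L Λ N) :
    inner ℂ (creB b m Ψ) Φ = inner ℂ Ψ (annB b m Φ) := by
  simp only [creB, annB, LinearMap.sum_apply, LinearMap.smul_apply, sum_inner, inner_sum,
    inner_smul_left, inner_smul_right, inner_cre_left]

theorem inner_annB_left (b : Fin M → Mode L Λ → ℂ) (m : Fin M) (Ψ Φ : SmoothVec L Λ N) :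
    inner ℂ (annB b m Ψ) Φ = inner ℂ Ψ (creB b m Φ) := by
  rw [← inner_conj_symm, ← inner_creB_left, inner_conj_symm]

theorem commute_creB (b : Fin M → Mode L Λ → ℂ) (m m' : Fin M) :
    Commute (creB b m : Module.End ℂ (SmoothVec L Λ N)) (creB b m') := by
  refine Commute.sum_left _ _ _ fun i _ => Commute.sum_right _ _ _ fun l _ => ?_
  exact ((commute_cre i l).smul_left _).smul_right _

theorem ann_mul_creB (b : Fin M → Mode L Λ → ℂ) (i : Mode L Λ) (m : Fin M) :
    (ann i * creB b m : Module.End ℂ (SmoothVec L Λ N)) = creB b m * ann i + b m i • 1 := by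
  have h : ∀ l, (ann i * b m l • cre l : Module.End ℂ (SmoothVec L Λ N)) =
      b m l • cre l * ann i + if i = l then b m i • 1 else 0 := by
    intro l
    rw [mul_smul_comm, ann_mul_cre, smul_add, smul_mul_assoc]
    by_cases hl : i = l
    · subst hl; simp
    · simp [hl]
  rw [creB, Finset.mul_sum, Finset.sum_mul]
  simp only [h, Finset.sum_add_distrib]
  simp

theorem annB_mul_creB (b : Fin M → Mode L Λ → ℂ)
    (hb : ∀ m m', ∑ i, (starRingEnd ℂ) (b m i) * b m' i = if m = m' then 1 else 0) (m m' : Fin M) :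
    (annB b m * creB b m' : Module.End ℂ (SmoothVec L Λ N)) =
      creB b m' * annB b m + if m = m' then 1 else 0 := by
  rw [annB, creB, sum_smul_mul_sum_smul _ _ ann_mul_cre, hb]
  by_cases h : m = m' <;> simp [h]

theorem norm_creB_sq (b : Fin M → Mode L Λ → ℂ)
    (hb : ∀ m m', ∑ i, (starRingEnd ℂ) (b m i) * b m' i = if m = m' then 1 else 0) (m : Fin M)
    (Ψ : SmoothVec L Λ N) : ‖creB b m Ψ‖ ^ 2 = ‖annB b m Ψ‖ ^ 2 + ‖Ψ‖ ^ 2 := by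
  rw [norm_sq_eq_re_inner (𝕜 := ℂ), inner_creB_left, ← Module.End.mul_apply, annB_mul_creB b hb,
    if_pos rfl, LinearMap.add_apply, Module.End.mul_apply, inner_add_right, ← inner_annB_left,
    map_add, Module.End.one_apply, ← norm_sq_eq_re_inner (𝕜 := ℂ), ← norm_sq_eq_re_inner (𝕜 := ℂ)]

/-- The pair creation operator `½ ∑ τ_m (b_m^*)²`. -/
def pairCre (b : Fin M → Mode L Λ → ℂ) (τ : Fin M → ℝ) : Module.End ℂ (SmoothVec L Λ N) :=
  ∑ m, ((τ m / 2 : ℝ) : ℂ) • (creB b m * creB b m)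

theorem ann_mul_pairCre (b : Fin M → Mode L Λ → ℂ) (τ : Fin M → ℝ) (i : Mode L Λ) :
    (ann i * pairCre b τ : Module.End ℂ (SmoothVec L Λ N)) =
      pairCre b τ * ann i + ∑ m, ((τ m : ℂ) * b m i) • creB b m := by
  have h : ∀ m, (ann i * (creB b m * creB b m) : Module.End ℂ (SmoothVec L Λ N)) =
      creB b m * creB b m * ann i + (2 * b m i) • creB b m := by
    intro m
    rw [← mul_assoc, ann_mul_creB, add_mul, mul_assoc, ann_mul_creB, mul_add, two_mul, add_smul]
    simp only [mul_smul_comm, smul_mul_assoc, mul_one, one_mul, mul_assoc, add_assoc]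
  rw [pairCre, Finset.mul_sum, Finset.sum_mul, ← Finset.sum_add_distrib]
  refine Finset.sum_congr rfl fun m _ => ?_
  rw [mul_smul_comm, h, smul_add, smul_smul, smul_mul_assoc]
  congr 2
  push_cast; ring

/-- The `2p`-photon component of the squeezed state `exp(-½ ∑ τ_m (b_m^*)²) v`. -/
def squeezed (b : Fin M → Mode L Λ → ℂ) (τ : Fin M → ℝ) (v : SmoothVec L Λ N) : ℕ → SmoothVec L Λ N
  | 0 => v
  | p + 1 => (-(1 / ((p : ℂ) + 1))) • pairCre b τ (squeezed b τ v p)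

variable {b : Fin M → Mode L Λ → ℂ} {τ : Fin M → ℝ} {v : SmoothVec L Λ N}

theorem creB_hasPhotons {d : ℕ} {Ψ : SmoothVec L Λ N} (h : HasPhotons d Ψ) (m : Fin M) :
    HasPhotons (d + 1) (creB b m Ψ) := by
  rw [creB, LinearMap.sum_apply]
  exact HasPhotons.sum fun i _ => (h.cre i).smul _

theorem squeezed_hasPhotons (hv : HasPhotons 0 v) (p : ℕ) :
    HasPhotons (2 * p) (squeezed b τ v p) := by
  induction p with
  | zero => exact hv
  | succ p ih =>
    refine HasPhotons.smul ?_ _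
    rw [pairCre, LinearMap.sum_apply]
    exact HasPhotons.sum fun m _ => (creB_hasPhotons (creB_hasPhotons ih m) m).smul _

/-- With `Q = pairCre b τ`, this is the component form of `a_i e^{-Q} v = -[a_i, Q] e^{-Q} v`, valid
because `[a_i, Q]` commutes with `Q` and `a_i v = 0`. -/
theorem ann_squeezed_succ (hv : ∀ i, ann i v = 0) (i : Mode L Λ) (p : ℕ) :
    ann i (squeezed b τ v (p + 1)) = -∑ m, ((τ m : ℂ) * b m i) • creB b m (squeezed b τ v p) := by
  have hcomm : ∀ m, Commute (pairCre b τ : Module.End ℂ (SmoothVec L Λ N)) (creB b m) := by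
    intro m
    refine Commute.sum_left _ _ _ fun m' _ => Commute.smul_left ?_ _
    exact (commute_creB b m' m).mul_left (commute_creB b m' m)
  have hstep : ∀ p, ann i (squeezed b τ v (p + 1)) = (-(1 / ((p : ℂ) + 1))) •
      (pairCre b τ (ann i (squeezed b τ v p)) +
        ∑ m, ((τ m : ℂ) * b m i) • creB b m (squeezed b τ v p)) := by
    intro p
    rw [squeezed, map_smul, ← Module.End.mul_apply, ann_mul_pairCre]
    simp only [LinearMap.add_apply, Module.End.mul_apply, LinearMap.sum_apply, LinearMap.smul_apply]
  induction p with
  | zero =>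
    rw [hstep]
    simp [squeezed, hv]
  | succ p ih =>
    have hp : ((p : ℂ) + 1) ≠ 0 := by exact_mod_cast Nat.succ_ne_zero p
    have hp' : ((p : ℂ) + 1 + 1) ≠ 0 := by exact_mod_cast Nat.succ_ne_zero (p + 1)
    have hQ : ∀ m, pairCre b τ (creB b m (squeezed b τ v p)) =
        (-((p : ℂ) + 1)) • creB b m (squeezed b τ v (p + 1)) := by
      intro m
      rw [← Module.End.mul_apply, (hcomm m).eq, Module.End.mul_apply]
      rw [squeezed, map_smul, smul_smul]
      rw [show -((p : ℂ) + 1) * -(1 / ((p : ℂ) + 1)) = 1 by field_simp, one_smul]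
    rw [hstep, ih]
    simp only [map_neg, map_sum, map_smul, hQ]
    rw [← Finset.sum_neg_distrib, ← Finset.sum_add_distrib, Finset.smul_sum, ← Finset.sum_neg_distrib]
    refine Finset.sum_congr rfl fun m _ => ?_
    rw [smul_smul, ← neg_smul, ← add_smul, smul_smul, ← neg_smul]
    congr 1
    push_cast
    field_simp

theorem annB_squeezed_succ (hb : ∀ m m', ∑ i, (starRingEnd ℂ) (b m i) * b m' i = if m = m' then 1 else 0)
    (hv : ∀ i, ann i v = 0) (m : Fin M) (p : ℕ) :
    annB b m (squeezed b τ v (p + 1)) = -((τ m : ℂ) • creB b m (squeezed b τ v p)) := by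
  rw [annB, LinearMap.sum_apply]
  simp only [LinearMap.smul_apply, ann_squeezed_succ hv, smul_neg, Finset.sum_neg_distrib,
    Finset.smul_sum, smul_smul]
  rw [Finset.sum_comm]
  simp only [← Finset.sum_smul]
  have h : ∀ m', ∑ i, (starRingEnd ℂ) (b m i) * ((τ m' : ℂ) * b m' i) =
      if m = m' then (τ m : ℂ) else 0 := by
    intro m'
    have : ∀ i, (starRingEnd ℂ) (b m i) * ((τ m' : ℂ) * b m' i) =
      (τ m' : ℂ) * ((starRingEnd ℂ) (b m i) * b m' i) := fun i => by ring
    simp only [this, ← Finset.mul_sum, hb]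
    by_cases hm : m = m'
    · subst hm; simp
    · simp [hm]
  simp [h]

/-- The matrix `b` is an isometry, so the photon number can be computed in the modes `b_m` once `a_i
Ψ` lies in their span. -/
theorem sum_norm_ann_sq_eq (hb : ∀ m m', ∑ i, (starRingEnd ℂ) (b m i) * b m' i = if m = m' then 1 else 0)
    {Ψ : SmoothVec L Λ N} (w : Fin M → SmoothVec L Λ N)
    (hw : ∀ i, ann i Ψ = ∑ m, b m i • w m) :
    ∑ i : Mode L Λ, ‖ann i Ψ‖ ^ 2 = ∑ m, ‖w m‖ ^ 2 := by
  have h1 : ∀ i, ‖ann i Ψ‖ ^ 2 = RCLike.re (∑ m, ∑ m', (starRingEnd ℂ) (b m i) * b m' i * inner ℂ (w m) (w m')) := by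
    intro i
    rw [norm_sq_eq_re_inner (𝕜 := ℂ), hw]
    simp only [sum_inner, inner_sum, inner_smul_left, inner_smul_right, mul_assoc, Finset.mul_sum]
    rw [Finset.sum_comm]
    refine congrArg _ (Finset.sum_congr rfl fun m _ => Finset.sum_congr rfl fun m' _ => ?_)
    ring
  simp only [h1, ← map_sum]
  rw [Finset.sum_comm]
  have h2 : ∀ m, ∑ i, ∑ m', (starRingEnd ℂ) (b m i) * b m' i * inner ℂ (w m) (w m') =
      inner ℂ (w m) (w m) := by
    intro m
    rw [Finset.sum_comm]
    simp only [← Finset.sum_mul, hb]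
    simp
  simp only [h2, map_sum, ← norm_sq_eq_re_inner (𝕜 := ℂ)]

end Squeezed

/-- Partial sums of a squeezed state. -/
def squeezedSum (b : Fin M → Mode L Λ → ℂ) (τ : Fin M → ℝ) (v : SmoothVec L Λ N) (n : ℕ) :
    SmoothVec L Λ N :=
  ∑ p ∈ Finset.range n, squeezed b τ v p

variable {b : Fin M → Mode L Λ → ℂ} {τ : Fin M → ℝ} {v : SmoothVec L Λ N}

theorem squeezedSum_succ (n : ℕ) :
    squeezedSum b τ v (n + 1) = squeezedSum b τ v n + squeezed b τ v n :=
  Finset.sum_range_succ _ _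

theorem norm_squeezedSum_succ_sq (hp : HasPhotons 0 v) (n : ℕ) :
    ‖squeezedSum b τ v (n + 1)‖ ^ 2 = ‖squeezedSum b τ v n‖ ^ 2 + ‖squeezed b τ v n‖ ^ 2 := by
  rw [squeezedSum_succ, sq, sq, sq]
  refine norm_add_sq_eq_norm_sq_add_norm_sq_of_inner_eq_zero (𝕜 := ℂ) _ _ ?_
  rw [squeezedSum, sum_inner]
  refine Finset.sum_eq_zero fun p hpn => ?_
  exact (squeezed_hasPhotons hp p).inner_eq_zero (by have := Finset.mem_range.1 hpn; omega)
    (squeezed_hasPhotons hp n)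

theorem norm_squeezedSum_mono (hp : HasPhotons 0 v) (n : ℕ) :
    ‖squeezedSum b τ v n‖ ^ 2 ≤ ‖squeezedSum b τ v (n + 1)‖ ^ 2 := by
  rw [norm_squeezedSum_succ_sq hp]
  have := sq_nonneg ‖squeezed b τ v n‖
  linarith

theorem ann_squeezedSum_succ (hv : ∀ i, ann i v = 0) (i : Mode L Λ) (n : ℕ) :
    ann i (squeezedSum b τ v (n + 1)) =
      ∑ m, b m i • (-((τ m : ℂ) • creB b m (squeezedSum b τ v n))) := by
  rw [squeezedSum, Finset.sum_range_succ', map_add, map_sum]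
  have h0 : ann i (squeezed b τ v 0) = 0 := hv i
  simp only [ann_squeezed_succ hv, h0, add_zero]
  rw [Finset.sum_neg_distrib, Finset.sum_comm, ← Finset.sum_neg_distrib]
  refine Finset.sum_congr rfl fun m _ => ?_
  rw [← Finset.smul_sum, ← map_sum, smul_neg, smul_smul, mul_comm, squeezedSum]

theorem annB_squeezedSum_succ (hb : ∀ m m', ∑ i, (starRingEnd ℂ) (b m i) * b m' i = if m = m' then 1 else 0)
    (hv : ∀ i, ann i v = 0) (m : Fin M) (n : ℕ) :
    annB b m (squeezedSum b τ v (n + 1)) = -((τ m : ℂ) • creB b m (squeezedSum b τ v n)) := by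
  rw [squeezedSum, Finset.sum_range_succ', map_add, map_sum]
  have h0 : annB b m (squeezed b τ v 0) = 0 := by simp [squeezed, annB, hv]
  simp only [annB_squeezed_succ hb hv, h0, add_zero]
  rw [Finset.sum_neg_distrib, ← Finset.smul_sum, ← map_sum, squeezedSum]

/-- `τ²/(1 - τ²)` is the fixed point of `q ↦ τ² (q + 1)`, the recursion given by `b S_{n+1} = -τ b*
S_n` and `‖b* S_n‖² = ‖b S_n‖² + ‖S_n‖²`. The truncated sums thus obey the bound of the full
squeezed state. -/
theorem norm_annB_squeezedSum_le (hb : ∀ m m', ∑ i, (starRingEnd ℂ) (b m i) * b m' i = if m = m' then 1 else 0)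
    (hv : ∀ i, ann i v = 0) (hp : HasPhotons 0 v) (m : Fin M) (h0 : 0 ≤ τ m) (h1 : τ m < 1) (n : ℕ) :
    ‖annB b m (squeezedSum b τ v n)‖ ^ 2 ≤ τ m ^ 2 / (1 - τ m ^ 2) * ‖squeezedSum b τ v n‖ ^ 2 := by
  have h2 : 0 < 1 - τ m ^ 2 := by nlinarith
  induction n with
  | zero => simp [squeezedSum]
  | succ n ih =>
    rw [annB_squeezedSum_succ hb hv, norm_neg, norm_smul, mul_pow, norm_creB_sq b hb,
      Complex.norm_real, Real.norm_eq_abs, sq_abs]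
    calc τ m ^ 2 * (‖annB b m (squeezedSum b τ v n)‖ ^ 2 + ‖squeezedSum b τ v n‖ ^ 2)
        ≤ τ m ^ 2 * (τ m ^ 2 / (1 - τ m ^ 2) * ‖squeezedSum b τ v n‖ ^ 2 +
          ‖squeezedSum b τ v n‖ ^ 2) := by gcongr
      _ = τ m ^ 2 / (1 - τ m ^ 2) * ‖squeezedSum b τ v n‖ ^ 2 := by field_simp; ring
      _ ≤ _ := by
        refine mul_le_mul_of_nonneg_left (norm_squeezedSum_mono hp n) (by positivity)

theorem norm_creB_squeezedSum_le (hb : ∀ m m', ∑ i, (starRingEnd ℂ) (b m i) * b m' i = if m = m' then 1 else 0)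
    (hv : ∀ i, ann i v = 0) (hp : HasPhotons 0 v) (m : Fin M) (h0 : 0 ≤ τ m) (h1 : τ m < 1) (n : ℕ) :
    ‖creB b m (squeezedSum b τ v n)‖ ^ 2 ≤ 1 / (1 - τ m ^ 2) * ‖squeezedSum b τ v n‖ ^ 2 := by
  have h2 : 0 < 1 - τ m ^ 2 := by nlinarith
  rw [norm_creB_sq b hb]
  have := norm_annB_squeezedSum_le hb hv hp m h0 h1 n
  have h3 : 1 / (1 - τ m ^ 2) = τ m ^ 2 / (1 - τ m ^ 2) + 1 := by field_simp; ring
  rw [h3, add_mul]; linarith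

/-- Since `b` acts as `-τ b*` up to truncation, `b + b*` acts as `(1 - τ) b*`, and `(1 - τ)²/(1 -
τ²) = (1 - τ)/(1 + τ)`. The truncation error has a higher photon number than the rest, hence is
orthogonal to it. -/
theorem norm_field_squeezedSum_le (hb : ∀ m m', ∑ i, (starRingEnd ℂ) (b m i) * b m' i = if m = m' then 1 else 0)
    (hv : ∀ i, ann i v = 0) (hp : HasPhotons 0 v) (m : Fin M) (h0 : 0 ≤ τ m) (h1 : τ m < 1) (n : ℕ) :
    ‖annB b m (squeezedSum b τ v (n + 1)) + creB b m (squeezedSum b τ v (n + 1))‖ ^ 2 ≤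
      (1 - τ m) / (1 + τ m) * ‖squeezedSum b τ v (n + 1)‖ ^ 2 + ‖creB b m (squeezed b τ v n)‖ ^ 2 := by
  have e : annB b m (squeezedSum b τ v (n + 1)) + creB b m (squeezedSum b τ v (n + 1)) =
      ((1 - τ m : ℝ) : ℂ) • creB b m (squeezedSum b τ v n) + creB b m (squeezed b τ v n) := by
    rw [annB_squeezedSum_succ hb hv, squeezedSum_succ, map_add, Complex.ofReal_sub, sub_smul]
    simp only [Complex.ofReal_one, one_smul]; abel
  have horth : inner ℂ (((1 - τ m : ℝ) : ℂ) • creB b m (squeezedSum b τ v n))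
      (creB b m (squeezed b τ v n)) = 0 := by
    rw [inner_smul_left, squeezedSum, map_sum, sum_inner, Finset.sum_eq_zero, mul_zero]
    intro p hpn
    exact (creB_hasPhotons (squeezed_hasPhotons hp p) m).inner_eq_zero
      (by have := Finset.mem_range.1 hpn; omega) (creB_hasPhotons (squeezed_hasPhotons hp n) m)
  have hn := norm_add_sq_eq_norm_sq_add_norm_sq_of_inner_eq_zero (𝕜 := ℂ) _ _ horth
  rw [← sq, ← sq, ← sq] at hn
  rw [e, hn, norm_smul, mul_pow, Complex.norm_real, Real.norm_eq_abs, sq_abs]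
  refine add_le_add ?_ le_rfl
  have h2 : 0 < 1 - τ m ^ 2 := by nlinarith
  calc (1 - τ m) ^ 2 * ‖creB b m (squeezedSum b τ v n)‖ ^ 2
      ≤ (1 - τ m) ^ 2 * (1 / (1 - τ m ^ 2) * ‖squeezedSum b τ v n‖ ^ 2) := by
        gcongr; exact norm_creB_squeezedSum_le hb hv hp m h0 h1 n
    _ = (1 - τ m) / (1 + τ m) * ‖squeezedSum b τ v n‖ ^ 2 := by
        have h3 : 1 - τ m ^ 2 = (1 - τ m) * (1 + τ m) := by ring
        have h4 : 0 < 1 - τ m := by linarith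
        rw [h3]; field_simp
    _ ≤ _ := by
        refine mul_le_mul_of_nonneg_left (norm_squeezedSum_mono hp n) ?_
        exact div_nonneg (by linarith) (by linarith)

theorem sum_norm_ann_squeezedSum_le (hb : ∀ m m', ∑ i, (starRingEnd ℂ) (b m i) * b m' i = if m = m' then 1 else 0)
    (hv : ∀ i, ann i v = 0) (hp : HasPhotons 0 v) (h0 : ∀ m, 0 ≤ τ m) (h1 : ∀ m, τ m < 1) (n : ℕ) :
    ∑ i : Mode L Λ, ‖ann i (squeezedSum b τ v (n + 1))‖ ^ 2 ≤
      (∑ m, τ m ^ 2 / (1 - τ m ^ 2)) * ‖squeezedSum b τ v (n + 1)‖ ^ 2 := by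
  rw [sum_norm_ann_sq_eq hb _ (fun i => ann_squeezedSum_succ hv i n), Finset.sum_mul]
  refine Finset.sum_le_sum fun m _ => ?_
  rw [← annB_squeezedSum_succ hb hv]
  exact norm_annB_squeezedSum_le hb hv hp m (h0 m) (h1 m) (n + 1)

theorem sum_norm_creB_squeezed (hb : ∀ m m', ∑ i, (starRingEnd ℂ) (b m i) * b m' i = if m = m' then 1 else 0)
    (hv : ∀ i, ann i v = 0) (hp : HasPhotons 0 v) (p : ℕ) :
    ∑ m, ‖creB b m (squeezed b τ v p)‖ ^ 2 = (2 * p + M) * ‖squeezed b τ v p‖ ^ 2 := by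
  simp only [norm_creB_sq b hb, Finset.sum_add_distrib]
  have h : ∑ m, ‖annB b m (squeezed b τ v p)‖ ^ 2 = 2 * p * ‖squeezed b τ v p‖ ^ 2 := by
    have h1 := (squeezed_hasPhotons (b := b) (τ := τ) hp p).sum_norm_ann_sq
    push_cast at h1
    rw [← h1]
    cases p with
    | zero => simp [squeezed, annB, hv]
    | succ p =>
      refine (sum_norm_ann_sq_eq hb _ fun i => ?_).symm
      rw [ann_squeezed_succ hv, ← Finset.sum_neg_distrib]
      refine Finset.sum_congr rfl fun m _ => ?_
      rw [annB_squeezed_succ hb hv, smul_neg, smul_smul, mul_comm]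
  rw [h]
  simp; ring

/-- Ratio test. The photon number `2(p+1)` of the next component gives `2(p+1) ‖s_{p+1}‖² = ∑ τ_m²
‖b_m* s_p‖²`, so consecutive terms have ratio at most `T² (1 + M/(2p+2))`, which tends to `T² < 1`.
-/
theorem tendsto_sum_norm_creB_squeezed (hb : ∀ m m', ∑ i, (starRingEnd ℂ) (b m i) * b m' i = if m = m' then 1 else 0)
    (hv : ∀ i, ann i v = 0) (hp : HasPhotons 0 v) (h0 : ∀ m, 0 ≤ τ m) {T : ℝ} (hT : T < 1)
    (h1 : ∀ m, τ m ≤ T) :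
    Filter.Tendsto (fun p => ∑ m, ‖creB b m (squeezed b τ v p)‖ ^ 2) Filter.atTop (nhds 0) := by
  rcases Nat.eq_zero_or_pos M with rfl | hM
  · simp
  have hT0 : 0 ≤ T := (h0 ⟨0, hM⟩).trans (h1 _)
  set V : ℕ → ℝ := fun p => ∑ m, ‖creB b m (squeezed b τ v p)‖ ^ 2 with hV
  have hV0 : ∀ p, 0 ≤ V p := fun p => Finset.sum_nonneg fun m _ => by positivity
  have hstep : ∀ p : ℕ, V (p + 1) ≤ T ^ 2 * (1 + M / (2 * p + 2)) * V p := by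
    intro p
    have e1 : (2 * ((p : ℝ) + 1)) * ‖squeezed b τ v (p + 1)‖ ^ 2 ≤ T ^ 2 * V p := by
      have h2 := (squeezed_hasPhotons (b := b) (τ := τ) hp (p + 1)).sum_norm_ann_sq
      push_cast at h2
      rw [← h2, sum_norm_ann_sq_eq hb (fun m => annB b m (squeezed b τ v (p + 1))), hV, Finset.mul_sum]
      · refine Finset.sum_le_sum fun m _ => ?_
        rw [annB_squeezed_succ hb hv, norm_neg, norm_smul, mul_pow, Complex.norm_real,
          Real.norm_eq_abs, sq_abs]
        have := pow_le_pow_left₀ (h0 m) (h1 m) 2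
        gcongr
      · intro i
        rw [ann_squeezed_succ hv, ← Finset.sum_neg_distrib]
        refine Finset.sum_congr rfl fun m _ => ?_
        rw [annB_squeezed_succ hb hv, smul_neg, smul_smul, mul_comm]
    have e2 : V (p + 1) = (1 + M / (2 * p + 2)) * ((2 * ((p : ℝ) + 1)) * ‖squeezed b τ v (p + 1)‖ ^ 2) := by
      rw [hV]
      simp only [sum_norm_creB_squeezed hb hv hp]
      push_cast
      field_simp
    rw [e2]
    calc (1 + M / (2 * (p : ℝ) + 2)) * ((2 * ((p : ℝ) + 1)) * ‖squeezed b τ v (p + 1)‖ ^ 2)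
        ≤ (1 + M / (2 * (p : ℝ) + 2)) * (T ^ 2 * V p) := by gcongr
      _ = _ := by ring
  have hlim : Filter.Tendsto (fun p : ℕ => T ^ 2 * (1 + M / (2 * (p : ℝ) + 2))) Filter.atTop
      (nhds (T ^ 2 * (1 + 0))) := by
    refine Filter.Tendsto.const_mul _ (Filter.Tendsto.const_add _ ?_)
    refine Filter.Tendsto.div_atTop tendsto_const_nhds ?_
    exact Filter.tendsto_atTop_add_const_right _ _
      (tendsto_natCast_atTop_atTop.const_mul_atTop (by norm_num))
  have hlt : T ^ 2 * (1 + 0) < (T ^ 2 + 1) / 2 := by nlinarith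
  have hs : Summable V := by
    refine summable_of_ratio_norm_eventually_le (r := (T ^ 2 + 1) / 2) (by nlinarith) ?_
    filter_upwards [hlim.eventually_lt_const hlt] with p h
    rw [Real.norm_of_nonneg (hV0 _), Real.norm_of_nonneg (hV0 _)]
    exact (hstep p).trans (mul_le_mul_of_nonneg_right h.le (hV0 p))
  exact hs.tendsto_atTop_zero

/-- Truncation keeps the trial state in the domain of finitely many amplitudes; `δ` absorbs the
truncation error, which is below `δ` while the norm stays at least that of the vacuum component. -/
theorem exists_squeezed_state (hb : ∀ m m', ∑ i, (starRingEnd ℂ) (b m i) * b m' i = if m = m' then 1 else 0)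
    (hv : ∀ i, ann i v = 0) (hp : HasPhotons 0 v) (hv1 : ‖v‖ = 1) (h0 : ∀ m, 0 ≤ τ m) {T : ℝ}
    (hT : T < 1) (h1 : ∀ m, τ m ≤ T) {δ : ℝ} (hδ : 0 < δ) :
    ∃ F : SmoothVec L Λ N, 1 ≤ ‖F‖ ^ 2 ∧
      (∀ m, ‖annB b m F + creB b m F‖ ^ 2 ≤ ((1 - τ m) / (1 + τ m) + δ) * ‖F‖ ^ 2) ∧
      ∑ i : Mode L Λ, ‖ann i F‖ ^ 2 ≤ (∑ m, τ m ^ 2 / (1 - τ m ^ 2)) * ‖F‖ ^ 2 := by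
  obtain ⟨n, hn⟩ := ((tendsto_sum_norm_creB_squeezed hb hv hp h0 hT h1).eventually_lt_const hδ).exists
  have hF : ∀ n, 1 ≤ ‖squeezedSum b τ v (n + 1)‖ ^ 2 := by
    intro n
    induction n with
    | zero => simp [squeezedSum, squeezed, hv1]
    | succ n ih => exact ih.trans (norm_squeezedSum_mono hp _)
  refine ⟨squeezedSum b τ v (n + 1), hF n, fun m => ?_,
    sum_norm_ann_squeezedSum_le hb hv hp h0 (fun m => (h1 m).trans_lt hT) n⟩
  refine (norm_field_squeezedSum_le hb hv hp m (h0 m) ((h1 m).trans_lt hT) n).trans ?_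
  rw [add_mul]
  refine add_le_add le_rfl ?_
  have h2 := Finset.single_le_sum (f := fun m => ‖creB b m (squeezed b τ v n)‖ ^ 2)
    (fun m _ => by positivity) (Finset.mem_univ m)
  nlinarith [hF n]

/-! ### Real field coordinates and diagonal modes -/

/-- A family of complex vectors with real mutual inner products has real coordinates in a suitable
orthonormal family. -/
theorem exists_orthonormal_real_coords {ι X : Type*} [Fintype ι] (f : X → EuclideanSpace ℂ ι)
    (hf : ∀ x y, (inner ℂ (f x) (f y)).im = 0) :
    ∃ (M : ℕ) (o : Fin M → EuclideanSpace ℂ ι) (ρ : Fin M → X → ℝ), Orthonormal ℂ o ∧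
      ∀ x, f x = ∑ m, (ρ m x : ℂ) • o m := by
  set W : Submodule ℝ (EuclideanSpace ℂ ι) := Submodule.span ℝ (Set.range f) with hW
  have him : ∀ v ∈ W, ∀ w ∈ W, (inner ℂ v w).im = 0 := by
    intro v hv w hw
    induction hv, hw using Submodule.span_induction₂ with
    | mem_mem x y hx hy =>
      obtain ⟨a, rfl⟩ := hx
      obtain ⟨b, rfl⟩ := hy
      exact hf a b
    | zero_left y hy => simp
    | zero_right x hx => simp
    | add_left x y z _ _ _ h1 h2 => rw [inner_add_left, Complex.add_im, h1, h2, add_zero]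
    | add_right x y z _ _ _ h1 h2 => rw [inner_add_right, Complex.add_im, h1, h2, add_zero]
    | smul_left r x y _ _ h =>
      rw [← Complex.coe_smul, inner_smul_left, Complex.conj_ofReal, Complex.im_ofReal_mul, h, mul_zero]
    | smul_right r x y _ _ h =>
      rw [← Complex.coe_smul, inner_smul_right, Complex.im_ofReal_mul, h, mul_zero]
  -- The complex inner product is real on `W`, so an orthonormal basis of the real space `W` is
  -- orthonormal over `ℂ` too, and elements of `W` have real coordinates in it.
  set o := stdOrthonormalBasis ℝ W with ho
  refine ⟨_, fun m => (o m : EuclideanSpace ℂ ι),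
    fun m x => inner ℝ (o m) ⟨f x, Submodule.subset_span ⟨x, rfl⟩⟩, ?_, fun x => ?_⟩
  · rw [orthonormal_iff_ite]
    intro m m'
    have h1 := orthonormal_iff_ite.1 o.orthonormal m m'
    have h2 : (inner ℂ (o m : EuclideanSpace ℂ ι) (o m')).re = if m = m' then 1 else 0 := by
      rw [← h1, Submodule.coe_inner, PiLp.inner_apply, PiLp.inner_apply, Complex.re_sum]
      exact Finset.sum_congr rfl fun i _ => by rw [Complex.inner, RCLike.inner_apply', mul_comm]
    have h3 := him _ (o m).2 _ (o m').2
    refine Complex.ext ?_ ?_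
    · rw [h2]; split_ifs <;> simp
    · rw [h3]; split_ifs <;> simp
  · have h := congrArg (Subtype.val) (o.sum_repr' ⟨f x, Submodule.subset_span ⟨x, rfl⟩⟩)
    rw [AddSubmonoidClass.coe_finsetSum] at h
    refine h.symm.trans ?_
    refine Finset.sum_congr rfl fun m _ => ?_
    rw [Complex.coe_smul]
    rfl

/-- The one-photon state `(2V)^{-1/2} ∑ |k|^{-1/2} ε_c e^{-ik·x}` created by `A_c(x)`. -/
def photonState (ε : (Fin 3 → ℤ) → Fin 2 → Space) (p : Space × Fin 3) :
    EuclideanSpace ℂ (Mode L Λ) :=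
  WithLp.toLp 2 fun i => ((1 / Real.sqrt (2 * L ^ 3) * (ε i.1.1 i.2 p.2 / Real.sqrt ‖i.k‖) : ℝ) : ℂ) *
    Complex.exp (-(Complex.I * (inner ℝ i.k p.1 : ℝ)))

theorem waveVec_neg (L : ℝ) (n : Fin 3 → ℤ) : waveVec L (-n) = -waveVec L n := by
  ext c
  rw [PiLp.neg_apply, waveVec_apply, waveVec_apply]
  simp

theorem neg_mem_modes (hL : 0 < L) {n : Fin 3 → ℤ} (hn : n ∈ modes L Λ) : -n ∈ modes L Λ := by
  rw [mem_modes hL] at hn ⊢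
  rw [waveVec_neg, norm_neg, neg_ne_zero]
  exact hn

/-- The two polarizations and `k/|k|` form the rows of an orthogonal matrix, whose columns are then
orthonormal as well. The result is even in `k`, although the polarizations at `k` and `-k` need not
be related. -/
theorem IsPolarization.sum_mul {ε : (Fin 3 → ℤ) → Fin 2 → Space} (hε : IsPolarization L Λ ε)
    (hL : 0 < L) {n : Fin 3 → ℤ} (hn : n ∈ modes L Λ) (c c' : Fin 3) :
    ∑ s, ε n s c * ε n s c' =
      (if c = c' then 1 else 0) - waveVec L n c * waveVec L n c' / ‖waveVec L n‖ ^ 2 := by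
  set k := waveVec L n with hk
  have hk0 : 0 < ‖k‖ := Mode.k_norm_pos hL (⟨n, hn⟩, (0 : Fin 2))
  have hdot : ∀ v w : Space, inner ℝ v w = ∑ c, v c * w c := by
    intro v w
    rw [PiLp.inner_apply]
    exact Finset.sum_congr rfl fun c _ => by simp [mul_comm]
  set E : Matrix (Fin 3) (Fin 3) ℝ := Matrix.of ![fun c => ε n 0 c, fun c => ε n 1 c, fun c => k c / ‖k‖] with hE
  have hkk : ∑ c, k c * k c = ‖k‖ ^ 2 := by rw [← hdot, real_inner_self_eq_norm_sq]
  have hee : ∀ s t : Fin 2, ∑ c, ε n s c * ε n t c = if s = t then 1 else 0 := by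
    intro s t; rw [← hdot]; exact (hε n hn).1 s t
  have hek : ∀ s : Fin 2, ∑ c, ε n s c * k c = 0 := by
    intro s; rw [← hdot]; exact (hε n hn).2 s
  have h1 : E * E.transpose = 1 := by
    have a00 := hee 0 0
    have a01 := hee 0 1
    have a10 := hee 1 0
    have a11 := hee 1 1
    have b0 := hek 0
    have b1 := hek 1
    simp only [Fin.sum_univ_three, Fin.isValue, if_true, zero_ne_one, one_ne_zero, if_false] at a00 a01 a10 a11 b0 b1 hkk
    ext i j
    fin_cases i <;> fin_cases j <;>
      simp [hE, Matrix.mul_apply, Fin.sum_univ_three] <;> field_simp <;> linarith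
  have h3 : E.transpose * E = 1 := mul_eq_one_comm.1 h1
  have h2 := congrFun (congrFun h3 c) c'
  simp only [Matrix.mul_apply, Matrix.transpose_apply, Fin.sum_univ_three, Matrix.one_apply] at h2
  rw [← h2, Fin.sum_univ_two]
  simp [hE]
  field_simp
  ring

/-- Physically, the components of `A` at different points commute. The inner product is a sum of
even real weights times `e^{ik·(x-y)}` over a set symmetric under `k ↦ -k`, so it equals its own
conjugate. -/
theorem photonState_inner_im {ε : (Fin 3 → ℤ) → Fin 2 → Space} (hε : IsPolarization L Λ ε)
    (hL : 0 < L) (p q : Space × Fin 3) :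
    (inner ℂ (photonState ε p : EuclideanSpace ℂ (Mode L Λ)) (photonState ε q)).im = 0 := by
  set g : (Fin 3 → ℤ) → ℝ := fun n => 1 / (2 * L ^ 3) / ‖waveVec L n‖ *
    ((if p.2 = q.2 then 1 else 0) - waveVec L n p.2 * waveVec L n q.2 / ‖waveVec L n‖ ^ 2) with hg
  have h1 : inner ℂ (photonState ε p : EuclideanSpace ℂ (Mode L Λ)) (photonState ε q) =
      ∑ n ∈ modes L Λ, (g n : ℂ) * Complex.exp (((inner ℝ (waveVec L n) (p.1 - q.1) : ℝ) : ℂ) * Complex.I) := by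
    rw [PiLp.inner_apply, Fintype.sum_prod_type, ← Finset.sum_coe_sort (modes L Λ)]
    refine Finset.sum_congr rfl fun n _ => ?_
    rw [hg]
    simp only [← hε.sum_mul hL n.2, photonState]
    rw [Finset.mul_sum, Complex.ofReal_sum, Finset.sum_mul]
    refine Finset.sum_congr rfl fun s _ => ?_
    rw [RCLike.inner_apply', map_mul, Complex.conj_ofReal, ← Complex.exp_conj]
    have e1 : (starRingEnd ℂ) (-(Complex.I * ((inner ℝ (Mode.k (n, s)) p.1 : ℝ) : ℂ))) =
        Complex.I * ((inner ℝ (waveVec L n) p.1 : ℝ) : ℂ) := by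
      simp [Mode.k]
    rw [e1, mul_mul_mul_comm, ← Complex.exp_add, ← Complex.ofReal_mul]
    congr 2
    · rw [← inv_sqrt_sq hL]
      have hk0 : 0 < ‖Mode.k (n, s)‖ := Mode.k_norm_pos hL _
      change _ = (1 / Real.sqrt (2 * L ^ 3)) ^ 2 / ‖Mode.k (n, s)‖ * _
      have h2 := Real.sq_sqrt hk0.le
      rw [← h2]
      have h3 := Real.sqrt_pos.2 hk0
      rw [Real.sqrt_sq h3.le]
      field_simp
    · rw [inner_sub_right]
      change Complex.I * _ + -(Complex.I * ((inner ℝ (waveVec L n) q.1 : ℝ) : ℂ)) = _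
      push_cast; ring
  rw [h1, ← Complex.conj_eq_iff_im, map_sum]
  refine Finset.sum_nbij' (fun n => -n) (fun n => -n) (fun n hn => neg_mem_modes hL hn)
    (fun n hn => neg_mem_modes hL hn) (fun n _ => neg_neg n) (fun n _ => neg_neg n) fun n _ => ?_
  have h2 : g (-n) = g n := by simp [hg, waveVec_neg]
  rw [h2, map_mul, Complex.conj_ofReal, ← Complex.exp_conj, waveVec_neg, inner_neg_left]
  simp

theorem coord_eq {ι X : Type*} [Fintype ι] {f : X → EuclideanSpace ℂ ι} {b : Fin M → ι → ℂ}
    {ρ : Fin M → X → ℝ}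
    (hb : ∀ m m', ∑ i, (starRingEnd ℂ) (b m i) * b m' i = if m = m' then 1 else 0)
    (hf : ∀ x i, f x i = ∑ m, (ρ m x : ℂ) * b m i) (m : Fin M) (x : X) :
    (ρ m x : ℂ) = ∑ i, (starRingEnd ℂ) (b m i) * f x i := by
  simp only [hf, Finset.mul_sum]
  rw [Finset.sum_comm]
  have h : ∀ m', ∑ i, (starRingEnd ℂ) (b m i) * ((ρ m' x : ℂ) * b m' i) =
      if m = m' then (ρ m x : ℂ) else 0 := by
    intro m'
    have h1 : ∀ i, (starRingEnd ℂ) (b m i) * ((ρ m' x : ℂ) * b m' i) =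
      (ρ m' x : ℂ) * ((starRingEnd ℂ) (b m i) * b m' i) := fun i => by ring
    simp only [h1, ← Finset.mul_sum, hb]
    by_cases hm : m = m'
    · subst hm; simp
    · simp [hm]
  simp [h]

theorem contDiff_photonState (ε : (Fin 3 → ℤ) → Fin 2 → Space) (c : Fin 3) (i : Mode L Λ) :
    ContDiff ℝ (⊤ : ℕ∞) fun x : Space => photonState ε (x, c) i := by
  have h : ContDiff ℝ (⊤ : ℕ∞) fun x : Space => (inner ℝ i.k x : ℝ) :=
    contDiff_const.inner ℝ contDiff_id
  have h2 : ContDiff ℝ (⊤ : ℕ∞) fun x : Space => Complex.exp (-(Complex.I * (inner ℝ i.k x : ℝ))) :=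
    Complex.contDiff_exp.comp (ContDiff.neg (contDiff_const.mul (Complex.ofRealCLM.contDiff.comp h)))
  exact (contDiff_const (c := ((1 / Real.sqrt (2 * L ^ 3) *
    (ε i.1.1 i.2 c / Real.sqrt ‖i.k‖) : ℝ) : ℂ))).mul h2

theorem contDiff_coord {ε : (Fin 3 → ℤ) → Fin 2 → Space} {b : Fin M → Mode L Λ → ℂ}
    {ρ : Fin M → Space × Fin 3 → ℝ}
    (hb : ∀ m m', ∑ i, (starRingEnd ℂ) (b m i) * b m' i = if m = m' then 1 else 0)
    (hf : ∀ x i, photonState ε x i = ∑ m, (ρ m x : ℂ) * b m i) (m : Fin M) (c : Fin 3) :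
    ContDiff ℝ (⊤ : ℕ∞) fun x : Space => ρ m (x, c) := by
  have h : (fun x : Space => ρ m (x, c)) =
      fun x => Complex.reCLM (∑ i, (starRingEnd ℂ) (b m i) * photonState ε (x, c) i) := by
    funext x
    rw [← coord_eq hb hf]; simp
  rw [h]
  exact Complex.reCLM.contDiff.comp
    (ContDiff.sum fun i _ => contDiff_const.mul (contDiff_photonState ε c i))

/-- Photon modes with real coordinates which diagonalize the quadratic form
`v ↦ ∑_c ∫ φ² (v · A_c)²`. -/
theorem exists_diagonal_modes {ε : (Fin 3 → ℤ) → Fin 2 → Space} (hε : IsPolarization L Λ ε)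
    (hL : 0 < L) {φ : Space → ℝ} (hφ : Continuous φ) (hc : HasCompactSupport φ) :
    ∃ (M : ℕ) (b : Fin M → Mode L Λ → ℂ) (ρ : Fin M → Space × Fin 3 → ℝ) (g : Fin M → ℝ),
      (∀ m m', ∑ i, (starRingEnd ℂ) (b m i) * b m' i = if m = m' then 1 else 0) ∧
      (∀ x i, photonState ε x i = ∑ m, (ρ m x : ℂ) * b m i) ∧
      ∀ m m', ∑ c, ∫ x, φ x ^ 2 * (ρ m (x, c) * ρ m' (x, c)) = if m = m' then g m else 0 := by
  obtain ⟨M, o, ρ, ho, hρ⟩ := exists_orthonormal_real_coords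
    (photonState (L := L) (Λ := Λ) ε) (photonState_inner_im hε hL)
  have hin : ∀ v w : EuclideanSpace ℂ (Mode L Λ), inner ℂ v w = ∑ i, (starRingEnd ℂ) (v i) * w i := by
    intro v w
    rw [PiLp.inner_apply]
    exact Finset.sum_congr rfl fun i _ => RCLike.inner_apply' _ _
  have hob : ∀ m m', ∑ i, (starRingEnd ℂ) (o m i) * o m' i = if m = m' then 1 else 0 := by
    intro m m'
    rw [← hin]; exact orthonormal_iff_ite.1 ho m m'
  have hρ' : ∀ x i, photonState ε x i = ∑ m, (ρ m x : ℂ) * o m i := by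
    intro x i
    rw [hρ]; simp
  have hρc : ∀ m c, Continuous fun x : Space => ρ m (x, c) := fun m c =>
    (contDiff_coord hob hρ' m c).continuous
  have hint : ∀ a a' c, Integrable fun x => φ x ^ 2 * (ρ a (x, c) * ρ a' (x, c)) := by
    intro a a' c
    have h1 : Continuous fun x => φ x ^ 2 * (ρ a (x, c) * ρ a' (x, c)) :=
      (hφ.pow 2).mul ((hρc a c).mul (hρc a' c))
    have h2 : HasCompactSupport fun x => φ x ^ 2 := hc.comp_left (g := fun t : ℝ => t ^ 2) (by simp)
    exact h1.integrable_of_hasCompactSupport h2.mul_right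
  set G : Matrix (Fin M) (Fin M) ℝ := Matrix.of fun m m' =>
    ∑ c, ∫ x, φ x ^ 2 * (ρ m (x, c) * ρ m' (x, c)) with hG
  have hGh : G.IsHermitian := by
    ext m m'
    simp [hG, mul_comm]
  -- The Gram matrix is real symmetric, so the change of modes that diagonalizes it is real
  -- orthogonal and keeps the coordinates real.
  set u := hGh.eigenvectorBasis with hu
  have huo : ∀ m m', ∑ a, u m a * u m' a = if m = m' then 1 else 0 := by
    intro m m'
    rw [← orthonormal_iff_ite.1 u.orthonormal m m', PiLp.inner_apply]
    exact Finset.sum_congr rfl fun i _ => by simp [mul_comm]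
  have huu : ∀ a a', ∑ m, u m a * u m a' = if a = a' then 1 else 0 := by
    have h1 : (Matrix.of fun m a => u m a) * (Matrix.of fun m a => u m a).transpose = 1 := by
      ext m m'
      simp [Matrix.mul_apply, huo, Matrix.one_apply]
    have h2 : (Matrix.of fun m a => u m a).transpose * (Matrix.of fun m a => u m a) = 1 :=
      mul_eq_one_comm.1 h1
    intro a a'
    have h3 := congrFun (congrFun h2 a) a'
    simpa [Matrix.mul_apply, Matrix.one_apply] using h3
  refine ⟨M, fun m i => ∑ a, (u m a : ℂ) * o a i, fun m x => ∑ a, u m a * ρ a x, hGh.eigenvalues,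
    ?_, ?_, ?_⟩
  · intro m m'
    beta_reduce
    have h1 : ∀ i, (starRingEnd ℂ) (∑ a, (u m a : ℂ) * o a i) * ∑ a, (u m' a : ℂ) * o a i =
        ∑ a, ∑ a', ((u m a : ℂ) * (u m' a')) * ((starRingEnd ℂ) (o a i) * o a' i) := by
      intro i
      rw [map_sum, Finset.sum_mul_sum]
      refine Finset.sum_congr rfl fun a _ => Finset.sum_congr rfl fun a' _ => ?_
      rw [map_mul, Complex.conj_ofReal]; ring
    simp only [h1]
    rw [Finset.sum_comm]
    have h2 : ∀ a, ∑ i, ∑ a', ((u m a : ℂ) * (u m' a')) * ((starRingEnd ℂ) (o a i) * o a' i) =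
        (u m a : ℂ) * (u m' a) := by
      intro a
      rw [Finset.sum_comm]
      simp only [← Finset.mul_sum, hob]
      simp
    simp only [h2]
    have := huo m m'
    rw [← Complex.ofReal_inj] at this
    push_cast at this
    exact this.trans (by split_ifs <;> simp)
  · intro x i
    beta_reduce
    rw [hρ']
    have h1 : ∀ m, ((∑ a, u m a * ρ a x : ℝ) : ℂ) * ∑ a, (u m a : ℂ) * o a i =
        ∑ a, ∑ a', ((u m a * u m a' : ℝ) : ℂ) * ((ρ a x : ℂ) * o a' i) := by
      intro m
      rw [Complex.ofReal_sum, Finset.sum_mul_sum]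
      refine Finset.sum_congr rfl fun a _ => Finset.sum_congr rfl fun a' _ => ?_
      push_cast; ring
    simp only [h1]
    rw [Finset.sum_comm]
    refine Finset.sum_congr rfl fun a _ => ?_
    rw [Finset.sum_comm]
    simp only [← Finset.sum_mul, ← Complex.ofReal_sum, huu]
    rw [Finset.sum_eq_single a (fun a' _ h => by rw [if_neg h.symm]; simp) (by simp), if_pos rfl,
      Complex.ofReal_one, one_mul]
  · intro m m'
    beta_reduce
    have h1 : ∀ c, ∫ x, φ x ^ 2 * ((∑ a, u m a * ρ a (x, c)) * ∑ a, u m' a * ρ a (x, c)) =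
        ∑ a, ∑ a', (u m a * u m' a') * ∫ x, φ x ^ 2 * (ρ a (x, c) * ρ a' (x, c)) := by
      intro c
      have h2 : ∀ x, φ x ^ 2 * ((∑ a, u m a * ρ a (x, c)) * ∑ a, u m' a * ρ a (x, c)) =
          ∑ a, ∑ a', (u m a * u m' a') * (φ x ^ 2 * (ρ a (x, c) * ρ a' (x, c))) := by
        intro x
        rw [Finset.sum_mul_sum, Finset.mul_sum]
        refine Finset.sum_congr rfl fun a _ => ?_
        rw [Finset.mul_sum]
        exact Finset.sum_congr rfl fun a' _ => by ring
      simp only [h2]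
      rw [integral_finsetSum _ fun a _ => integrable_finsetSum _ fun a' _ => (hint a a' c).const_mul _]
      refine Finset.sum_congr rfl fun a _ => ?_
      rw [integral_finsetSum _ fun a' _ => (hint a a' c).const_mul _]
      simp only [integral_const_mul]
    simp only [h1]
    rw [Finset.sum_comm]
    have h3 : ∀ a, ∑ c, ∑ a', (u m a * u m' a') * ∫ x, φ x ^ 2 * (ρ a (x, c) * ρ a' (x, c)) =
        u m a * (hGh.eigenvalues m' * u m' a) := by
      intro a
      rw [Finset.sum_comm]
      simp only [← Finset.mul_sum]
      have h4 := congrFun (hGh.mulVec_eigenvectorBasis m') a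
      simp only [Matrix.mulVec, dotProduct, Pi.smul_apply, smul_eq_mul] at h4
      rw [← h4, Finset.mul_sum]
      refine Finset.sum_congr rfl fun a' _ => ?_
      change _ = u m a * ((∑ c, ∫ x, φ x ^ 2 * (ρ a (x, c) * ρ a' (x, c))) * u m' a')
      ring
    simp only [h3]
    have h5 : ∀ a, u m a * (hGh.eigenvalues m' * u m' a) = hGh.eigenvalues m' * (u m a * u m' a) :=
      fun a => by ring
    simp only [h5, ← Finset.mul_sum, huo]
    by_cases hm : m = m'
    · subst hm; simp
    · simp [hm]

/-! ### Product trial states and their energy -/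

/-- The photon state `F` (wave functions of zero particles) times the particle wave function `χ`. -/
def tensor (F : SmoothVec L Λ 0) (χ : Config N → ℂ)
    (hχ : ContDiff ℝ (⊤ : ℕ∞) χ ∧ HasCompactSupport χ) : SmoothVec L Λ N :=
  ⟨fun ν x => F.val ν default * χ x, by
    refine ⟨F.finite.subset fun ν hν h0 => hν ?_, fun ν => ⟨contDiff_const.mul hχ.1, hχ.2.mul_left⟩⟩
    funext x; simp [h0]⟩

theorem tensor_val (F : SmoothVec L Λ 0) (χ : Config N → ℂ) (hχ ν x) :
    (tensor F χ hχ).val ν x = F.val ν default * χ x := rfl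

/-- The configuration space of zero particles is a point of volume one. Pure photon states are thus
a case of `SmoothVec`, and the operator calculus applies to them unchanged. -/
theorem inner_zero_particles (F F' : SmoothVec L Λ 0) :
    inner ℂ F F' = ∑' ν, (starRingEnd ℂ) (F.val ν default) * F'.val ν default := by
  rw [SmoothVec.inner_def, innerProd]
  refine tsum_congr fun ν => ?_
  rw [integral_unique]
  have : (volume : Measure (Config 0)).real Set.univ = 1 := by
    rw [volume_pi, Measure.real, Measure.pi_univ]; simp
  rw [this, one_smul]
  exact congrArg (fun x => (starRingEnd ℂ) (F.val ν x) * F'.val ν x) (Subsingleton.elim _ _)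

theorem inner_tensor (F F' : SmoothVec L Λ 0) (χ χ' : Config N → ℂ) (hχ hχ') :
    inner ℂ (tensor F χ hχ) (tensor F' χ' hχ') =
      inner ℂ F F' * ∫ x, (starRingEnd ℂ) (χ x) * χ' x := by
  rw [inner_zero_particles, SmoothVec.inner_def, innerProd, ← tsum_mul_right]
  refine tsum_congr fun ν => ?_
  rw [← integral_const_mul]
  refine integral_congr_ae (Filter.Eventually.of_forall fun x => ?_)
  simp only [tensor_val, map_mul]; ring

theorem ann_tensor (i : Mode L Λ) (F : SmoothVec L Λ 0) (χ : Config N → ℂ) (hχ) :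
    ann i (tensor F χ hχ) = tensor (ann i F) χ hχ := by
  refine SmoothVec.ext_val ?_
  funext ν x
  simp only [tensor_val, ann_val, annihilate]; ring

/-- The photon vacuum. -/
def vacuum (L Λ : ℝ) : SmoothVec L Λ 0 :=
  ⟨fun ν _ => Set.indicator {0} (fun _ => (1 : ℂ)) ν, by
    refine ⟨(Set.finite_singleton 0).subset fun ν hν => ?_, fun ν => ⟨contDiff_const, ?_⟩⟩
    · by_contra h
      exact hν (by funext x; exact Set.indicator_of_notMem h _)
    · exact HasCompactSupport.of_compactSpace _⟩

theorem vacuum_val_zero (x) : (vacuum L Λ).val 0 x = 1 :=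
  Set.indicator_of_mem (Set.mem_singleton (0 : Mode L Λ → ℕ)) fun _ => (1 : ℂ)

theorem vacuum_val_of_ne {ν : Mode L Λ → ℕ} (h : ν ≠ 0) : (vacuum L Λ).val ν = 0 :=
  funext fun _ => Set.indicator_of_notMem (s := {(0 : Mode L Λ → ℕ)}) (a := ν) (by simpa using h)
    fun _ => (1 : ℂ)

theorem ann_vacuum (i : Mode L Λ) : ann i (vacuum L Λ) = 0 := by
  refine SmoothVec.ext_val ?_
  funext ν x
  have h : ν + Pi.single i 1 ≠ 0 := fun h => by
    have := congrFun h i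
    simp at this
  rw [ann_val, annihilate, vacuum_val_of_ne h, map_zero]
  simp

theorem vacuum_hasPhotons : HasPhotons 0 (vacuum L Λ) := by
  intro ν hν
  by_cases h : ν = 0
  · simp [h]
  · exact absurd (vacuum_val_of_ne h) hν

theorem norm_vacuum : ‖vacuum L Λ‖ = 1 := by
  have h : inner ℂ (vacuum L Λ) (vacuum L Λ) = 1 := by
    rw [inner_zero_particles, tsum_eq_single 0]
    · simp [vacuum_val_zero]
    · intro ν hν
      simp [vacuum_val_of_ne hν]
  have h2 := norm_sq_eq_re_inner (𝕜 := ℂ) (vacuum L Λ)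
  rw [h] at h2
  exact (pow_eq_one_iff_of_nonneg (norm_nonneg _) two_ne_zero).1 (by simpa using h2)

/-- The product wave function `∏ φ(x_j)`. -/
def productFn (N : ℕ) (φ : Space → ℝ) : Config N → ℂ := fun x => ((∏ j, φ (x j) : ℝ) : ℂ)

variable {φ : Space → ℝ}

theorem contDiff_prod_apply (hφ : ContDiff ℝ (⊤ : ℕ∞) φ) (s : Finset (Fin N)) :
    ContDiff ℝ (⊤ : ℕ∞) fun x : Config N => ∏ j ∈ s, φ (x j) :=
  contDiff_prod fun j _ => hφ.comp (contDiff_apply ℝ Space j)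

theorem hasCompactSupport_prod_apply (hc : HasCompactSupport φ) :
    HasCompactSupport fun x : Config N => ∏ j, φ (x j) := by
  refine HasCompactSupport.of_support_subset_isCompact
    (isCompact_univ_pi (s := fun _ : Fin N => tsupport φ) fun _ => hc) fun x hx => ?_
  rw [Set.mem_univ_pi]
  intro j
  exact subset_tsupport _ fun h0 => hx (Finset.prod_eq_zero (Finset.mem_univ j) h0)

theorem productFn_admissible (hφ : ContDiff ℝ (⊤ : ℕ∞) φ) (hc : HasCompactSupport φ) :
    ContDiff ℝ (⊤ : ℕ∞) (productFn N φ) ∧ HasCompactSupport (productFn N φ) :=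
  ⟨Complex.ofRealCLM.contDiff.comp (contDiff_prod_apply hφ Finset.univ),
    (hasCompactSupport_prod_apply hc).comp_left (g := Complex.ofReal) (by simp)⟩

theorem integral_mul_prod_erase (h1 : ∫ x, φ x ^ 2 = 1) (j : Fin N) (ψ : Space → ℝ) :
    ∫ x : Config N, ψ (x j) * ∏ l ∈ Finset.univ.erase j, φ (x l) ^ 2 = ∫ x, ψ x := by
  have h2 : ∀ x : Config N, ψ (x j) * ∏ l ∈ Finset.univ.erase j, φ (x l) ^ 2 =
      ∏ l, (if l = j then ψ else fun y => φ y ^ 2) (x l) := by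
    intro x
    rw [← Finset.mul_prod_erase Finset.univ _ (Finset.mem_univ j), if_pos rfl]
    congr 1
    refine Finset.prod_congr rfl fun l hl => ?_
    rw [if_neg (Finset.ne_of_mem_erase hl)]
  simp only [h2]
  rw [integral_fintype_prod_volume_eq_prod (fun l => if l = j then ψ else fun y => φ y ^ 2),
    ← Finset.mul_prod_erase Finset.univ _ (Finset.mem_univ j), if_pos rfl, Finset.prod_eq_one, mul_one]
  intro l hl
  rw [if_neg (Finset.ne_of_mem_erase hl)]
  exact h1

theorem prod_sq_eq (j : Fin N) (x : Config N) :
    (∏ l, φ (x l)) * (∏ l, φ (x l)) = φ (x j) ^ 2 * ∏ l ∈ Finset.univ.erase j, φ (x l) ^ 2 := by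
  rw [← Finset.prod_mul_distrib, ← Finset.mul_prod_erase Finset.univ _ (Finset.mem_univ j)]
  simp only [sq]

theorem norm_tensor_productFn (hφ : ContDiff ℝ (⊤ : ℕ∞) φ) (hc : HasCompactSupport φ)
    (h1 : ∫ x, φ x ^ 2 = 1) (F : SmoothVec L Λ 0) :
    ‖tensor F (productFn N φ) (productFn_admissible hφ hc)‖ = ‖F‖ := by
  have h2 : ∫ x, (starRingEnd ℂ) (productFn N φ x) * productFn N φ x = 1 := by
    have h3 : ∀ x : Config N, (starRingEnd ℂ) (productFn N φ x) * productFn N φ x =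
        ((∏ l, φ (x l) ^ 2 : ℝ) : ℂ) := by
      intro x
      rw [productFn, Complex.conj_ofReal, ← Complex.ofReal_mul, ← Finset.prod_mul_distrib]
      simp only [sq]
    simp only [h3]
    rw [integral_complex_ofReal, integral_fintype_prod_volume_eq_prod (fun _ y => φ y ^ 2)]
    simp [h1]
  have h3 := inner_tensor F F (productFn N φ) (productFn N φ) (productFn_admissible hφ hc)
    (productFn_admissible hφ hc)
  rw [h2, mul_one] at h3
  have h4 : ‖tensor F (productFn N φ) (productFn_admissible hφ hc)‖ ^ 2 = ‖F‖ ^ 2 := by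
    rw [norm_sq_eq_re_inner (𝕜 := ℂ), h3, ← norm_sq_eq_re_inner (𝕜 := ℂ)]
  exact (sq_eq_sq₀ (norm_nonneg _) (norm_nonneg _)).1 h4

theorem norm_mom_tensor_productFn (hφ : ContDiff ℝ (⊤ : ℕ∞) φ) (hc : HasCompactSupport φ)
    (h1 : ∫ x, φ x ^ 2 = 1) (F : SmoothVec L Λ 0) (j : Fin N) (c : Fin 3) :
    ‖mom j c (tensor F (productFn N φ) (productFn_admissible hφ hc))‖ ^ 2 =
      (∫ x, (fderiv ℝ φ x (EuclideanSpace.single c 1)) ^ 2) * ‖F‖ ^ 2 := by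
  set dφ : Space → ℝ := fun x => fderiv ℝ φ x (EuclideanSpace.single c 1) with hd
  set D : Config N → ℝ := fun x => dφ (x j) * ∏ l ∈ Finset.univ.erase j, φ (x l) with hD
  have hdφ : ContDiff ℝ (⊤ : ℕ∞) dφ :=
    (hφ.fderiv_right (m := (⊤ : ℕ∞)) (by simp)).clm_apply contDiff_const
  have hderiv : ∀ x, fderiv ℝ (productFn N φ) x (Pi.single j (EuclideanSpace.single c 1)) = (D x : ℂ) := by
    intro x
    set v : Config N := Pi.single j (EuclideanSpace.single c 1) with hv
    have hdiff : DifferentiableAt ℝ (productFn N φ) x :=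
      (productFn_admissible hφ hc).1.differentiable (by simp) x
    rw [← (hdiff.hasFDerivAt.hasLineDerivAt v).lineDeriv, lineDeriv]
    have h2 : ∀ t : ℝ, productFn N φ (x + t • v) =
        ((φ (x j + t • EuclideanSpace.single c 1) * ∏ l ∈ Finset.univ.erase j, φ (x l) : ℝ) : ℂ) := by
      intro t
      rw [productFn, ← Finset.mul_prod_erase Finset.univ _ (Finset.mem_univ j)]
      congr 2
      · simp [hv]
      · refine Finset.prod_congr rfl fun l hl => ?_
        have : l ≠ j := Finset.ne_of_mem_erase hl
        simp [hv, this]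
    simp only [h2]
    have h3 : HasDerivAt (fun t : ℝ => φ (x j + t • EuclideanSpace.single c 1)) (dφ (x j)) 0 :=
      ((hφ.differentiable (by simp) (x j)).hasFDerivAt.hasLineDerivAt _)
    exact ((h3.mul_const _).ofReal_comp).deriv
  have hval : ∀ ν x, (mom j c (tensor F (productFn N φ) (productFn_admissible hφ hc))).val ν x =
      F.val ν default * (-Complex.I * D x) := by
    intro ν x
    rw [mom_val, momentum]
    have h2 : (tensor F (productFn N φ) (productFn_admissible hφ hc)).val ν =
        F.val ν default • productFn N φ := rfl
    rw [h2, fderiv_const_smul ((productFn_admissible hφ hc).1.differentiable (by simp) x)]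
    rw [smul_apply, hderiv, smul_eq_mul]
    ring
  have h2 : inner ℂ (mom j c (tensor F (productFn N φ) (productFn_admissible hφ hc)))
      (mom j c (tensor F (productFn N φ) (productFn_admissible hφ hc))) =
      inner ℂ F F * ((∫ x, dφ x ^ 2 : ℝ) : ℂ) := by
    rw [inner_zero_particles, SmoothVec.inner_def, innerProd, ← tsum_mul_right]
    refine tsum_congr fun ν => ?_
    have h3 : ∀ x, (starRingEnd ℂ) ((mom j c (tensor F (productFn N φ) (productFn_admissible hφ hc))).val ν x) *
        (mom j c (tensor F (productFn N φ) (productFn_admissible hφ hc))).val ν x =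
        (starRingEnd ℂ) (F.val ν default) * F.val ν default *
          ((dφ (x j) ^ 2 * ∏ l ∈ Finset.univ.erase j, φ (x l) ^ 2 : ℝ) : ℂ) := by
      intro x
      rw [hval, map_mul, map_mul, map_neg, Complex.conj_I, Complex.conj_ofReal]
      have : (D x : ℂ) * D x = ((dφ (x j) ^ 2 * ∏ l ∈ Finset.univ.erase j, φ (x l) ^ 2 : ℝ) : ℂ) := by
        rw [← Complex.ofReal_mul, hD]
        congr 1
        rw [Finset.prod_pow]; ring
      rw [← this]
      linear_combination (-(starRingEnd ℂ) (F.val ν default) * F.val ν default * (D x : ℂ) * D x) * Complex.I_mul_I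
    simp only [h3]
    rw [integral_const_mul, integral_complex_ofReal, integral_mul_prod_erase h1 j fun y => dφ y ^ 2]
  rw [norm_sq_eq_re_inner (𝕜 := ℂ), h2, mul_comm, re_ofReal_mul_inner_self]

/-- Real coordinates are decisive here: the creation and annihilation parts of mode `b_m` receive
the same coefficient `ρ_m(x_j, c)`, so `A` contains only the combinations `b_m + b_m*`. -/
theorem vecPot_tensor_productFn {ε : (Fin 3 → ℤ) → Fin 2 → Space} {b : Fin M → Mode L Λ → ℂ}
    {ρ : Fin M → Space × Fin 3 → ℝ}
    (hf : ∀ x i, photonState ε x i = ∑ m, (ρ m x : ℂ) * b m i)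
    (hφ : ContDiff ℝ (⊤ : ℕ∞) φ) (hc : HasCompactSupport φ) (F : SmoothVec L Λ 0) (j : Fin N)
    (c : Fin 3) (ν x) :
    (vecPot ε j c (tensor F (productFn N φ) (productFn_admissible hφ hc))).val ν x =
      ∑ m, (annB b m F + creB b m F).val ν default * ((ρ m (x j, c) : ℂ) * productFn N φ x) := by
  have e1 : ∀ i : Mode L Λ, (1 / Real.sqrt (2 * L ^ 3) : ℂ) * ((ε i.1.1 i.2 c / Real.sqrt ‖i.k‖ : ℝ) : ℂ) *
      Complex.exp (-(Complex.I * (inner ℝ i.k (x j) : ℝ))) = ∑ m, (ρ m (x j, c) : ℂ) * b m i := by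
    intro i
    rw [← hf]
    simp only [photonState]
    push_cast; ring
  have e2 : ∀ i : Mode L Λ, (1 / Real.sqrt (2 * L ^ 3) : ℂ) * ((ε i.1.1 i.2 c / Real.sqrt ‖i.k‖ : ℝ) : ℂ) *
      Complex.exp (Complex.I * (inner ℝ i.k (x j) : ℝ)) =
        ∑ m, (ρ m (x j, c) : ℂ) * (starRingEnd ℂ) (b m i) := by
    intro i
    have := congrArg (starRingEnd ℂ) (e1 i)
    rw [map_sum, map_mul, ← Complex.exp_conj] at this
    simpa using this
  rw [vecPot_val, vectorPotential, Finset.mul_sum]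
  have e3 : ∀ i : Mode L Λ, (1 / Real.sqrt (2 * L ^ 3) : ℂ) * (((ε i.1.1 i.2 c / Real.sqrt ‖i.k‖ : ℝ) : ℂ) *
      (Complex.exp (Complex.I * (inner ℝ i.k (x j) : ℝ)) *
          annihilate i (tensor F (productFn N φ) (productFn_admissible hφ hc)).val ν x +
        Complex.exp (-(Complex.I * (inner ℝ i.k (x j) : ℝ))) *
          create i (tensor F (productFn N φ) (productFn_admissible hφ hc)).val ν x)) =
      ∑ m, ((starRingEnd ℂ) (b m i) * (ann i F).val ν default + b m i * (cre i F).val ν default) *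
        ((ρ m (x j, c) : ℂ) * productFn N φ x) := by
    intro i
    have e4 : annihilate i (tensor F (productFn N φ) (productFn_admissible hφ hc)).val ν x =
        (ann i F).val ν default * productFn N φ x := by
      simp only [annihilate, tensor_val, ann_val]; ring
    have e5 : create i (tensor F (productFn N φ) (productFn_admissible hφ hc)).val ν x =
        (cre i F).val ν default * productFn N φ x := by
      simp only [create, tensor_val, cre_val]; ring
    rw [e4, e5]
    calc _ = ((1 / Real.sqrt (2 * L ^ 3) : ℂ) * ((ε i.1.1 i.2 c / Real.sqrt ‖i.k‖ : ℝ) : ℂ) *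
          Complex.exp (Complex.I * (inner ℝ i.k (x j) : ℝ))) * ((ann i F).val ν default * productFn N φ x) +
        ((1 / Real.sqrt (2 * L ^ 3) : ℂ) * ((ε i.1.1 i.2 c / Real.sqrt ‖i.k‖ : ℝ) : ℂ) *
          Complex.exp (-(Complex.I * (inner ℝ i.k (x j) : ℝ)))) * ((cre i F).val ν default * productFn N φ x) := by
          ring
      _ = _ := by
        rw [e1, e2, Finset.sum_mul, Finset.sum_mul, ← Finset.sum_add_distrib]
        exact Finset.sum_congr rfl fun m _ => by ring
  simp only [e3]
  rw [Finset.sum_comm]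
  refine Finset.sum_congr rfl fun m _ => ?_
  rw [← Finset.sum_mul]
  congr 1
  simp only [annB, creB, LinearMap.sum_apply, LinearMap.smul_apply, map_add, Pi.add_apply, val_sum,
    map_smul, Pi.smul_apply, smul_eq_mul, Finset.sum_add_distrib]

theorem sum_norm_vecPot_tensor_productFn {ε : (Fin 3 → ℤ) → Fin 2 → Space} {b : Fin M → Mode L Λ → ℂ}
    {ρ : Fin M → Space × Fin 3 → ℝ} {g : Fin M → ℝ}
    (hb : ∀ m m', ∑ i, (starRingEnd ℂ) (b m i) * b m' i = if m = m' then 1 else 0)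
    (hf : ∀ x i, photonState ε x i = ∑ m, (ρ m x : ℂ) * b m i)
    (hg : ∀ m m', ∑ c, ∫ x, φ x ^ 2 * (ρ m (x, c) * ρ m' (x, c)) = if m = m' then g m else 0)
    (hφ : ContDiff ℝ (⊤ : ℕ∞) φ) (hc : HasCompactSupport φ) (h1 : ∫ x, φ x ^ 2 = 1)
    (F : SmoothVec L Λ 0) (j : Fin N) :
    ∑ c, ‖vecPot ε j c (tensor F (productFn N φ) (productFn_admissible hφ hc))‖ ^ 2 =
      ∑ m, g m * ‖annB b m F + creB b m F‖ ^ 2 := by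
  have hadm : ∀ m c, ContDiff ℝ (⊤ : ℕ∞) (fun x : Config N => (ρ m (x j, c) : ℂ) * productFn N φ x) ∧
      HasCompactSupport fun x : Config N => (ρ m (x j, c) : ℂ) * productFn N φ x := by
    intro m c
    refine ⟨(Complex.ofRealCLM.contDiff.comp ?_).mul (productFn_admissible hφ hc).1,
      (productFn_admissible hφ hc).2.mul_left⟩
    exact (contDiff_coord hb hf m c).comp (contDiff_apply ℝ Space j)
  have h2 : ∀ c, vecPot ε j c (tensor F (productFn N φ) (productFn_admissible hφ hc)) =
      ∑ m, tensor (annB b m F + creB b m F) _ (hadm m c) := by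
    intro c
    refine SmoothVec.ext_val ?_
    funext ν x
    rw [vecPot_tensor_productFn hf hφ hc, val_sum]
    simp only [tensor_val]
  have h3 : ∀ c m m', ∫ x : Config N, (starRingEnd ℂ) ((ρ m (x j, c) : ℂ) * productFn N φ x) *
      ((ρ m' (x j, c) : ℂ) * productFn N φ x) =
      ((∫ x, φ x ^ 2 * (ρ m (x, c) * ρ m' (x, c)) : ℝ) : ℂ) := by
    intro c m m'
    rw [← integral_mul_prod_erase h1 j, ← integral_complex_ofReal]
    refine integral_congr_ae (Filter.Eventually.of_forall fun x => ?_)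
    simp only [productFn]
    rw [map_mul, Complex.conj_ofReal, Complex.conj_ofReal, ← Complex.ofReal_mul, ← Complex.ofReal_mul,
      ← Complex.ofReal_mul]
    congr 1
    have := prod_sq_eq (φ := φ) j x
    linear_combination (ρ m (x j, c) * ρ m' (x j, c)) * this
  have h4 : ∀ c, ‖vecPot ε j c (tensor F (productFn N φ) (productFn_admissible hφ hc))‖ ^ 2 =
      ∑ m, ∑ m', (∫ x, φ x ^ 2 * (ρ m (x, c) * ρ m' (x, c))) *
        RCLike.re (inner ℂ (annB b m F + creB b m F) (annB b m' F + creB b m' F)) := by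
    intro c
    rw [norm_sq_eq_re_inner (𝕜 := ℂ), h2, sum_inner, map_sum]
    simp only [inner_sum, map_sum, inner_tensor, h3]
    refine Finset.sum_congr rfl fun m _ => Finset.sum_congr rfl fun m' _ => ?_
    rw [mul_comm]
    exact Complex.re_ofReal_mul _ _
  simp only [h4]
  rw [Finset.sum_comm]
  have h5 : ∀ m, ∑ c, ∑ m', (∫ x, φ x ^ 2 * (ρ m (x, c) * ρ m' (x, c))) *
        RCLike.re (inner ℂ (annB b m F + creB b m F) (annB b m' F + creB b m' F)) =
      g m * ‖annB b m F + creB b m F‖ ^ 2 := by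
    intro m
    rw [Finset.sum_comm]
    simp only [← Finset.sum_mul, hg]
    rw [Finset.sum_eq_single m (fun m' _ h => by rw [if_neg h.symm, zero_mul]) (by simp), if_pos rfl,
      norm_sq_eq_re_inner (𝕜 := ℂ)]
  simp only [h5]

/-- `½ ‖u + v‖² ≤ ‖u‖² + ‖v‖²` removes the cross term between `p` and `A`, and `|k| < Λ` replaces
every photon energy by `Λ`, leaving independent oscillators in the modes `b_m`. -/
theorem energy_tensor_productFn_le (hL : 0 < L) {α : ℝ} (hα : 0 ≤ α)
    {ε : (Fin 3 → ℤ) → Fin 2 → Space} {b : Fin M → Mode L Λ → ℂ}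
    {ρ : Fin M → Space × Fin 3 → ℝ} {g : Fin M → ℝ}
    (hb : ∀ m m', ∑ i, (starRingEnd ℂ) (b m i) * b m' i = if m = m' then 1 else 0)
    (hf : ∀ x i, photonState ε x i = ∑ m, (ρ m x : ℂ) * b m i)
    (hg : ∀ m m', ∑ c, ∫ x, φ x ^ 2 * (ρ m (x, c) * ρ m' (x, c)) = if m = m' then g m else 0)
    (hφ : ContDiff ℝ (⊤ : ℕ∞) φ) (hc : HasCompactSupport φ) (h1 : ∫ x, φ x ^ 2 = 1)
    (F : SmoothVec L Λ 0) :
    energy α ε (tensor F (productFn N φ) (productFn_admissible hφ hc)) ≤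
      N * (∑ c, ∫ x, (fderiv ℝ φ x (EuclideanSpace.single c 1)) ^ 2) * ‖F‖ ^ 2 +
      α * N * ∑ m, g m * ‖annB b m F + creB b m F‖ ^ 2 + Λ * ∑ i : Mode L Λ, ‖ann i F‖ ^ 2 := by
  set Ψ : SmoothVec L Λ N := tensor F (productFn N φ) (productFn_admissible hφ hc) with hΨ
  have h2 : ∀ j : Fin N, ∑ c, ‖covMom α ε j c Ψ‖ ^ 2 ≤
      2 * ((∑ c, ∫ x, (fderiv ℝ φ x (EuclideanSpace.single c 1)) ^ 2) * ‖F‖ ^ 2) +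
      2 * (α * ∑ m, g m * ‖annB b m F + creB b m F‖ ^ 2) := by
    intro j
    rw [← sum_norm_vecPot_tensor_productFn hb hf hg hφ hc h1 F j, Finset.mul_sum, Finset.mul_sum,
      Finset.sum_mul, Finset.mul_sum, ← Finset.sum_add_distrib]
    refine Finset.sum_le_sum fun c _ => ?_
    rw [← norm_mom_tensor_productFn hφ hc h1 F j c, ← hΨ]
    have h3 : ‖covMom α ε j c Ψ‖ ≤ ‖mom j c Ψ‖ + Real.sqrt α * ‖vecPot ε j c Ψ‖ := by
      rw [covMom, LinearMap.add_apply, LinearMap.smul_apply]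
      refine (norm_add_le _ _).trans (le_of_eq ?_)
      rw [norm_smul, Complex.norm_real, Real.norm_of_nonneg (Real.sqrt_nonneg _)]
    have h4 := pow_le_pow_left₀ (norm_nonneg _) h3 2
    have h5 := Real.sq_sqrt hα
    nlinarith [sq_nonneg (‖mom j c Ψ‖ - Real.sqrt α * ‖vecPot ε j c Ψ‖)]
  have h3 := Finset.sum_le_sum (s := Finset.univ) fun (j : Fin N) _ => h2 j
  rw [Finset.sum_const, Finset.card_univ, Fintype.card_fin, nsmul_eq_mul] at h3
  have h4 : ∑ i : Mode L Λ, ‖i.k‖ * ‖ann i Ψ‖ ^ 2 ≤ Λ * ∑ i : Mode L Λ, ‖ann i F‖ ^ 2 := by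
    rw [Finset.mul_sum]
    refine Finset.sum_le_sum fun i _ => ?_
    rw [hΨ, ann_tensor, norm_tensor_productFn hφ hc h1]
    exact mul_le_mul_of_nonneg_right (i.k_norm_lt hL).le (by positivity)
  rw [energy]
  linarith

theorem tensor_isBosonic (hφ : ContDiff ℝ (⊤ : ℕ∞) φ) (hc : HasCompactSupport φ)
    (F : SmoothVec L Λ 0) :
    IsBosonic (tensor F (productFn N φ) (productFn_admissible hφ hc)).val where
  finite_support := SmoothVec.finite _
  smooth := SmoothVec.smooth _
  compact_support := SmoothVec.compact _
  symmetric σ ν x := by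
    rw [tensor_val, tensor_val, productFn, productFn, Equiv.prod_comp σ fun j => φ (x j)]

/-- The `L²`-normalized dilation `r^{-1/2} η(t/r)`. -/
def dilate (r : ℝ) (η : ℝ → ℝ) (t : ℝ) : ℝ := (Real.sqrt r)⁻¹ * η (t / r)

/-! ### One-dimensional profiles and the kernel inverting `1 + Λ⁻¹ d/dt` -/

section Profile

variable {η : ℝ → ℝ} {r : ℝ}

theorem contDiff_dilate (hη : ContDiff ℝ (⊤ : ℕ∞) η) : ContDiff ℝ (⊤ : ℕ∞) (dilate r η) :=
  contDiff_const.mul (hη.comp (contDiff_id.div_const r))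

theorem dilate_eq_zero (hr : 0 < r) (h0 : ∀ t, 1 ≤ |t| → η t = 0) {t : ℝ} (ht : r ≤ |t|) :
    dilate r η t = 0 := by
  rw [dilate, h0, mul_zero]
  rw [abs_div, abs_of_pos hr, le_div_iff₀ hr]
  linarith

theorem hasCompactSupport_of_eq_zero {E : Type*} [Zero E] {f : ℝ → E} {R : ℝ}
    (h0 : ∀ t, R ≤ |t| → f t = 0) : HasCompactSupport f := by
  refine HasCompactSupport.intro (isCompact_Icc (a := -R) (b := R)) fun t ht => h0 t ?_
  by_contra h
  exact ht (abs_le.1 (not_le.1 h).le)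

theorem integral_dilate_sq (hr : 0 < r) (h1 : ∫ t, η t ^ 2 = 1) : ∫ t, dilate r η t ^ 2 = 1 := by
  simp only [dilate, mul_pow, inv_pow, Real.sq_sqrt hr.le]
  rw [integral_const_mul, Measure.integral_comp_div (fun t => η t ^ 2), h1, abs_of_pos hr]
  simp [hr.ne']

theorem deriv_dilate (hη : ContDiff ℝ (⊤ : ℕ∞) η) (t : ℝ) :
    deriv (dilate r η) t = r⁻¹ * dilate r (deriv η) t := by
  have h := (((hη.differentiable (by simp) (t / r)).hasDerivAt.comp t
    ((hasDerivAt_id t).div_const r)).const_mul (Real.sqrt r)⁻¹).deriv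
  have h2 : dilate r η = fun t => (Real.sqrt r)⁻¹ * (η ∘ fun x => id x / r) t := rfl
  rw [h2, h, dilate]
  ring

theorem integral_deriv_dilate_sq (hr : 0 < r) (hη : ContDiff ℝ (⊤ : ℕ∞) η) :
    ∫ t, deriv (dilate r η) t ^ 2 = (∫ t, deriv η t ^ 2) / r ^ 2 := by
  simp only [deriv_dilate hη, dilate, mul_pow, inv_pow, Real.sq_sqrt hr.le]
  rw [integral_const_mul, integral_const_mul, Measure.integral_comp_div (fun t => deriv η t ^ 2),
    abs_of_pos hr, smul_eq_mul]
  field_simp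

/-- `φ(t) e^{iκt}`. -/
def modulated (φ : ℝ → ℝ) (κ t : ℝ) : ℂ := φ t * Complex.exp (Complex.I * ((κ * t : ℝ) : ℂ))

/-- `(1 + Λ⁻¹ d/dt) (φ(t) e^{iκt})`. -/
def modulatedDeriv (Λ : ℝ) (φ : ℝ → ℝ) (κ t : ℝ) : ℂ :=
  (φ t + (deriv φ t + Complex.I * κ * φ t) / Λ) * Complex.exp (Complex.I * ((κ * t : ℝ) : ℂ))

variable {φ : ℝ → ℝ} {Λ κ : ℝ}

theorem continuous_modulatedDeriv (hφ : ContDiff ℝ (⊤ : ℕ∞) φ) :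
    Continuous (modulatedDeriv Λ φ κ) := by
  have := hφ.continuous
  have := hφ.continuous_deriv (by simp)
  unfold modulatedDeriv
  fun_prop

theorem hasDerivAt_modulated (hφ : ContDiff ℝ (⊤ : ℕ∞) φ) (t : ℝ) :
    HasDerivAt (modulated φ κ)
      ((deriv φ t + Complex.I * κ * φ t) * Complex.exp (Complex.I * ((κ * t : ℝ) : ℂ))) t := by
  have h1 : HasDerivAt (fun t => (φ t : ℂ)) ((deriv φ t : ℝ) : ℂ) t :=
    (hφ.differentiable (by simp) t).hasDerivAt.ofReal_comp
  have h2 : HasDerivAt (fun t : ℝ => Complex.I * ((κ * t : ℝ) : ℂ)) (Complex.I * ((κ * 1 : ℝ) : ℂ)) t :=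
    (((hasDerivAt_id t).const_mul κ).ofReal_comp).const_mul Complex.I
  have h3 := h1.mul h2.cexp
  refine h3.congr_deriv ?_
  push_cast
  ring

theorem deriv_eq_zero_of_eq_zero {R : ℝ} (h0 : ∀ t, R ≤ |t| → φ t = 0) {t : ℝ} (ht : R < |t|) :
    deriv φ t = 0 := by
  have h : φ =ᶠ[nhds t] fun _ => 0 := by
    filter_upwards [(isOpen_lt continuous_const continuous_abs).mem_nhds ht] with s hs
    exact h0 s (le_of_lt hs)
  rw [h.deriv_eq, deriv_const]

theorem modulatedDeriv_eq_zero {R : ℝ} (h0 : ∀ t, R ≤ |t| → φ t = 0) {t : ℝ} (ht : R < |t|) :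
    modulatedDeriv Λ φ κ t = 0 := by
  simp [modulatedDeriv, deriv_eq_zero_of_eq_zero h0 ht, h0 t ht.le]

theorem norm_modulatedDeriv_sq_le (hΛ : 0 < Λ) (hκ : |κ| ≤ Λ) (t : ℝ) :
    ‖modulatedDeriv Λ φ κ t‖ ^ 2 ≤ 3 * φ t ^ 2 + 2 / Λ ^ 2 * deriv φ t ^ 2 := by
  have h1 : ‖Complex.exp (Complex.I * ((κ * t : ℝ) : ℂ))‖ = 1 := by
    rw [mul_comm]; exact Complex.norm_exp_ofReal_mul_I _
  have h2 : (φ t + (deriv φ t + Complex.I * κ * φ t) / Λ : ℂ) =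
      ((φ t + deriv φ t / Λ : ℝ) : ℂ) + ((κ / Λ * φ t : ℝ) : ℂ) * Complex.I := by
    push_cast; ring
  rw [modulatedDeriv, norm_mul, h1, mul_one, h2, ← Complex.normSq_eq_norm_sq, Complex.normSq_add_mul_I]
  have h3 : (κ / Λ) ^ 2 ≤ 1 := by
    rw [← sq_abs, abs_div, abs_of_pos hΛ]
    exact pow_le_one₀ (by positivity) ((div_le_one hΛ).2 hκ)
  have h4 : 2 / Λ ^ 2 * deriv φ t ^ 2 = 2 * (deriv φ t / Λ) ^ 2 := by ring
  rw [h4, mul_pow]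
  nlinarith [sq_nonneg (φ t - deriv φ t / Λ), sq_nonneg (φ t)]

/-- Applying `1 + Λ⁻¹ d/dt` costs only a constant: frequencies do not exceed `Λ`, and the profile
varies on the scale `r ≥ 1/Λ`. The bound does not depend on `r`, `Λ` or `κ`. -/
theorem integral_norm_modulatedDeriv_sq_le (hr : 0 < r) (hη : ContDiff ℝ (⊤ : ℕ∞) η)
    (h0 : ∀ t, 1 ≤ |t| → η t = 0) (h1 : ∫ t, η t ^ 2 = 1) (hΛ : 1 ≤ r * Λ) (hκ : |κ| ≤ Λ) :
    ∫ t, ‖modulatedDeriv Λ (dilate r η) κ t‖ ^ 2 ≤ 3 + 2 * ∫ t, deriv η t ^ 2 := by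
  have hΛ0 : 0 < Λ := by
    by_contra h
    nlinarith
  have hc := contDiff_dilate (r := r) hη
  have hz : ∀ t, r ≤ |t| → dilate r η t = 0 := fun t ht => dilate_eq_zero hr h0 ht
  have hz2 : ∀ t, r + 1 ≤ |t| → deriv (dilate r η) t = 0 := fun t ht =>
    deriv_eq_zero_of_eq_zero hz (by linarith)
  have hz3 : ∀ t, r + 1 ≤ |t| → modulatedDeriv Λ (dilate r η) κ t = 0 := fun t ht =>
    modulatedDeriv_eq_zero hz (by linarith)
  have i1 : Integrable fun t => dilate r η t ^ 2 := by
    refine (hc.continuous.pow 2).integrable_of_hasCompactSupport ?_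
    exact hasCompactSupport_of_eq_zero (R := r) fun t ht => by rw [Pi.pow_apply, hz t ht]; simp
  have i2 : Integrable fun t => deriv (dilate r η) t ^ 2 := by
    refine ((hc.continuous_deriv (by simp)).pow 2).integrable_of_hasCompactSupport ?_
    exact hasCompactSupport_of_eq_zero (R := r + 1) fun t ht => by rw [Pi.pow_apply, hz2 t ht]; simp
  have i3 : Integrable fun t => ‖modulatedDeriv Λ (dilate r η) κ t‖ ^ 2 := by
    refine ((continuous_modulatedDeriv hc).norm.pow 2).integrable_of_hasCompactSupport ?_
    exact hasCompactSupport_of_eq_zero (R := r + 1) fun t ht => by rw [Pi.pow_apply, hz3 t ht]; simp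
  refine (integral_mono (g := fun t => 3 * dilate r η t ^ 2 + 2 / Λ ^ 2 * deriv (dilate r η) t ^ 2)
    i3 ((i1.const_mul 3).add (i2.const_mul (2 / Λ ^ 2)))
    fun t => norm_modulatedDeriv_sq_le hΛ0 hκ t).trans ?_
  rw [integral_add (i1.const_mul 3) (i2.const_mul (2 / Λ ^ 2)), integral_const_mul,
    integral_const_mul, integral_dilate_sq hr h1, integral_deriv_dilate_sq hr hη]
  have hI : 0 ≤ ∫ t, deriv η t ^ 2 := integral_nonneg fun t => sq_nonneg _
  have h5 : 2 / Λ ^ 2 * ((∫ t, deriv η t ^ 2) / r ^ 2) = 2 * ((∫ t, deriv η t ^ 2) / (r * Λ) ^ 2) := by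
    field_simp
  rw [h5]
  have h6 : (∫ t, deriv η t ^ 2) / (r * Λ) ^ 2 ≤ ∫ t, deriv η t ^ 2 :=
    div_le_self hI (one_le_pow₀ hΛ)
  linarith

/-- The integral kernel on `[-r, r]` inverting `1 + Λ⁻¹ d/dt`. -/
def expKernel (r Λ t s : ℝ) : ℝ :=
  if -r ≤ s ∧ s ≤ t ∧ t ≤ r then Λ * Real.exp (-(Λ * (t - s))) else 0

theorem expKernel_eq_indicator (r Λ : ℝ) {t : ℝ} (ht : t ≤ r) (s : ℝ) :
    expKernel r Λ t s = (Set.Icc (-r) t).indicator (fun s => Λ * Real.exp (-(Λ * (t - s)))) s := by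
  rw [expKernel, Set.indicator_apply]
  simp [Set.mem_Icc, ht]

theorem expKernel_eq_zero {r Λ t s : ℝ} (ht : ¬ (-r ≤ t ∧ t ≤ r)) : expKernel r Λ t s = 0 := by
  rw [expKernel, if_neg]
  rintro ⟨h1, h2, h3⟩
  exact ht ⟨h1.trans h2, h3⟩

/-- The integrand is the derivative of `e^{-Λ(t-s)} φ(s) e^{iκs}`, which vanishes at `s = -r`. For
`t` outside `[-r, r]` both sides are zero, so the kernel may be cut off there; this is what makes it
square integrable. -/
theorem integral_expKernel_mul (hφ : ContDiff ℝ (⊤ : ℕ∞) φ) (hΛ : Λ ≠ 0)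
    (h0 : ∀ t, r ≤ |t| → φ t = 0) (t : ℝ) :
    ∫ s, (expKernel r Λ t s : ℂ) * modulatedDeriv Λ φ κ s = modulated φ κ t := by
  by_cases ht : -r ≤ t ∧ t ≤ r
  · have h1 : ∀ s, (expKernel r Λ t s : ℂ) * modulatedDeriv Λ φ κ s =
        (Set.Icc (-r) t).indicator (fun s => ((Λ * Real.exp (-(Λ * (t - s))) : ℝ) : ℂ) *
          modulatedDeriv Λ φ κ s) s := by
      intro s
      rw [expKernel_eq_indicator r Λ ht.2, Set.indicator_apply, Set.indicator_apply]
      split_ifs <;> simp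
    simp only [h1]
    rw [integral_indicator measurableSet_Icc, integral_Icc_eq_integral_Ioc,
      ← intervalIntegral.integral_of_le ht.1]
    have h2 : ∀ s ∈ Set.uIcc (-r) t, HasDerivAt
        (fun s => ((Real.exp (-(Λ * (t - s))) : ℝ) : ℂ) * modulated φ κ s)
        (((Λ * Real.exp (-(Λ * (t - s))) : ℝ) : ℂ) * modulatedDeriv Λ φ κ s) s := by
      intro s _
      have h3 : HasDerivAt (fun s => Real.exp (-(Λ * (t - s))))
          (Real.exp (-(Λ * (t - s))) * -(Λ * (0 - 1))) s :=
        ((((hasDerivAt_const s t).sub (hasDerivAt_id s)).const_mul Λ).neg).exp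
      refine (h3.ofReal_comp.mul (hasDerivAt_modulated hφ s)).congr_deriv ?_
      have hΛ' : (Λ : ℂ) ≠ 0 := by exact_mod_cast hΛ
      simp only [modulatedDeriv, modulated]
      push_cast
      field_simp
      ring
    rw [intervalIntegral.integral_eq_sub_of_hasDerivAt h2]
    · have h4 : modulated φ κ (-r) = 0 := by
        rw [modulated, h0 (-r) (by rw [abs_neg]; exact le_abs_self r)]; simp
      simp [h4]
    · refine Continuous.intervalIntegrable ?_ _ _
      have := continuous_modulatedDeriv (Λ := Λ) (κ := κ) hφ
      fun_prop
  · simp only [expKernel_eq_zero ht]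
    have : r ≤ |t| := by
      by_contra h
      exact ht (abs_le.1 (not_le.1 h).le)
    simp [modulated, h0 t this]

theorem measurable_expKernel : Measurable (Function.uncurry (expKernel r Λ)) := by
  unfold expKernel Function.uncurry
  refine Measurable.ite ?_ (by fun_prop) measurable_const
  exact (measurableSet_le measurable_const measurable_snd).inter
    ((measurableSet_le measurable_snd measurable_fst).inter
      (measurableSet_le measurable_fst measurable_const))

theorem abs_expKernel_le (hΛ : 0 < Λ) (t s : ℝ) : |expKernel r Λ t s| ≤ Λ := by
  rw [expKernel]
  split_ifs with h
  · rw [abs_of_nonneg (by positivity)]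
    refine mul_le_of_le_one_right hΛ.le (Real.exp_le_one_iff.2 ?_)
    have := mul_nonneg hΛ.le (sub_nonneg.2 h.2.1)
    linarith
  · simpa using hΛ.le

theorem expKernel_sq_eq_indicator {s : ℝ} (hs : -r ≤ s) (t : ℝ) :
    expKernel r Λ t s ^ 2 =
      (Set.Icc s r).indicator (fun t => Λ ^ 2 * Real.exp (-(2 * Λ * (t - s)))) t := by
  rw [expKernel, Set.indicator_apply]
  simp only [Set.mem_Icc, hs, true_and]
  split_ifs
  · rw [mul_pow, ← Real.exp_nat_mul]
    congr 2; push_cast; ring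
  · simp

theorem expKernel_eq_zero_of_right {t s : ℝ} (hs : ¬ (-r ≤ s ∧ s ≤ r)) : expKernel r Λ t s = 0 := by
  rw [expKernel, if_neg]
  rintro ⟨h1, h2, h3⟩
  exact hs ⟨h1, h2.trans h3⟩

theorem integrable_expKernel_sq (s : ℝ) : Integrable fun t => expKernel r Λ t s ^ 2 := by
  by_cases hs : -r ≤ s ∧ s ≤ r
  · simp only [expKernel_sq_eq_indicator hs.1]
    rw [integrable_indicator_iff measurableSet_Icc]
    exact Continuous.integrableOn_Icc (by fun_prop)
  · simp [expKernel_eq_zero_of_right hs]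

/-- Integrating this bound over `s` yields a squared Hilbert–Schmidt norm of at most `2r · Λ/2 = rΛ`
per dimension. -/
theorem integral_expKernel_sq_le (hΛ : 0 < Λ) (s : ℝ) :
    ∫ t, expKernel r Λ t s ^ 2 ≤ (Set.Icc (-r) r).indicator (fun _ => Λ / 2) s := by
  by_cases hs : -r ≤ s ∧ s ≤ r
  · rw [Set.indicator_of_mem (Set.mem_Icc.2 hs)]
    simp only [expKernel_sq_eq_indicator hs.1]
    rw [integral_indicator measurableSet_Icc, integral_Icc_eq_integral_Ioc,
      ← intervalIntegral.integral_of_le hs.2]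
    have h2 : ∀ t ∈ Set.uIcc s r, HasDerivAt
        (fun t => -(Λ / 2 * Real.exp (-(2 * Λ * (t - s))))) (Λ ^ 2 * Real.exp (-(2 * Λ * (t - s)))) t := by
      intro t _
      have h3 : HasDerivAt (fun t => Real.exp (-(2 * Λ * (t - s))))
          (Real.exp (-(2 * Λ * (t - s))) * -(2 * Λ * (1 - 0))) t :=
        ((((hasDerivAt_id t).sub (hasDerivAt_const t s)).const_mul (2 * Λ)).neg).exp
      refine ((h3.const_mul (Λ / 2)).neg).congr_deriv ?_
      ring
    rw [intervalIntegral.integral_eq_sub_of_hasDerivAt h2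
      (Continuous.intervalIntegrable (by fun_prop) _ _)]
    simp
    positivity
  · simp only [expKernel_eq_zero_of_right hs]
    simp only [ne_eq, OfNat.ofNat_ne_zero, not_false_eq_true, zero_pow, integral_zero]
    exact Set.indicator_nonneg (fun _ _ => by positivity) _

theorem integrable_modulatedDeriv (hφ : ContDiff ℝ (⊤ : ℕ∞) φ) (h0 : ∀ t, r ≤ |t| → φ t = 0) :
    Integrable (modulatedDeriv Λ φ κ) :=
  (continuous_modulatedDeriv hφ).integrable_of_hasCompactSupport
    (hasCompactSupport_of_eq_zero (R := r + 1) fun _ ht => modulatedDeriv_eq_zero h0 (by linarith))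

theorem integrable_norm_modulatedDeriv_sq (hφ : ContDiff ℝ (⊤ : ℕ∞) φ)
    (h0 : ∀ t, r ≤ |t| → φ t = 0) : Integrable fun t => ‖modulatedDeriv Λ φ κ t‖ ^ 2 :=
  ((continuous_modulatedDeriv hφ).norm.pow 2).integrable_of_hasCompactSupport
    (hasCompactSupport_of_eq_zero (R := r + 1) fun _ ht => by
      rw [Pi.pow_apply, modulatedDeriv_eq_zero h0 (by linarith)]; simp)

theorem integrable_expKernel_mul (hφ : ContDiff ℝ (⊤ : ℕ∞) φ) (hΛ : 0 < Λ)
    (h0 : ∀ t, r ≤ |t| → φ t = 0) (t : ℝ) :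
    Integrable fun s => (expKernel r Λ t s : ℂ) * modulatedDeriv Λ φ κ s := by
  refine (integrable_modulatedDeriv hφ h0).bdd_mul (c := Λ) ?_ (Filter.Eventually.of_forall fun s => ?_)
  · exact (Complex.measurable_ofReal.comp
      (measurable_expKernel.comp measurable_prodMk_left)).aestronglyMeasurable
  · rw [Complex.norm_real]; exact abs_expKernel_le hΛ t s

end Profile

/-! ### Trace norm of a product of Hilbert–Schmidt operators -/

section Schatten

variable {X C : Type*} [MeasureSpace X] [Fintype C] {M : ℕ} {H G : Fin M → C → X → ℝ} {g : Fin M → ℝ}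

/-- Bessel's inequality for orthogonal, not normalized functions on `X × C`. -/
theorem sum_sq_integral_mul_le
    (hHH : ∀ m m' c, Integrable fun x => H m c x * H m' c x)
    (ho : ∀ m m', ∑ c, ∫ x, H m c x * H m' c x = if m = m' then g m else 0)
    {f : X → ℝ} (hf : Integrable fun x => f x ^ 2) (c : C)
    (hfH : ∀ m, Integrable fun x => f x * H m c x) :
    ∑ m, ((Real.sqrt (g m))⁻¹ * ∫ x, f x * H m c x) ^ 2 ≤ ∫ x, f x ^ 2 := by
  set β : Fin M → ℝ := fun m => (Real.sqrt (g m))⁻¹ * ∫ x, f x * H m c x with hβ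
  set a : Fin M → ℝ := fun m => β m * (Real.sqrt (g m))⁻¹ with ha
  have hg : ∀ m, 0 ≤ g m := by
    intro m
    have := ho m m
    rw [if_pos rfl] at this
    rw [← this]
    exact Finset.sum_nonneg fun c _ => integral_nonneg fun x => mul_self_nonneg _
  have hP : ∀ c', Integrable fun x => ∑ m, ∑ m', (a m * a m') * (H m c' x * H m' c' x) := fun c' =>
    integrable_finsetSum _ fun m _ => integrable_finsetSum _ fun m' _ => (hHH m m' c').const_mul _
  have hPe : ∀ c' x, (∑ m, a m * H m c' x) ^ 2 = ∑ m, ∑ m', (a m * a m') * (H m c' x * H m' c' x) := by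
    intro c' x
    rw [sq, Finset.sum_mul_sum]
    exact Finset.sum_congr rfl fun m _ => Finset.sum_congr rfl fun m' _ => by ring
  have h1 : ∑ c', ∫ x, (∑ m, a m * H m c' x) ^ 2 = ∑ m, a m ^ 2 * g m := by
    simp only [hPe]
    have e1 : ∀ c', ∫ x, ∑ m, ∑ m', (a m * a m') * (H m c' x * H m' c' x) =
        ∑ m, ∑ m', (a m * a m') * ∫ x, H m c' x * H m' c' x := by
      intro c'
      rw [integral_finsetSum _ fun m _ => integrable_finsetSum _ fun m' _ => (hHH m m' c').const_mul _]
      refine Finset.sum_congr rfl fun m _ => ?_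
      rw [integral_finsetSum _ fun m' _ => (hHH m m' c').const_mul _]
      simp only [integral_const_mul]
    simp only [e1]
    rw [Finset.sum_comm]
    refine Finset.sum_congr rfl fun m _ => ?_
    rw [Finset.sum_comm]
    simp only [← Finset.mul_sum, ho]
    simp only [mul_ite, mul_zero, Finset.sum_ite_eq, Finset.mem_univ, if_true]
    ring
  have h2 : ∫ x, (∑ m, a m * H m c x) ^ 2 ≤ ∑ m, a m ^ 2 * g m := by
    rw [← h1]
    exact Finset.single_le_sum (f := fun c' => ∫ x, (∑ m, a m * H m c' x) ^ 2)
      (fun c' _ => integral_nonneg fun x => sq_nonneg _) (Finset.mem_univ c)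
  -- Null directions are harmless: for `g m = 0` the convention `0⁻¹ = 0` makes both sides vanish.
  have h3 : ∀ m, a m ^ 2 * g m ≤ β m ^ 2 := by
    intro m
    have e : a m ^ 2 * g m = β m ^ 2 * ((g m)⁻¹ * g m) := by
      simp only [ha, mul_pow, inv_pow, Real.sq_sqrt (hg m)]; ring
    rw [e]
    refine mul_le_of_le_one_right (sq_nonneg _) ?_
    exact inv_mul_le_one
  have i2 : Integrable fun x => ∑ m, a m * (f x * H m c x) :=
    integrable_finsetSum _ fun m _ => (hfH m).const_mul _
  have h4 : ∫ x, (f x - ∑ m, a m * H m c x) ^ 2 =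
      (∫ x, f x ^ 2) - 2 * (∑ m, β m ^ 2) + ∫ x, (∑ m, a m * H m c x) ^ 2 := by
    have e1 : ∀ x, (f x - ∑ m, a m * H m c x) ^ 2 =
        (f x ^ 2 - 2 * ∑ m, a m * (f x * H m c x)) + (∑ m, a m * H m c x) ^ 2 := by
      intro x
      have : ∑ m, a m * (f x * H m c x) = f x * ∑ m, a m * H m c x := by
        rw [Finset.mul_sum]; exact Finset.sum_congr rfl fun m _ => by ring
      rw [this]; ring
    have i3 : Integrable fun x => (∑ m, a m * H m c x) ^ 2 := by simpa only [hPe] using hP c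
    simp only [e1]
    rw [integral_add (f := fun x => f x ^ 2 - 2 * ∑ m, a m * (f x * H m c x))
      (hf.sub (i2.const_mul 2)) i3, integral_sub hf (i2.const_mul 2), integral_const_mul,
      integral_finsetSum _ fun m _ => (hfH m).const_mul _]
    simp only [integral_const_mul]
    have e2 : ∀ m, a m * ∫ x, f x * H m c x = β m ^ 2 := fun m => by simp only [ha, hβ]; ring
    simp only [e2]
  have h5 : 0 ≤ ∫ x, (f x - ∑ m, a m * H m c x) ^ 2 := integral_nonneg fun x => sq_nonneg _
  have h6 : ∑ m, a m ^ 2 * g m ≤ ∑ m, β m ^ 2 := Finset.sum_le_sum fun m _ => h3 m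
  linarith

/-- The sum of the singular values of a product of two Hilbert–Schmidt operators, one of which is
given by the integral kernel `k`. -/
theorem sum_sqrt_le_of_integral_kernel [SFinite (volume : Measure X)]
    (hH : ∀ m c, Integrable (H m c))
    (hHH : ∀ m m' c, Integrable fun x => H m c x * H m' c x)
    (ho : ∀ m m', ∑ c, ∫ x, H m c x * H m' c x = if m = m' then g m else 0)
    {k : X → X → ℝ} (hk : Measurable (Function.uncurry k)) {K : ℝ} (hkK : ∀ x y, |k x y| ≤ K)
    {B : X → ℝ} (hB : Integrable B) (hk2 : ∀ y, Integrable fun x => k x y ^ 2)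
    (hkB : ∀ y, ∫ x, k x y ^ 2 ≤ B y)
    (hG : ∀ m c, Integrable (G m c)) (hGH : ∀ m c x, H m c x = ∫ y, k x y * G m c y)
    {D : C → X → ℝ} (hD : ∀ c, Integrable (D c)) (hGD : ∀ c y, ∑ m, G m c y ^ 2 ≤ D c y)
    {θ : ℝ} (hθ : 0 < θ) :
    ∑ m, Real.sqrt (g m) ≤ ∑ c, ((2 * θ)⁻¹ * (∫ y, D c y) + θ / 2 * ∫ y, B y) := by
  have hI : ∀ m c, Integrable (fun p : X × X => H m c p.1 * k p.1 p.2 * G m c p.2)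
      (volume.prod volume) := by
    intro m c
    have h1 := ((hH m c).mul_prod (hG m c)).bdd_mul (f := Function.uncurry k)
      hk.aestronglyMeasurable (c := K) (Filter.Eventually.of_forall fun p => hkK p.1 p.2)
    refine h1.congr (Filter.Eventually.of_forall fun p => ?_)
    simp only [Function.uncurry]
    ring
  have h1 : ∀ m, Real.sqrt (g m) = ∑ c, ∫ y, ((Real.sqrt (g m))⁻¹ * ∫ x, k x y * H m c x) * G m c y := by
    intro m
    have e1 : Real.sqrt (g m) = (Real.sqrt (g m))⁻¹ * g m := by
      by_cases h : 0 < g m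
      · have := Real.sqrt_pos.2 h
        nth_rewrite 3 [← Real.sq_sqrt h.le]
        field_simp
      · rw [Real.sqrt_eq_zero_of_nonpos (not_lt.1 h)]; simp
    have e2 := ho m m
    rw [if_pos rfl] at e2
    refine e1.trans ?_
    nth_rewrite 2 [← e2]
    rw [Finset.mul_sum]
    refine Finset.sum_congr rfl fun c _ => ?_
    have e3 : ∀ x, H m c x * H m c x = ∫ y, H m c x * k x y * G m c y := by
      intro x
      nth_rewrite 2 [hGH m c x]
      rw [← integral_const_mul]
      simp only [mul_assoc]
    simp only [e3]
    -- One factor of `⟨H_m, H_m⟩` is written as the kernel applied to `G_m`; after Fubini the kernel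
    -- acts, transposed, on the other factor, which is normalized by `√g_m`.
    rw [integral_integral_swap (hI m c), ← integral_const_mul]
    refine integral_congr_ae (Filter.Eventually.of_forall fun y => ?_)
    beta_reduce
    rw [mul_assoc, ← integral_mul_const]
    congr 1
    exact integral_congr_ae (Filter.Eventually.of_forall fun x => by ring)
  rw [Finset.sum_congr rfl fun m _ => h1 m, Finset.sum_comm]
  refine Finset.sum_le_sum fun c _ => ?_
  have hI2 : ∀ m, Integrable fun y => ((Real.sqrt (g m))⁻¹ * ∫ x, k x y * H m c x) * G m c y := by
    intro m
    refine ((hI m c).integral_prod_right.const_mul (Real.sqrt (g m))⁻¹).congr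
      (Filter.Eventually.of_forall fun y => ?_)
    beta_reduce
    rw [mul_assoc, ← integral_mul_const]
    congr 1
    exact integral_congr_ae (Filter.Eventually.of_forall fun x => by ring)
  rw [← integral_finsetSum _ fun m _ => hI2 m, ← integral_const_mul, ← integral_const_mul,
    ← integral_add ((hD c).const_mul _) (hB.const_mul _)]
  refine integral_mono (integrable_finsetSum _ fun m _ => hI2 m)
    (((hD c).const_mul _).add (hB.const_mul _)) fun y => ?_
  have hkH : ∀ m, Integrable fun x => k x y * H m c x := fun m =>
    (hH m c).bdd_mul (hk.comp measurable_prodMk_right).aestronglyMeasurable (c := K)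
      (Filter.Eventually.of_forall fun x => hkK x y)
  -- Bessel for `x ↦ k x y` at fixed `y`, so that the sum over `m` is controlled by the kernel
  -- alone, whatever the number of modes.
  have h2 := (sum_sq_integral_mul_le hHH ho (hk2 y) c hkH).trans (hkB y)
  have h3 := hGD c y
  have h4 : ∀ m, ((Real.sqrt (g m))⁻¹ * ∫ x, k x y * H m c x) * G m c y ≤
      (2 * θ)⁻¹ * G m c y ^ 2 + θ / 2 * ((Real.sqrt (g m))⁻¹ * ∫ x, k x y * H m c x) ^ 2 := by
    intro m
    set u := (Real.sqrt (g m))⁻¹ * ∫ x, k x y * H m c x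
    have : (2 * θ)⁻¹ * G m c y ^ 2 + θ / 2 * u ^ 2 - u * G m c y =
        (2 * θ)⁻¹ * (G m c y - θ * u) ^ 2 := by field_simp; ring
    have h5 : 0 ≤ (2 * θ)⁻¹ * (G m c y - θ * u) ^ 2 := by positivity
    linarith
  refine (Finset.sum_le_sum fun m _ => h4 m).trans ?_
  rw [Finset.sum_add_distrib, ← Finset.mul_sum, ← Finset.mul_sum]
  have : 0 < (2 * θ)⁻¹ := by positivity
  gcongr

end Schatten

/-- Bessel's inequality in finite dimensions. -/
theorem sum_norm_sum_mul_sq_le {ι : Type*} [Fintype ι] {M : ℕ} {b : Fin M → ι → ℂ}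
    (hb : ∀ m m', ∑ i, (starRingEnd ℂ) (b m i) * b m' i = if m = m' then 1 else 0) (w : ι → ℂ) :
    ∑ m, ‖∑ i, b m i * w i‖ ^ 2 ≤ ∑ i, ‖w i‖ ^ 2 := by
  set v : Fin M → EuclideanSpace ℂ ι := fun m => WithLp.toLp 2 fun i => (starRingEnd ℂ) (b m i)
  have hv : Orthonormal ℂ v := by
    rw [orthonormal_iff_ite]
    intro m m'
    rw [PiLp.inner_apply]
    have h := hb m' m
    simp only [eq_comm (a := m')] at h
    rw [← h]
    refine Finset.sum_congr rfl fun i _ => ?_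
    rw [RCLike.inner_apply']
    simp [v, mul_comm]
  have h := hv.sum_inner_products_le (WithLp.toLp 2 w) (s := Finset.univ)
  rw [EuclideanSpace.norm_sq_eq] at h
  refine le_trans (le_of_eq ?_) h
  refine Finset.sum_congr rfl fun m _ => ?_
  congr 2
  rw [PiLp.inner_apply]
  refine Finset.sum_congr rfl fun i _ => ?_
  rw [RCLike.inner_apply']
  simp [v]

/-! ### Trace bound for the field seen by a localized particle -/

section SpaceProd

variable {𝕜 : Type*} [RCLike 𝕜]

theorem integral_space_prod (f : Fin 3 → ℝ → 𝕜) :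
    ∫ x : Space, ∏ d, f d (x d) = ∏ d, ∫ t, f d t := by
  rw [← integral_fintype_prod_volume_eq_prod,
    ← (PiLp.volume_preserving_toLp (Fin 3)).integral_comp (MeasurableEquiv.toLp 2 _).measurableEmbedding]

theorem integrable_space_prod {f : Fin 3 → ℝ → 𝕜} (hf : ∀ d, Integrable (f d)) :
    Integrable fun x : Space => ∏ d, f d (x d) := by
  rw [← (PiLp.volume_preserving_toLp (Fin 3)).integrable_comp_emb
    (MeasurableEquiv.toLp 2 _).measurableEmbedding]
  exact Integrable.fintype_prod hf

end SpaceProd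

/-- The product function `∏_d φ(x_d)` on `ℝ³`. -/
def boxFn (φ : ℝ → ℝ) (x : Space) : ℝ := ∏ d, φ (x d)

theorem contDiff_boxFn {φ : ℝ → ℝ} (hφ : ContDiff ℝ (⊤ : ℕ∞) φ) : ContDiff ℝ (⊤ : ℕ∞) (boxFn φ) :=
  contDiff_prod fun d _ => hφ.comp (EuclideanSpace.proj (𝕜 := ℝ) d).contDiff

theorem hasCompactSupport_boxFn {φ : ℝ → ℝ} {r : ℝ} (h0 : ∀ t, r ≤ |t| → φ t = 0) :
    HasCompactSupport (boxFn φ) := by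
  refine HasCompactSupport.intro (K := WithLp.toLp 2 '' (Set.Icc (fun _ : Fin 3 => -r) fun _ => r))
    (isCompact_Icc.image (PiLp.continuous_toLp 2 _)) fun x hx => ?_
  by_contra hne
  refine hx ⟨x.ofLp, ?_, rfl⟩
  have h : ∀ d, |x d| ≤ r := by
    intro d
    by_contra hd
    exact hne (Finset.prod_eq_zero (Finset.mem_univ d) (h0 _ (not_le.1 hd).le))
  exact ⟨fun d => (abs_le.1 (h d)).1, fun d => (abs_le.1 (h d)).2⟩

/-- The coefficient `(2V)^{-1/2} ε_c |k|^{-1/2}` of the mode `i` in the vector potential. -/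
def couplingCoeff (ε : (Fin 3 → ℤ) → Fin 2 → Space) (c : Fin 3) (i : Mode L Λ) : ℝ :=
  1 / Real.sqrt (2 * L ^ 3) * (ε i.1.1 i.2 c / Real.sqrt ‖i.k‖)

theorem IsPolarization.sum_couplingCoeff_sq {ε : (Fin 3 → ℤ) → Fin 2 → Space}
    (hε : IsPolarization L Λ ε) (hL : 0 < L) (i : Mode L Λ) :
    ∑ c, couplingCoeff ε c i ^ 2 = 1 / (2 * L ^ 3 * ‖i.k‖) := by
  have h := hε.sum_sq i
  have hk := Mode.k_norm_pos hL i
  have h1 : ∀ c, couplingCoeff ε c i ^ 2 = 1 / (2 * L ^ 3 * ‖i.k‖) * ε i.1.1 i.2 c ^ 2 := by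
    intro c
    rw [couplingCoeff, mul_pow, inv_sqrt_sq hL, div_pow, Real.sq_sqrt hk.le]
    field_simp
  simp only [h1, ← Finset.mul_sum, h, mul_one]

/-- The field coordinate obtained from `φ ρ_m` by applying `1 + Λ⁻¹ ∂` in each direction. -/
def liftedCoord (ε : (Fin 3 → ℤ) → Fin 2 → Space) (b : Fin M → Mode L Λ → ℂ) (φ : ℝ → ℝ)
    (m : Fin M) (c : Fin 3) (y : Space) : ℝ :=
  (∑ i, b m i * ((couplingCoeff ε c i : ℂ) * ∏ d, modulatedDeriv Λ φ (i.k d) (y d))).re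

section Trace

variable {ε : (Fin 3 → ℤ) → Fin 2 → Space} {b : Fin M → Mode L Λ → ℂ}
  {ρ : Fin M → Space × Fin 3 → ℝ} {φ : ℝ → ℝ} {r : ℝ}

/-- As `ρ_m` is real, it may be conjugated, which expresses it through `e^{+ik·x}`. The plane wave
and the box function then factor into one-dimensional modulated profiles. -/
theorem boxFn_mul_coord
    (hb : ∀ m m', ∑ i, (starRingEnd ℂ) (b m i) * b m' i = if m = m' then 1 else 0)
    (hf : ∀ x i, photonState ε x i = ∑ m, (ρ m x : ℂ) * b m i) (m : Fin M) (c : Fin 3) (x : Space) :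
    boxFn φ x * ρ m (x, c) =
      (∑ i, b m i * ((couplingCoeff ε c i : ℂ) * ∏ d, modulated φ (i.k d) (x d))).re := by
  have h1 : (ρ m (x, c) : ℂ) = ∑ i, b m i * (starRingEnd ℂ) (photonState ε (x, c) i) := by
    have h := congrArg (starRingEnd ℂ) (coord_eq hb hf m (x, c))
    rw [Complex.conj_ofReal, map_sum] at h
    rw [h]
    exact Finset.sum_congr rfl fun i _ => by rw [map_mul, Complex.conj_conj]
  have h2 : ∀ i : Mode L Λ, (boxFn φ x : ℂ) * (starRingEnd ℂ) (photonState ε (x, c) i) =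
      (couplingCoeff ε c i : ℂ) * ∏ d, modulated φ (i.k d) (x d) := by
    intro i
    have e1 : (starRingEnd ℂ) (photonState ε (x, c) i) = (couplingCoeff ε c i : ℂ) *
        Complex.exp (Complex.I * (inner ℝ i.k x : ℝ)) := by
      simp only [photonState, couplingCoeff, map_mul, Complex.conj_ofReal, ← Complex.exp_conj]
      simp
    have e2 : (inner ℝ i.k x : ℝ) = ∑ d, i.k d * x d := by
      rw [PiLp.inner_apply]
      exact Finset.sum_congr rfl fun d _ => by simp [mul_comm]
    simp only [e1, modulated, Finset.prod_mul_distrib, ← Complex.exp_sum, ← Finset.mul_sum, e2, boxFn]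
    push_cast
    ring
  have h3 : ((boxFn φ x * ρ m (x, c) : ℝ) : ℂ) =
      ∑ i, b m i * ((couplingCoeff ε c i : ℂ) * ∏ d, modulated φ (i.k d) (x d)) := by
    rw [Complex.ofReal_mul, h1, Finset.mul_sum]
    refine Finset.sum_congr rfl fun i _ => ?_
    rw [← h2]; ring
  rw [← h3, Complex.ofReal_re]

theorem integrable_liftedCoord (hφ : ContDiff ℝ (⊤ : ℕ∞) φ) (h0 : ∀ t, r ≤ |t| → φ t = 0)
    (m : Fin M) (c : Fin 3) : Integrable (liftedCoord ε b φ m c) := by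
  have h : Integrable fun y : Space =>
      ∑ i, b m i * ((couplingCoeff ε c i : ℂ) * ∏ d, modulatedDeriv Λ φ (i.k d) (y d)) :=
    integrable_finsetSum _ fun i _ => ((integrable_space_prod fun d =>
      integrable_modulatedDeriv hφ h0).const_mul _).const_mul _
  exact h.re

theorem integral_expKernel_mul_liftedCoord
    (hb : ∀ m m', ∑ i, (starRingEnd ℂ) (b m i) * b m' i = if m = m' then 1 else 0)
    (hf : ∀ x i, photonState ε x i = ∑ m, (ρ m x : ℂ) * b m i)
    (hφ : ContDiff ℝ (⊤ : ℕ∞) φ) (h0 : ∀ t, r ≤ |t| → φ t = 0) (hΛ : 0 < Λ)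
    (m : Fin M) (c : Fin 3) (x : Space) :
    boxFn φ x * ρ m (x, c) =
      ∫ y : Space, (∏ d, expKernel r Λ (x d) (y d)) * liftedCoord ε b φ m c y := by
  have h1 : ∀ y : Space, (∏ d, expKernel r Λ (x d) (y d)) * liftedCoord ε b φ m c y =
      RCLike.re (∑ i, b m i * ((couplingCoeff ε c i : ℂ) *
        ∏ d, ((expKernel r Λ (x d) (y d) : ℂ) * modulatedDeriv Λ φ (i.k d) (y d)))) := by
    intro y
    rw [liftedCoord, ← Complex.re_ofReal_mul]
    change Complex.re _ = Complex.re _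
    congr 1
    rw [Finset.mul_sum]
    refine Finset.sum_congr rfl fun i _ => ?_
    rw [Finset.prod_mul_distrib]
    push_cast
    ring
  have hi : ∀ i : Mode L Λ, Integrable fun y : Space => ∏ d,
      ((expKernel r Λ (x d) (y d) : ℂ) * modulatedDeriv Λ φ (i.k d) (y d)) := fun i =>
    integrable_space_prod (f := fun d s => (expKernel r Λ (x d) s : ℂ) * modulatedDeriv Λ φ (i.k d) s)
      fun d => integrable_expKernel_mul hφ hΛ h0 (x d)
  simp only [h1]
  rw [integral_re (integrable_finsetSum _ fun i _ => ((hi i).const_mul _).const_mul _),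
    integral_finsetSum _ fun i _ => ((hi i).const_mul _).const_mul _, boxFn_mul_coord hb hf]
  change Complex.re _ = Complex.re _
  congr 1
  refine Finset.sum_congr rfl fun i _ => ?_
  rw [integral_const_mul, integral_const_mul, integral_space_prod
    (fun d s => (expKernel r Λ (x d) s : ℂ) * modulatedDeriv Λ φ (i.k d) s)]
  simp only [integral_expKernel_mul hφ hΛ.ne' h0]

/-- Bessel in the finite-dimensional mode space: the orthonormal family `b` disappears, leaving a
sum over plane-wave modes that is explicitly computable. -/
theorem sum_liftedCoord_sq_le
    (hb : ∀ m m', ∑ i, (starRingEnd ℂ) (b m i) * b m' i = if m = m' then 1 else 0)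
    (c : Fin 3) (y : Space) :
    ∑ m, liftedCoord ε b φ m c y ^ 2 ≤
      ∑ i : Mode L Λ, couplingCoeff ε c i ^ 2 * ∏ d, ‖modulatedDeriv Λ φ (i.k d) (y d)‖ ^ 2 := by
  refine le_trans (Finset.sum_le_sum fun m _ => ?_) ((sum_norm_sum_mul_sq_le hb fun i =>
    (couplingCoeff ε c i : ℂ) * ∏ d, modulatedDeriv Λ φ (i.k d) (y d)).trans (le_of_eq ?_))
  · rw [← sq_abs]
    exact pow_le_pow_left₀ (abs_nonneg _) (Complex.abs_re_le_norm _) 2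
  · refine Finset.sum_congr rfl fun i _ => ?_
    rw [norm_mul, mul_pow, Complex.norm_real, Real.norm_eq_abs, sq_abs, norm_prod, Finset.prod_pow]

theorem Mode.abs_k_apply_le (hL : 0 < L) (i : Mode L Λ) (d : Fin 3) : |i.k d| ≤ Λ := by
  rw [← Real.norm_eq_abs]
  exact (PiLp.norm_apply_le i.k d).trans (Mode.k_norm_lt hL i).le

/-- A bound on the trace of the square root of the quadratic form of the vector potential, averaged
over a particle localized in a box of side `2r`. -/
theorem sum_sqrt_le (hL : 0 < L) (hΛL : 2 * Real.pi / L < Λ) (hε : IsPolarization L Λ ε)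
    {η : ℝ → ℝ} (hη : ContDiff ℝ (⊤ : ℕ∞) η) (h0 : ∀ t, 1 ≤ |t| → η t = 0) (h1 : ∫ t, η t ^ 2 = 1)
    (hr : 0 < r) (hrΛ : 1 ≤ r * Λ)
    (hb : ∀ m m', ∑ i, (starRingEnd ℂ) (b m i) * b m' i = if m = m' then 1 else 0)
    (hf : ∀ x i, photonState ε x i = ∑ m, (ρ m x : ℂ) * b m i) {g : Fin M → ℝ}
    (hg : ∀ m m', ∑ c, ∫ x, boxFn (dilate r η) x ^ 2 * (ρ m (x, c) * ρ m' (x, c)) =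
      if m = m' then g m else 0) {θ : ℝ} (hθ : 0 < θ) :
    ∑ m, Real.sqrt (g m) ≤
      (2 * θ)⁻¹ * ((3 + 2 * ∫ t, deriv η t ^ 2) ^ 3 * Λ ^ 2) + 3 / 2 * θ * (r * Λ) ^ 3 := by
  have hΛ : 0 < Λ := lt_trans (by positivity) hΛL
  set φ := dilate r η with hφ
  have hφs : ContDiff ℝ (⊤ : ℕ∞) φ := contDiff_dilate hη
  have hφ0 : ∀ t, r ≤ |t| → φ t = 0 := fun t ht => dilate_eq_zero hr h0 ht
  have hHc : ∀ m c, Continuous fun x : Space => boxFn φ x * ρ m (x, c) := fun m c =>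
    (contDiff_boxFn hφs).continuous.mul (contDiff_coord hb hf m c).continuous
  have hHs : ∀ m c, HasCompactSupport fun x : Space => boxFn φ x * ρ m (x, c) := fun m c =>
    (hasCompactSupport_boxFn hφ0).mul_right
  set B : Space → ℝ := fun y => ∏ d, (Set.Icc (-r) r).indicator (fun _ => Λ / 2) (y d) with hB
  set D : Fin 3 → Space → ℝ := fun c y =>
    ∑ i : Mode L Λ, couplingCoeff ε c i ^ 2 * ∏ d, ‖modulatedDeriv Λ φ (i.k d) (y d)‖ ^ 2 with hD
  have hind : Integrable ((Set.Icc (-r) r).indicator fun _ => Λ / 2) :=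
    (integrable_indicator_iff measurableSet_Icc).2 continuous_const.integrableOn_Icc
  have hDi : ∀ i : Mode L Λ, Integrable fun y : Space =>
      ∏ d, ‖modulatedDeriv Λ φ (i.k d) (y d)‖ ^ 2 := fun i =>
    integrable_space_prod (f := fun d t => ‖modulatedDeriv Λ φ (i.k d) t‖ ^ 2) fun d =>
      integrable_norm_modulatedDeriv_sq hφs hφ0
  have h := sum_sqrt_le_of_integral_kernel (X := Space) (C := Fin 3)
    (H := fun m c x => boxFn φ x * ρ m (x, c)) (G := liftedCoord ε b φ) (g := g)
    (fun m c => (hHc m c).integrable_of_hasCompactSupport (hHs m c))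
    (fun m m' c => ((hHc m c).mul (hHc m' c)).integrable_of_hasCompactSupport (hHs m c).mul_right)
    (fun m m' => by
      rw [← hg]
      exact Finset.sum_congr rfl fun c _ => integral_congr_ae
        (Filter.Eventually.of_forall fun x => by beta_reduce; ring))
    (k := fun x y => ∏ d, expKernel r Λ (x d) (y d)) (K := Λ ^ 3) ?_ ?_ (B := B)
    (integrable_space_prod fun d => hind) (fun y => ?_) (fun y => ?_)
    (fun m c => integrable_liftedCoord hφs hφ0 m c)
    (fun m c x => integral_expKernel_mul_liftedCoord hb hf hφs hφ0 hΛ m c x) (D := D)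
    (fun c => integrable_finsetSum _ fun i _ => (hDi i).const_mul _)
    (fun c y => sum_liftedCoord_sq_le hb c y) hθ
  · refine h.trans ?_
    -- The squared Hilbert–Schmidt norm of the kernel is at most this phase-space volume of the box;
    -- it is counted once for each of the three components of `A`, whence the factor `3/2`.
    have e1 : ∫ y, B y = (r * Λ) ^ 3 := by
      rw [hB, integral_space_prod (fun _ => (Set.Icc (-r) r).indicator fun _ => Λ / 2)]
      rw [Finset.prod_const, integral_indicator measurableSet_Icc, setIntegral_const]
      simp [Measure.real, Real.volume_Icc]
      rw [ENNReal.toReal_ofReal (by linarith)]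
      ring
    -- The other Hilbert–Schmidt factor: each mode costs a constant, and the squared couplings sum
    -- to at most `Λ²` uniformly in `L`.
    have e2 : ∑ c, ∫ y, D c y ≤ (3 + 2 * ∫ t, deriv η t ^ 2) ^ 3 * Λ ^ 2 := by
      have e3 : ∀ c, ∫ y, D c y = ∑ i : Mode L Λ, couplingCoeff ε c i ^ 2 *
          ∏ d, ∫ t, ‖modulatedDeriv Λ φ (i.k d) t‖ ^ 2 := by
        intro c
        rw [hD]
        beta_reduce
        rw [integral_finsetSum _ fun i _ => (hDi i).const_mul _]
        refine Finset.sum_congr rfl fun i _ => ?_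
        rw [integral_const_mul, integral_space_prod (fun d t => ‖modulatedDeriv Λ φ (i.k d) t‖ ^ 2)]
      simp only [e3]
      rw [Finset.sum_comm]
      simp only [← Finset.sum_mul, hε.sum_couplingCoeff_sq hL]
      have e4 : ∀ i : Mode L Λ, ∏ d, ∫ t, ‖modulatedDeriv Λ φ (i.k d) t‖ ^ 2 ≤
          (3 + 2 * ∫ t, deriv η t ^ 2) ^ 3 := by
        intro i
        refine (Finset.prod_le_prod (fun d _ => integral_nonneg fun t => sq_nonneg _) fun d _ =>
          integral_norm_modulatedDeriv_sq_le hr hη h0 h1 hrΛ (Mode.abs_k_apply_le hL i d)).trans ?_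
        rw [Finset.prod_const]
        simp
      have e5 : 0 ≤ ∫ t, deriv η t ^ 2 := integral_nonneg fun t => sq_nonneg _
      calc _ ≤ ∑ i : Mode L Λ, 1 / (2 * L ^ 3 * ‖i.k‖) * (3 + 2 * ∫ t, deriv η t ^ 2) ^ 3 :=
            Finset.sum_le_sum fun i _ => mul_le_mul_of_nonneg_left (e4 i) (by positivity)
        _ ≤ _ := by
            rw [← Finset.sum_mul, mul_comm]
            exact mul_le_mul_of_nonneg_left (sum_inv_norm_k_le hL hΛL) (by positivity)
    rw [Finset.sum_add_distrib, ← Finset.mul_sum, e1]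
    have e6 : (0 : ℝ) < (2 * θ)⁻¹ := by positivity
    have e7 := mul_le_mul_of_nonneg_left e2 e6.le
    simp only [Finset.sum_const, Finset.card_univ, Fintype.card_fin, nsmul_eq_mul]
    push_cast
    linarith
  · have hm : ∀ d : Fin 3, Measurable fun p : Space × Space => expKernel r Λ (p.1 d) (p.2 d) := by
      intro d
      exact measurable_expKernel.comp (f := fun p : Space × Space => (p.1 d, p.2 d)) (by fun_prop)
    exact Finset.measurable_prod _ fun d _ => hm d
  · intro x y
    rw [Finset.abs_prod]
    refine (Finset.prod_le_prod (fun d _ => abs_nonneg _) fun d _ => abs_expKernel_le hΛ _ _).trans ?_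
    simp
  · simp only [← Finset.prod_pow]
    exact integrable_space_prod (f := fun d t => expKernel r Λ t (y d) ^ 2) fun d =>
      integrable_expKernel_sq (y d)
  · simp only [← Finset.prod_pow]
    rw [integral_space_prod (fun d t => expKernel r Λ t (y d) ^ 2)]
    exact Finset.prod_le_prod (fun d _ => integral_nonneg fun t => sq_nonneg _) fun d _ =>
      integral_expKernel_sq_le hΛ (y d)

end Trace

/-! ### Choice of the trial state and the upper bound -/

theorem exists_profile : ∃ η : ℝ → ℝ, ContDiff ℝ (⊤ : ℕ∞) η ∧ (∀ t, 1 ≤ |t| → η t = 0) ∧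
    ∫ t, η t ^ 2 = 1 := by
  set f : ContDiffBump (0 : ℝ) := ⟨1 / 2, 1, by norm_num, by norm_num⟩ with hf
  have hc : Continuous fun t => f t ^ 2 := f.continuous.pow 2
  have hpos : 0 < ∫ t, f t ^ 2 := by
    refine hc.integral_pos_of_hasCompactSupport_nonneg_nonzero ?_ (fun t => sq_nonneg _) (x := 0) ?_
    · exact f.hasCompactSupport.comp_left (g := fun t : ℝ => t ^ 2) (by simp)
    · rw [f.one_of_mem_closedBall (Metric.mem_closedBall_self f.rIn_pos.le)]; simp
  refine ⟨fun t => (Real.sqrt (∫ t, f t ^ 2))⁻¹ * f t, contDiff_const.mul f.contDiff, fun t ht => ?_, ?_⟩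
  · beta_reduce
    rw [f.zero_of_le_dist, mul_zero]
    simpa [hf] using ht
  · simp only [mul_pow, inv_pow, Real.sq_sqrt hpos.le]
    rw [integral_const_mul, inv_mul_cancel₀ hpos.ne']

theorem integral_boxFn_sq {φ : ℝ → ℝ} (h1 : ∫ t, φ t ^ 2 = 1) : ∫ x, boxFn φ x ^ 2 = 1 := by
  simp only [boxFn, ← Finset.prod_pow]
  rw [integral_space_prod (fun _ t => φ t ^ 2)]
  simp [h1]

theorem fderiv_boxFn_sq {φ : ℝ → ℝ} (hφ : ContDiff ℝ (⊤ : ℕ∞) φ) (c : Fin 3) (x : Space) :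
    fderiv ℝ (boxFn φ) x (EuclideanSpace.single c 1) ^ 2 =
      ∏ d, (if d = c then fun t => deriv φ t ^ 2 else fun t => φ t ^ 2) (x d) := by
  have h := HasFDerivAt.finsetProd (u := Finset.univ) (x := x) (g := fun (d : Fin 3) (x : Space) => φ (x d))
    (g' := fun d => deriv φ (x d) • (EuclideanSpace.proj d : Space →L[ℝ] ℝ)) fun d _ =>
      ((hφ.differentiable (by simp) (x d)).hasDerivAt).comp_hasFDerivAt x
        (EuclideanSpace.proj (𝕜 := ℝ) d).hasFDerivAt
  have h2 : HasFDerivAt (boxFn φ) _ x := h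
  rw [h2.fderiv]
  have h3 : (∑ d, (∏ j ∈ Finset.univ.erase d, φ (x j)) • deriv φ (x d) •
      (EuclideanSpace.proj d : Space →L[ℝ] ℝ)) (EuclideanSpace.single c 1) =
      deriv φ (x c) * ∏ j ∈ Finset.univ.erase c, φ (x j) := by
    rw [_root_.sum_apply, Finset.sum_eq_single c]
    · simp [mul_comm]
    · intro d _ hd
      simp [hd]
    · simp
  rw [h3, ← Finset.mul_prod_erase Finset.univ _ (Finset.mem_univ c), if_pos rfl, mul_pow,
    ← Finset.prod_pow]
  congr 1
  exact Finset.prod_congr rfl fun d hd => by rw [if_neg (Finset.ne_of_mem_erase hd)]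

theorem sum_integral_fderiv_boxFn_sq {φ : ℝ → ℝ} (hφ : ContDiff ℝ (⊤ : ℕ∞) φ)
    (h1 : ∫ t, φ t ^ 2 = 1) :
    ∑ c, ∫ x, fderiv ℝ (boxFn φ) x (EuclideanSpace.single c 1) ^ 2 = 3 * ∫ t, deriv φ t ^ 2 := by
  have h : ∀ c : Fin 3, ∫ x, fderiv ℝ (boxFn φ) x (EuclideanSpace.single c 1) ^ 2 =
      ∫ t, deriv φ t ^ 2 := by
    intro c
    simp only [fderiv_boxFn_sq hφ]
    rw [integral_space_prod fun d => if d = c then fun t => deriv φ t ^ 2 else fun t => φ t ^ 2,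
      Finset.prod_eq_single c]
    · simp
    · intro d _ hd
      simp [hd, h1]
    · simp
  simp [h]

theorem energy_nonneg (α : ℝ) (ε : (Fin 3 → ℤ) → Fin 2 → Space) (Ψ : SmoothVec L Λ N) :
    0 ≤ energy α ε Ψ := by
  unfold energy
  positivity

theorem bosonEnergy_le_of_energy_le {α E : ℝ} {ε : (Fin 3 → ℤ) → Fin 2 → Space}
    (Ψ : SmoothVec L Λ N) (hΨ : IsBosonic Ψ.val) (h1 : 0 < ‖Ψ‖ ^ 2)
    (hE : energy α ε Ψ ≤ E * ‖Ψ‖ ^ 2) : bosonEnergy L Λ α ε N ≤ E := by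
  have hbdd : BddBelow {E : ℝ | ∃ Ψ : WaveFn L Λ N, IsBosonic Ψ ∧ Ψ ≠ 0 ∧
      E = (innerProd Ψ (hamiltonian α ε Ψ)).re / (innerProd Ψ Ψ).re} := by
    refine ⟨0, ?_⟩
    rintro _ ⟨Φ, hΦ, -, rfl⟩
    set Φ' : SmoothVec L Λ N := ⟨Φ, hΦ.finite_support, fun ν => ⟨hΦ.smooth ν, hΦ.compact_support ν⟩⟩
    change 0 ≤ (innerProd Φ'.val (hamiltonian α ε Φ'.val)).re / (innerProd Φ'.val Φ'.val).re
    rw [re_inner_hamiltonian, ← SmoothVec.norm_sq]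
    exact div_nonneg (energy_nonneg _ _ _) (sq_nonneg _)
  refine (csInf_le hbdd ⟨Ψ.val, hΨ, ?_, rfl⟩).trans ?_
  · intro h0
    have : Ψ = 0 := SmoothVec.ext_val (by rw [h0, map_zero])
    rw [this] at h1
    simp at h1
  · rw [re_inner_hamiltonian, ← SmoothVec.norm_sq]
    exact (div_le_iff₀ h1).2 hE

/-- For coupling `a s²` and frequency `Λ` the squeezing is `τ = y/(y + 2)` with `y = s √(a/Λ)`. Then
`(1 - τ)/(1 + τ) = 1/(1 + y)`, the photon number is `y²/(4(1 + y))`, and the total is `(5/4) Λ y²/(1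
+ y)`. Dropping `y/(1 + y) ≤ 1` leaves a bound linear in `s`, which is why the trace of a square
root appears. -/
theorem coupled_oscillator_le {a Λ s : ℝ} (ha : 0 < a) (hΛ : 0 < Λ) (hs : 0 ≤ s) :
    a * (s ^ 2 * ((1 - Real.sqrt (a / Λ) * s / (Real.sqrt (a / Λ) * s + 2)) /
      (1 + Real.sqrt (a / Λ) * s / (Real.sqrt (a / Λ) * s + 2)))) +
      Λ * ((Real.sqrt (a / Λ) * s / (Real.sqrt (a / Λ) * s + 2)) ^ 2 /
        (1 - (Real.sqrt (a / Λ) * s / (Real.sqrt (a / Λ) * s + 2)) ^ 2)) ≤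
      5 / 4 * Real.sqrt (a * Λ) * s := by
  set κ := Real.sqrt (a / Λ) with hκ
  have hκ0 : 0 < κ := Real.sqrt_pos.2 (div_pos ha hΛ)
  have hκ2 : κ ^ 2 * Λ = a := by
    rw [hκ, Real.sq_sqrt (div_pos ha hΛ).le, div_mul_cancel₀ _ hΛ.ne']
  have hκΛ : Real.sqrt (a * Λ) = κ * Λ := by
    rw [← hκ2, show κ ^ 2 * Λ * Λ = (κ * Λ) ^ 2 by ring, Real.sqrt_sq (by positivity)]
  rw [hκΛ, ← hκ2]
  set y := κ * s with hy
  have hy0 : 0 ≤ y := by positivity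
  have e1 : (1 - y / (y + 2)) / (1 + y / (y + 2)) = 1 / (1 + y) := by
    field_simp; ring
  have e2 : (y / (y + 2)) ^ 2 / (1 - (y / (y + 2)) ^ 2) = y ^ 2 / (4 * (1 + y)) := by
    have h1 : 1 - (y / (y + 2)) ^ 2 = 4 * (1 + y) / (y + 2) ^ 2 := by field_simp; ring
    rw [h1]; field_simp
  rw [e1, e2]
  have e3 : κ ^ 2 * Λ * (s ^ 2 * (1 / (1 + y))) + Λ * (y ^ 2 / (4 * (1 + y))) =
      5 / 4 * Λ * (y * (y / (1 + y))) := by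
    rw [hy]; field_simp; ring
  have e4 : y / (1 + y) ≤ 1 := (div_le_one (by positivity)).2 (by linarith)
  rw [e3, show 5 / 4 * (κ * Λ) * s = 5 / 4 * Λ * (y * 1) by rw [hy]; ring]
  gcongr

theorem bosonEnergy_le_of_box (hL : 0 < L) (hΛL : 2 * Real.pi / L < Λ)
    {ε : (Fin 3 → ℤ) → Fin 2 → Space} (hε : IsPolarization L Λ ε) {α : ℝ} (hα : 0 < α) (hN : 1 ≤ N)
    {η : ℝ → ℝ} (hη : ContDiff ℝ (⊤ : ℕ∞) η) (h0 : ∀ t, 1 ≤ |t| → η t = 0) (h1 : ∫ t, η t ^ 2 = 1)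
    {r : ℝ} (hr : 0 < r) (hrΛ : 1 ≤ r * Λ) {θ : ℝ} (hθ : 0 < θ) :
    bosonEnergy L Λ α ε N ≤ N * (3 * ((∫ t, deriv η t ^ 2) / r ^ 2)) + 5 / 4 * Real.sqrt (N * α * Λ) *
      ((2 * θ)⁻¹ * ((3 + 2 * ∫ t, deriv η t ^ 2) ^ 3 * Λ ^ 2) + 3 / 2 * θ * (r * Λ) ^ 3) := by
  have hΛ : 0 < Λ := lt_trans (by positivity) hΛL
  have hN0 : (0 : ℝ) < N := by exact_mod_cast hN
  set φ := boxFn (dilate r η)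
  have hφ : ContDiff ℝ (⊤ : ℕ∞) φ := contDiff_boxFn (contDiff_dilate hη)
  have hc : HasCompactSupport φ := hasCompactSupport_boxFn (r := r) fun t ht => dilate_eq_zero hr h0 ht
  have hφ1 : ∫ x, φ x ^ 2 = 1 := integral_boxFn_sq (integral_dilate_sq hr h1)
  obtain ⟨M, b, ρ, g, hb, hf, hg⟩ := exists_diagonal_modes hε hL hφ.continuous hc
  have hg0 : ∀ m, 0 ≤ g m := by
    intro m
    have := hg m m
    rw [if_pos rfl] at this
    rw [← this]
    exact Finset.sum_nonneg fun c _ => integral_nonneg fun x =>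
      mul_nonneg (sq_nonneg _) (mul_self_nonneg _)
  have hS := sum_sqrt_le hL hΛL hε hη h0 h1 hr hrΛ hb hf hg hθ
  refine le_trans ?_ (add_le_add_right (mul_le_mul_of_nonneg_left hS (by positivity)) _)
  set κ := Real.sqrt (N * α / Λ) with hκ
  have hκ0 : 0 ≤ κ := Real.sqrt_nonneg _
  set y : Fin M → ℝ := fun m => κ * Real.sqrt (g m) with hy
  have hy0 : ∀ m, 0 ≤ y m := fun m => by positivity
  set Y := ∑ m, y m with hY
  have hY0 : 0 ≤ Y := Finset.sum_nonneg fun m _ => hy0 m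
  have hyY : ∀ m, y m ≤ Y := fun m => Finset.single_le_sum (fun m _ => hy0 m) (Finset.mem_univ m)
  set G := α * N * ∑ m, g m with hG
  have hG0 : 0 ≤ G := mul_nonneg (by positivity) (Finset.sum_nonneg fun m _ => hg0 m)
  refine le_of_forall_pos_le_add fun e he => ?_
  -- The truncation errors, weighted by the couplings, add up to `e G/(G + 1) ≤ e`; the `+ 1` covers
  -- `G = 0`.
  have hδ : 0 < e / (G + 1) := by positivity
  -- `x ↦ x/(x + 2)` is increasing, so `T = Y/(Y + 2)` bounds all squeezing parameters uniformly
  -- below `1`, also when there are no modes.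
  obtain ⟨F, hF1, hF2, hF3⟩ := exists_squeezed_state (τ := fun m => y m / (y m + 2)) hb
    (ann_vacuum (L := L) (Λ := Λ)) vacuum_hasPhotons norm_vacuum
    (fun m => div_nonneg (hy0 m) (by linarith [hy0 m])) (T := Y / (Y + 2))
    ((div_lt_one (by linarith)).2 (by linarith))
    (fun m => by
      have h2 := hyY m
      have h3 := hy0 m
      rw [div_le_div_iff₀ (by linarith) (by linarith)]
      nlinarith) hδ
  have hE := energy_tensor_productFn_le (N := N) hL hα.le hb hf hg hφ hc hφ1 F
  have hn := norm_tensor_productFn (N := N) hφ hc hφ1 F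
  refine bosonEnergy_le_of_energy_le (tensor F (productFn N φ) (productFn_admissible hφ hc))
    (tensor_isBosonic hφ hc F) (by rw [hn]; linarith) ?_
  rw [hn]
  refine hE.trans ?_
  rw [sum_integral_fderiv_boxFn_sq (contDiff_dilate hη) (integral_dilate_sq hr h1),
    integral_deriv_dilate_sq hr hη]
  have k1 : α * N * ∑ m, g m * ‖annB b m F + creB b m F‖ ^ 2 ≤
      α * N * ∑ m, g m * (((1 - y m / (y m + 2)) / (1 + y m / (y m + 2)) + e / (G + 1)) * ‖F‖ ^ 2) := by
    refine mul_le_mul_of_nonneg_left ?_ (by positivity)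
    exact Finset.sum_le_sum fun m _ => mul_le_mul_of_nonneg_left (hF2 m) (hg0 m)
  have k2 := mul_le_mul_of_nonneg_left hF3 hΛ.le
  have k3 : α * N * ∑ m, g m * (((1 - y m / (y m + 2)) / (1 + y m / (y m + 2)) + e / (G + 1)) * ‖F‖ ^ 2) +
      Λ * ((∑ m, (y m / (y m + 2)) ^ 2 / (1 - (y m / (y m + 2)) ^ 2)) * ‖F‖ ^ 2) =
      (∑ m, (N * α * (Real.sqrt (g m) ^ 2 * ((1 - y m / (y m + 2)) / (1 + y m / (y m + 2)))) +
        Λ * ((y m / (y m + 2)) ^ 2 / (1 - (y m / (y m + 2)) ^ 2))) + e * (G / (G + 1))) * ‖F‖ ^ 2 := by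
    have k4 : e * (G / (G + 1)) = ∑ m, α * N * g m * (e / (G + 1)) := by
      rw [← Finset.sum_mul, ← Finset.mul_sum, ← hG]; ring
    rw [k4, ← Finset.sum_add_distrib, Finset.sum_mul, Finset.sum_mul, Finset.mul_sum, Finset.mul_sum,
      ← Finset.sum_add_distrib]
    refine Finset.sum_congr rfl fun m _ => ?_
    rw [Real.sq_sqrt (hg0 m)]
    ring
  have k5 : ∑ m, (N * α * (Real.sqrt (g m) ^ 2 * ((1 - y m / (y m + 2)) / (1 + y m / (y m + 2)))) +
        Λ * ((y m / (y m + 2)) ^ 2 / (1 - (y m / (y m + 2)) ^ 2))) ≤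
      5 / 4 * Real.sqrt (N * α * Λ) * ∑ m, Real.sqrt (g m) := by
    rw [Finset.mul_sum]
    exact Finset.sum_le_sum fun m _ => coupled_oscillator_le (by positivity) hΛ (Real.sqrt_nonneg _)
  have k6 : e * (G / (G + 1)) ≤ e :=
    mul_le_of_le_one_right he.le ((div_le_one (by positivity)).2 (by linarith))
  have k7 := mul_le_mul_of_nonneg_right (add_le_add k5 k6) (sq_nonneg ‖F‖)
  rw [← k3] at k7
  nlinarith [k1, k2, k7]

theorem rpow_fourteenth_pow {x : ℝ} (hx : 0 ≤ x) (n : ℕ) :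
    (x ^ (1 / 14 : ℝ)) ^ n = x ^ ((n : ℝ) / 14) := by
  rw [← Real.rpow_natCast, ← Real.rpow_mul hx]
  congr 1
  ring

theorem exists_bosonEnergy_upper_bound : ∃ C : ℝ, 0 < C ∧ ∀ (L Λ α : ℝ) (N : ℕ)
    (ε : (Fin 3 → ℤ) → Fin 2 → Space), 0 < L → 2 * Real.pi / L < Λ → IsPolarization L Λ ε → 0 < α →
    α ≤ Λ → 1 ≤ N →
    bosonEnergy L Λ α ε N ≤
      C * (N : ℝ) ^ (5 / 7 : ℝ) * α ^ (2 / 7 : ℝ) * Λ ^ (12 / 7 : ℝ) := by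
  obtain ⟨η, hη, h0, h1⟩ := exists_profile
  set I := ∫ t, deriv η t ^ 2 with hI
  have hI0 : 0 ≤ I := integral_nonneg fun t => sq_nonneg _
  refine ⟨3 * I + 5 / 8 * ((3 + 2 * I) ^ 3 + 3), by positivity, ?_⟩
  intro L Λ α N ε hL hΛL hε hα hαΛ hN
  have hΛ : 0 < Λ := lt_trans (by positivity) hΛL
  have hN1 : (1 : ℝ) ≤ N := by exact_mod_cast hN
  have hN0 : (0 : ℝ) < N := by linarith
  -- Fourteenth roots turn every exponent, including those from `√(NαΛ)` and `(rΛ)^(3/2)`, into an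
  -- integer.
  set n := (N : ℝ) ^ (1 / 14 : ℝ) with hn
  set a := α ^ (1 / 14 : ℝ) with ha
  set l := Λ ^ (1 / 14 : ℝ) with hl
  have hn1 : 1 ≤ n := Real.one_le_rpow hN1 (by norm_num)
  have hn0 : 0 < n := by linarith
  have ha0 : 0 < a := Real.rpow_pos_of_pos hα _
  have hl0 : 0 < l := Real.rpow_pos_of_pos hΛ _
  have hal : a ≤ l := Real.rpow_le_rpow hα.le hαΛ (by norm_num)
  have hn14 : (N : ℝ) = n ^ 14 := by rw [rpow_fourteenth_pow hN0.le]; norm_num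
  have ha14 : α = a ^ 14 := by rw [rpow_fourteenth_pow hα.le]; norm_num
  have hl14 : Λ = l ^ 14 := by rw [rpow_fourteenth_pow hΛ.le]; norm_num
  have t1 : (N : ℝ) ^ (5 / 7 : ℝ) = n ^ 10 := by rw [rpow_fourteenth_pow hN0.le]; norm_num
  have t2 : α ^ (2 / 7 : ℝ) = a ^ 4 := by rw [rpow_fourteenth_pow hα.le]; norm_num
  have t3 : Λ ^ (12 / 7 : ℝ) = l ^ 24 := by rw [rpow_fourteenth_pow hΛ.le]; norm_num
  have t4 : Real.sqrt (N * α * Λ) = n ^ 7 * a ^ 7 * l ^ 7 := by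
    rw [hn14, ha14, hl14, show n ^ 14 * a ^ 14 * l ^ 14 = (n ^ 7 * a ^ 7 * l ^ 7) ^ 2 by ring,
      Real.sqrt_sq (by positivity)]
  have hrΛ : 1 ≤ n ^ 2 / (a ^ 2 * l ^ 12) * Λ := by
    have e : n ^ 2 / (a ^ 2 * l ^ 12) * Λ = (n * (l / a)) ^ 2 := by
      rw [hl14]; field_simp
    rw [e]
    refine one_le_pow₀ (one_le_mul_of_one_le_of_one_le hn1 ((one_le_div ha0).2 hal))
  -- `r = N^(1/7) α^(-1/7) Λ^(-6/7)` balances localization against field energy, and `θ = Λ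
  -- (rΛ)^(-3/2)` balances the two Hilbert–Schmidt factors. All terms then have the same order; `α ≤
  -- Λ` was needed for `rΛ ≥ 1`.
  have h := bosonEnergy_le_of_box (N := N) hL hΛL hε hα hN hη h0 h1
    (r := n ^ 2 / (a ^ 2 * l ^ 12)) (by positivity) hrΛ (θ := l ^ 14 / (n * l / a) ^ 3) (by positivity)
  refine h.trans (le_of_eq ?_)
  rw [t1, t2, t3, t4, hn14, hl14, ← hI]
  field_simp
  ring

/-! ### The lower bound for the energy and the conclusion -/

theorem exists_isBosonic_ne_zero (L Λ : ℝ) (N : ℕ) : ∃ Ψ : WaveFn L Λ N, IsBosonic Ψ ∧ Ψ ≠ 0 := by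
  obtain ⟨η, hη, h0, h1⟩ := exists_profile
  have hφ := contDiff_boxFn hη
  have hc := hasCompactSupport_boxFn h0
  refine ⟨_, tensor_isBosonic (N := N) hφ hc (vacuum L Λ), fun h => ?_⟩
  have hn := norm_tensor_productFn (N := N) hφ hc (integral_boxFn_sq h1) (vacuum L Λ)
  rw [show tensor (vacuum L Λ) (productFn N (boxFn η)) (productFn_admissible hφ hc) = 0 from
    SmoothVec.ext_val (by rw [h, map_zero]), norm_zero, norm_vacuum] at hn
  exact zero_ne_one hn

theorem rpow_three_halves {x : ℝ} (hx : 0 < x) : x ^ (3 / 2 : ℝ) = x * Real.sqrt x := by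
  rw [show (3 / 2 : ℝ) = 1 + 1 / 2 by norm_num, Real.rpow_add hx, Real.rpow_one, Real.sqrt_eq_rpow]

/-- Mode counting gives `Nρ/2 ≥ N Λ³/(256 π³)`, the origin of the constant. Half of the main term is
spent on the zero-point loss. -/
theorem bosonEnergy_lower_bound (hL : 0 < L) (hΛL : 2 * Real.pi / L < Λ)
    {ε : (Fin 3 → ℤ) → Fin 2 → Space} (hε : IsPolarization L Λ ε) {α : ℝ} (hα : 0 < α)
    (hαΛ : 256 * Real.pi ^ 3 / α ≤ Λ) (hN : 1 ≤ N) :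
    1 / (2 * Real.sqrt (256 * Real.pi ^ 3)) * Real.sqrt N * Real.sqrt α * Λ ^ (3 / 2 : ℝ) ≤
      bosonEnergy L Λ α ε N := by
  have hpi := Real.pi_pos
  have hΛ : 0 < Λ := lt_trans (by positivity) hΛL
  have hN1 : (1 : ℝ) ≤ N := by exact_mod_cast hN
  have hcard : Fintype.card (Mode L Λ) = (modes L Λ).card * 2 := by
    rw [Fintype.card_prod, Fintype.card_coe, Fintype.card_fin]
  have hM : 0 < Fintype.card (Mode L Λ) := by
    rw [hcard]; exact Nat.mul_pos (card_modes_pos hL hΛL) two_pos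
  set c := Real.sqrt (256 * Real.pi ^ 3) with hc
  have hc0 : 0 < c := Real.sqrt_pos.2 (by positivity)
  have hc2 : c ^ 2 = 256 * Real.pi ^ 3 := Real.sq_sqrt (by positivity)
  have h1 : Real.sqrt N * (Λ * Real.sqrt Λ) / c ≤
      Real.sqrt (N * ((Fintype.card (Mode L Λ) : ℝ) / (2 * L ^ 3)) / 2) := by
    refine Real.le_sqrt_of_sq_le ?_
    have h2 := card_modes_ge hL hΛL
    rw [hcard]
    push_cast
    have e1 : (Real.sqrt N * (Λ * Real.sqrt Λ) / c) ^ 2 =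
        N * (((Λ * L / (2 * Real.pi)) ^ 3 / 16) * 2 / (2 * L ^ 3)) / 2 := by
      rw [div_pow, mul_pow, mul_pow, Real.sq_sqrt (by linarith), Real.sq_sqrt hΛ.le, hc2]
      field_simp
      ring
    rw [e1]
    gcongr
  -- This is where `Λ` must be large compared with `1/α`: the threshold is `√(αΛ) ≥ √(256 π³)`.
  have h3 : Λ / 2 ≤ 1 / 2 * (Real.sqrt α * (Real.sqrt N * (Λ * Real.sqrt Λ) / c)) := by
    have e1 : c ≤ Real.sqrt α * Real.sqrt Λ := by
      rw [hc, ← Real.sqrt_mul hα.le]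
      refine Real.sqrt_le_sqrt ?_
      have e := (div_le_iff₀ hα).1 hαΛ
      linarith
    have e2 : 1 ≤ Real.sqrt N := Real.one_le_sqrt.2 hN1
    have e3 : 1 ≤ Real.sqrt α * Real.sqrt Λ / c := (one_le_div hc0).2 e1
    have e4 : Real.sqrt α * (Real.sqrt N * (Λ * Real.sqrt Λ) / c) =
        Λ * (Real.sqrt N * (Real.sqrt α * Real.sqrt Λ / c)) := by ring
    rw [e4]
    have e5 := mul_le_mul_of_nonneg_left (one_le_mul_of_one_le_of_one_le e2 e3) hΛ.le
    linarith
  obtain ⟨Ψ₀, hΨ₀, hne⟩ := exists_isBosonic_ne_zero L Λ N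
  refine le_csInf ⟨_, Ψ₀, hΨ₀, hne, rfl⟩ ?_
  rintro _ ⟨Φ, hΦ, hΦ0, rfl⟩
  set Ψ : SmoothVec L Λ N := ⟨Φ, hΦ.finite_support, fun ν => ⟨hΦ.smooth ν, hΦ.compact_support ν⟩⟩
  change _ ≤ (innerProd Ψ.val (hamiltonian α ε Ψ.val)).re / (innerProd Ψ.val Ψ.val).re
  rw [re_inner_hamiltonian, ← SmoothVec.norm_sq]
  have hpos : 0 < ‖Ψ‖ ^ 2 := by
    have : Ψ ≠ 0 := fun h => hΦ0 (by
      have e := congrArg SmoothVec.val h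
      rw [map_zero] at e
      exact e)
    positivity
  rw [le_div_iff₀ hpos]
  refine le_trans (mul_le_mul_of_nonneg_right ?_ hpos.le) (energy_lower_bound hL hε hN Ψ hM)
  rw [rpow_three_halves hΛ]
  have h4 := mul_le_mul_of_nonneg_left h1 (Real.sqrt_nonneg α)
  have e6 : 1 / (2 * c) * Real.sqrt N * Real.sqrt α * (Λ * Real.sqrt Λ) =
      1 / 2 * (Real.sqrt α * (Real.sqrt N * (Λ * Real.sqrt Λ) / c)) := by field_simp
  rw [e6]
  linarith

end

end NRQED

theorem theorem3 :
    ∃ C₁ C₂ : ℝ, 0 < C₁ ∧ 0 < C₂ ∧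
      ∀ α : ℝ, 0 < α → ∃ Λ₀ : ℝ, 0 < Λ₀ ∧ ∀ Λ : ℝ, Λ₀ ≤ Λ →
        ∀ L : ℝ, 0 < L → 2 * Real.pi / L < Λ →
          ∀ ε : (Fin 3 → ℤ) → Fin 2 → NRQED.Space, NRQED.IsPolarization L Λ ε →
            (∀ N : ℕ, 1 ≤ N →
              C₁ * Real.sqrt N * Real.sqrt α * Λ ^ (3 / 2 : ℝ) ≤ NRQED.bosonEnergy L Λ α ε N ∧
              NRQED.bosonEnergy L Λ α ε N ≤
                C₂ * (N : ℝ) ^ (5 / 7 : ℝ) * α ^ (2 / 7 : ℝ) * Λ ^ (12 / 7 : ℝ)) ∧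
            Filter.Tendsto (fun N : ℕ => NRQED.bosonEnergy L Λ α ε N / N) Filter.atTop (nhds 0) ∧
            ∃ N₀ : ℕ, ∀ N : ℕ, N₀ ≤ N →
              NRQED.bosonEnergy L Λ α ε N < N * NRQED.bosonEnergy L Λ α ε 1 := by
  have hpi := Real.pi_pos
  obtain ⟨C₂, hC₂, hup⟩ := NRQED.exists_bosonEnergy_upper_bound
  -- In the threshold for `Λ`, `α` serves the upper bound (`rΛ ≥ 1`) and `256 π³ / α` serves the
  -- lower bound.
  refine ⟨1 / (2 * Real.sqrt (256 * Real.pi ^ 3)), C₂, by positivity, hC₂, fun α hα =>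
    ⟨max α (256 * Real.pi ^ 3 / α), lt_max_of_lt_left hα, fun Λ hΛ₀ L hL hΛL ε hε => ?_⟩⟩
  have hΛ : 0 < Λ := lt_trans (by positivity) hΛL
  have hlow := fun (N : ℕ) (hN : 1 ≤ N) =>
    NRQED.bosonEnergy_lower_bound (N := N) hL hΛL hε hα ((le_max_right _ _).trans hΛ₀) hN
  have hupN := fun (N : ℕ) (hN : 1 ≤ N) =>
    hup L Λ α N ε hL hΛL hε hα ((le_max_left _ _).trans hΛ₀) hN
  have hlim : Filter.Tendsto (fun N : ℕ => NRQED.bosonEnergy L Λ α ε N / N) Filter.atTop (nhds 0) := by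
    have h1 : Filter.Tendsto (fun N : ℕ => C₂ * α ^ (2 / 7 : ℝ) * Λ ^ (12 / 7 : ℝ) *
        (N : ℝ) ^ (-(2 / 7) : ℝ)) Filter.atTop (nhds 0) := by
      have h := ((tendsto_rpow_neg_atTop (y := 2 / 7) (by norm_num)).comp
        tendsto_natCast_atTop_atTop).const_mul (C₂ * α ^ (2 / 7 : ℝ) * Λ ^ (12 / 7 : ℝ))
      rw [mul_zero] at h
      exact h
    refine squeeze_zero' ?_ ?_ h1
    · filter_upwards [Filter.eventually_ge_atTop 1] with N hN
      exact div_nonneg (le_trans (by positivity) (hlow N hN)) (Nat.cast_nonneg N)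
    · filter_upwards [Filter.eventually_ge_atTop 1] with N hN
      have hN0 : (0 : ℝ) < N := by exact_mod_cast hN
      rw [div_le_iff₀ hN0]
      refine (hupN N hN).trans (le_of_eq ?_)
      have h2 : (N : ℝ) ^ (5 / 7 : ℝ) = (N : ℝ) ^ (-(2 / 7) : ℝ) * N := by
        nth_rewrite 3 [← Real.rpow_one (N : ℝ)]
        rw [← Real.rpow_add hN0]
        norm_num
      rw [h2]
      ring
  refine ⟨fun N hN => ⟨hlow N hN, hupN N hN⟩, hlim, ?_⟩
  -- Binding needs only that the energy per particle eventually drops below the positive energy of a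
  -- single particle.
  have h1 : 0 < NRQED.bosonEnergy L Λ α ε 1 := lt_of_lt_of_le (by positivity) (hlow 1 le_rfl)
  obtain ⟨N₀, hN₀⟩ := Filter.eventually_atTop.1 (hlim.eventually_lt_const h1)
  refine ⟨max N₀ 1, fun N hN => ?_⟩
  have hN0 : (0 : ℝ) < N := by exact_mod_cast (le_max_right _ _).trans hN
  have h2 := hN₀ N ((le_max_left _ _).trans hN)
  rwa [div_lt_iff₀ hN0, mul_comm] at h2
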